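/- **Balancing condition for the mean curvature of constant curvature balls.** Let $\kappa\in\mathbb R$, let $B^3$ be the closed unit ball with boundary $S^2$, and let $\gamma_{+1}$ be the round metric of $S^2(1)$. 1. Let $g$ be a Riemannian metric on $B^3$, of class $C^2$ up to the boundary (for instance $C^{m,\alpha}$ with $m\ge 2$), of constant sectional curvature $\kappa$. Let $\gamma=g|_{TS^2}$ be the induced boundary metric and let $H$ be the mean curvature of $S^2=\partial B^3\subset(B^3,g)$ with respect to the outward unit normal, that is, the $\gamma$-trace of the second fundamental form $A(u,v)=g(\nabla_u\nu,v)$. Then $H$ is of class $C^1$, and for every ($C^1$) conformal Killing field $X$ of $(S^2,\gamma)$, that is, every tangent field with $\mathcal L_X\gamma=\mu\gamma$ for some function $\mu$, the function $X(H)$ is integrable and $$\int_{S^2}X(H)\,dV_\gamma=0 .$$ 2. If moreover $\gamma$ is pointwise conformal to $\gamma_{+1}$, then $H$ is not a non-constant monotone function of a height function on $S^2(1)$. That is, there are no unit vector $a\in\mathbb R^3$ and monotone (non-decreasing or non-increasing) function $f:[-1,1]\to\mathbb R$ such that $H$ is non-constant and $H(x)=f(\langle a,x\rangle)$ for all $x\in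 S^2$. 3. More generally, let $(N,g)$ be any smooth Riemannian $3$-manifold of constant sectional curvature $\kappa$ (for instance a space form), and let $F:S^2(1)\to N$ be a conformal immersion of class $C^3$ (that is, $F^*g=\rho\,\gamma_{+1}$ with $\rho>0$), not necessarily extending to a ball. Then the mean curvature of $F$ with respect to a continuous unit normal field is not a non-constant monotone function of a height function on $S^2(1)$. -/

import Mathlib

open Set Metric MeasureTheory
open scoped Manifold ContDiff RealInnerProductSpace

noncomputable section

namespace Balancing

/-- Euclidean three-space. -/
abbrev E3 : Type := EuclideanSpace ℝ (Fin 3)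

/-- The unit sphere `S²` in Euclidean three-space. -/
abbrev S2 : Type := sphere (0 : E3) 1

/-- The closed unit ball `B³` in Euclidean three-space. -/
abbrev B3 : Set E3 := closedBall (0 : E3) 1

/-! ### Metrics and curvature in coordinates

A metric in coordinates on `s ⊆ ℝ³` is a field of symmetric positive definite matrices
`G x = (g_{ij}(x))`, `x ∈ s`; only its values on `s` matter. -/

/-- The bilinear form `∑ m_{ij} u^i v^j` of a matrix. -/
def form (m : Matrix (Fin 3) (Fin 3) ℝ) (u v : E3) : ℝ :=
  ∑ i, ∑ j, m i j * u i * v j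

/-- The partial derivative `∂_i f` at `x`, taken within `s`
(one-sided at boundary points of `s`). -/
def pd (s : Set E3) (i : Fin 3) (f : E3 → ℝ) (x : E3) : ℝ :=
  fderivWithin ℝ f s x (EuclideanSpace.single i 1)

/-- The Christoffel symbols
`Γ^k_{ij} = ½ ∑_l g^{kl} (∂_i g_{jl} + ∂_j g_{il} - ∂_l g_{ij})`. -/
def christoffel (s : Set E3) (G : E3 → Matrix (Fin 3) (Fin 3) ℝ) (k i j : Fin 3) (x : E3) : ℝ :=
  (1 / 2) * ∑ l, (G x)⁻¹ k l *
    (pd s i (fun y => G y j l) x + pd s j (fun y => G y i l) x - pd s l (fun y => G y i j) x)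

/-- The components `R^l_{kij}` of the curvature tensor, `R(∂_i, ∂_j) ∂_k = ∑_l R^l_{kij} ∂_l`. -/
def riemann (s : Set E3) (G : E3 → Matrix (Fin 3) (Fin 3) ℝ) (l k i j : Fin 3) (x : E3) : ℝ :=
  pd s i (christoffel s G l j k) x - pd s j (christoffel s G l i k) x
    + ∑ m, (christoffel s G l i m x * christoffel s G m j k x
        - christoffel s G l j m x * christoffel s G m i k x)

/-- `g(R(u, v) v, u)`, the numerator of the sectional curvature of the plane spanned by `u, v`. -/
def curvNum (s : Set E3) (G : E3 → Matrix (Fin 3) (Fin 3) ℝ) (x u v : E3) : ℝ :=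
  ∑ p, ∑ l, ∑ k, ∑ i, ∑ j, G x p l * riemann s G l k i j x * u i * v j * v k * u p

/-- All sectional curvatures `g(R(u,v)v,u) / (|u|²|v|² - ⟨u,v⟩²)` on `s` are equal to `κ`. -/
def HasConstCurv (s : Set E3) (G : E3 → Matrix (Fin 3) (Fin 3) ℝ) (κ : ℝ) : Prop :=
  ∀ x ∈ s, ∀ u v : E3, LinearIndependent ℝ ![u, v] →
    curvNum s G x u v / (form (G x) u u * form (G x) v v - form (G x) u v ^ 2) = κ

/-! ### Calculus on the sphere

Maps on `S²` are differentiated through their extensions that are constant along rays; on vectors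
tangent to `S²` this is the differential of the map. -/

/-- The radial projection `y ↦ y / |y|` onto `S²` (with an irrelevant value at the origin). -/
def radialProj (y : E3) : S2 :=
  if h : y = 0 then ⟨EuclideanSpace.single 0 1, by simp⟩
  else ⟨‖y‖⁻¹ • y, by simp [norm_smul, h]⟩

variable {V : Type*} [NormedAddCommGroup V] [NormedSpace ℝ V]

/-- The derivative of `f : S² → V` at `x` in the direction of a tangent vector `u ⟂ x`. -/
def sD (f : S2 → V) (x : S2) (u : E3) : V :=
  fderiv ℝ (fun y : E3 => f (radialProj y)) (x : E3) u

/-- The second derivative of `f : S² → V` at `x` on tangent vectors `u, v ⟂ x`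
(its Hessian with respect to the round metric). -/
def sD2 (f : S2 → V) (x : S2) (u v : E3) : V :=
  fderiv ℝ (fun y : E3 => fderiv ℝ (fun z : E3 => f (radialProj z)) y u) (x : E3) v

/-- A basis of `T_x S² = x^⊥`, orthonormal for the round metric. -/
def frame (x : S2) :
    OrthonormalBasis (Fin (Module.finrank ℝ (ℝ ∙ (x : E3))ᗮ)) ℝ (ℝ ∙ (x : E3))ᗮ :=
  stdOrthonormalBasis ℝ (ℝ ∙ (x : E3))ᗮ

/-! ### Second fundamental form and mean curvature -/

/-- The vector `Γ_p(u, v) = (∑ Γ^k_{ij}(p) u^i v^j)_k`. -/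
def christoffelVec (s : Set E3) (G : E3 → Matrix (Fin 3) (Fin 3) ℝ) (p u v : E3) : E3 :=
  WithLp.toLp 2 fun k => ∑ i, ∑ j, christoffel s G k i j p * u i * v j

/-- The second fundamental form at `x` of a map `f` of `S²` into `(s, G)`, with respect to the unit
normal `n` at `f x`: `A(u, v) = -g(∇_u df(v), n) = g(∇_u n, df(v))`. -/
def secondFF (s : Set E3) (G : E3 → Matrix (Fin 3) (Fin 3) ℝ) (f : S2 → E3) (n : E3) (x : S2)
    (u v : E3) : ℝ :=
  - form (G (f x)) (sD2 f x u v + christoffelVec s G (f x) (sD f x u) (sD f x v)) n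

/-- The mean curvature `H = tr A = ∑ γ^{ab} A_{ab}`, the trace being taken with respect to the first
fundamental form `γ_{ab} = g(df(e_a), df(e_b))`. -/
def meanCurv (s : Set E3) (G : E3 → Matrix (Fin 3) (Fin 3) ℝ) (f : S2 → E3) (n : E3)
    (x : S2) : ℝ :=
  Matrix.trace
    ((Matrix.of fun a b => form (G (f x)) (sD f x (frame x a)) (sD f x (frame x b)))⁻¹ *
      (Matrix.of fun a b => secondFF s G f n x (frame x a) (frame x b)))

/-! ### Constant curvature metrics on the ball and their boundary data -/

/-- `G` is a Riemannian metric on the closed ball `B³`, of class `C²` up to the boundary, of constant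
sectional curvature `κ`. -/
structure IsConstCurvMetricOnBall (G : E3 → Matrix (Fin 3) (Fin 3) ℝ) (κ : ℝ) : Prop where
  contDiffOn : ∀ i j, ContDiffOn ℝ 2 (fun x => G x i j) B3
  posDef : ∀ x ∈ B3, (G x).PosDef
  constCurv : HasConstCurv B3 G κ

/-- `ν` is the outward unit normal field of `∂B³ = S²` with respect to the metric `G`. -/
structure IsOutwardUnitNormal (G : E3 → Matrix (Fin 3) (Fin 3) ℝ) (ν : S2 → E3) : Prop where
  unit : ∀ x : S2, form (G x) (ν x) (ν x) = 1
  normal : ∀ x : S2, ∀ u : E3, ⟪(x : E3), u⟫ = 0 → form (G x) (ν x) u = 0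
  outward : ∀ x : S2, 0 < ⟪(x : E3), ν x⟫

/-- The mean curvature of `∂B³ ⊂ (B³, G)` with respect to the normal field `ν`. -/
def boundaryMeanCurv (G : E3 → Matrix (Fin 3) (Fin 3) ℝ) (ν : S2 → E3) (x : S2) : ℝ :=
  meanCurv B3 G (fun y : S2 => (y : E3)) (ν x) x

/-! The boundary metric `γ` is the restriction of `G x`, `x ∈ S²`, to pairs of tangent vectors. -/

/-- The density `dV_γ / dA` of the area form of `γ = G|_{TS²}` with respect to the area `dA` of the
round metric: the square root of the determinant of `γ` in a round orthonormal frame. -/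
def areaDensity (G : E3 → Matrix (Fin 3) (Fin 3) ℝ) (x : S2) : ℝ :=
  Real.sqrt (Matrix.det (Matrix.of fun a b => form (G x) (frame x a) (frame x b)))

/-- The area measure of the round unit sphere. -/
def roundArea : Measure S2 := (volume : Measure E3).toSphere

/-- The Lie derivative `(L_X γ)(u, v)` of `γ = G|_{TS²}`, for `u, v` tangent to `S²` at `x`. -/
def lieDeriv (G : E3 → Matrix (Fin 3) (Fin 3) ℝ) (X : S2 → E3) (x : S2) (u v : E3) : ℝ :=
  sD (fun y : S2 => form (G y) u v) x (X x)
    + form (G x) (sD X x u) v + form (G x) u (sD X x v)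

/-- `X` is a (`C¹`, tangential) conformal Killing field of `(S², γ)`, where `γ = G|_{TS²}`:
`L_X γ = μ γ` for some function `μ`. -/
structure IsConformalKilling (G : E3 → Matrix (Fin 3) (Fin 3) ℝ) (X : S2 → E3) : Prop where
  contMDiff : ContMDiff (𝓡 2) 𝓘(ℝ, E3) 1 X
  tangent : ∀ x : S2, ⟪(x : E3), X x⟫ = 0
  conformal : ∃ μ : S2 → ℝ, ∀ x : S2, ∀ u v : E3, ⟪(x : E3), u⟫ = 0 → ⟪(x : E3), v⟫ = 0 →
    lieDeriv G X x u v = μ x * form (G x) u v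

/-- The boundary metric `γ = G|_{TS²}` is (pointwise) conformal to the round metric of `S²(1)`. -/
def IsConformalToRound (G : E3 → Matrix (Fin 3) (Fin 3) ℝ) : Prop :=
  ∃ ρ : S2 → ℝ, (∀ x, 0 < ρ x) ∧ ∀ x : S2, ∀ u v : E3,
    ⟪(x : E3), u⟫ = 0 → ⟪(x : E3), v⟫ = 0 → form (G x) u v = ρ x * ⟪u, v⟫

/-- `H` is a non-constant monotone (non-decreasing or non-increasing) function of a height function
`x ↦ ⟪a, x⟫`, `|a| = 1`, on `S²(1)`. -/
def IsMonotoneOfHeight (H : S2 → ℝ) : Prop :=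
  (∃ x y, H x ≠ H y) ∧
    ∃ a : E3, ‖a‖ = 1 ∧ ∃ f : ℝ → ℝ,
      (MonotoneOn f (Icc (-1) 1) ∨ AntitoneOn f (Icc (-1) 1)) ∧ ∀ x : S2, H x = f ⟪a, (x : E3)⟫

/-! ### Conformal immersions of the sphere in three-manifolds of constant curvature -/

section Immersion

variable {N : Type*} [TopologicalSpace N] [ChartedSpace E3 N] [IsManifold (𝓡 3) ∞ N]

/-- Smooth Riemannian metrics on the three-manifold `N`. -/
abbrev SmoothMetric (N : Type*) [TopologicalSpace N] [ChartedSpace E3 N] [IsManifold (𝓡 3) ∞ N] :=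
  Bundle.ContMDiffRiemannianMetric (𝓡 3) ∞ E3 (fun p : N => TangentSpace (𝓡 3) p)

/-- The matrix field of a metric in the coordinates of a chart `φ`, on `φ.target`. -/
def metricInChart (g : SmoothMetric N) (φ : OpenPartialHomeomorph N E3) (y : E3) :
    Matrix (Fin 3) (Fin 3) ℝ :=
  Matrix.of fun i j => g.inner (φ.symm y)
    (mfderiv (𝓡 3) (𝓡 3) φ.symm y (EuclideanSpace.single i (1 : ℝ) : E3))
    (mfderiv (𝓡 3) (𝓡 3) φ.symm y (EuclideanSpace.single j (1 : ℝ) : E3))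

/-- `(N, g)` has constant sectional curvature `κ`. -/
def IsConstCurvMetric (g : SmoothMetric N) (κ : ℝ) : Prop :=
  ∀ φ ∈ atlas E3 N, HasConstCurv φ.target (metricInChart g φ) κ

/-- `F : S²(1) → (N, g)` is a conformal immersion (of class `C³`): `F^* g = ρ γ_{+1}` with a positive
function `ρ`, where `γ_{+1}` is the round metric. -/
structure IsConformalImmersion (g : SmoothMetric N) (F : S2 → N) : Prop where
  contMDiff : ContMDiff (𝓡 2) (𝓡 3) 3 F
  conformal : ∃ ρ : S2 → ℝ, (∀ x, 0 < ρ x) ∧ ∀ (x : S2) (u v : TangentSpace (𝓡 2) x),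
    g.inner (F x) (mfderiv (𝓡 2) (𝓡 3) F x u) (mfderiv (𝓡 2) (𝓡 3) F x v) =
      ρ x * @inner ℝ E3 _ (mfderiv (𝓡 2) 𝓘(ℝ, E3) (fun y : S2 => (y : E3)) x u)
        (mfderiv (𝓡 2) 𝓘(ℝ, E3) (fun y : S2 => (y : E3)) x v)

/-- `ν` is a continuous unit normal field along `F`. -/
structure IsUnitNormalAlong (g : SmoothMetric N) (F : S2 → N)
    (ν : ∀ x : S2, TangentSpace (𝓡 3) (F x)) : Prop where
  continuous : Continuous fun x : S2 => (⟨F x, ν x⟩ : TangentBundle (𝓡 3) N)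
  unit : ∀ x : S2, g.inner (F x) (ν x) (ν x) = 1
  normal : ∀ (x : S2) (u : TangentSpace (𝓡 2) x),
    g.inner (F x) (ν x) (mfderiv (𝓡 2) (𝓡 3) F x u) = 0

/-- `H` is the mean curvature of `F` with respect to the unit normal field `ν`, as computed in the
charts of `N`. -/
def HasMeanCurv (g : SmoothMetric N) (F : S2 → N) (ν : ∀ x : S2, TangentSpace (𝓡 3) (F x))
    (H : S2 → ℝ) : Prop :=
  ∀ φ ∈ atlas E3 N, ∀ x : S2, F x ∈ φ.source →
    H x = meanCurv φ.target (metricInChart g φ) (fun y => φ (F y))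
      (mfderiv (𝓡 3) (𝓡 3) φ (F x) (ν x) : E3) x

end Immersion

end Balancing

end

noncomputable section

namespace Balancing

open Filter Topology

/-! ### Maps on S² extended with degree zero homogeneity -/

section Homogeneous

variable {V : Type*} [NormedAddCommGroup V] [NormedSpace ℝ V]

/-! Let `A°` be the trace-free part of the second fundamental form. In a space of constant curvature
the Codazzi equation gives `div A° = ½ dH`. For a conformal Killing field `X` the symmetric part of
`∇X` is a multiple of `γ`, hence orthogonal to `A°`, and so `div (A°(X)) = ½ X(H)`. Integration over
the closed surface gives the balancing condition.

The divergence is taken here as an exterior derivative. Let `Y` be `X` rotated by a right angle and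
`ω = A°(·, Y)`. Then `dω(X, Y) = -½ X(H) |X|²` (`exterior_derivative_traceless`). The ambient
curvature enters only through `g(R(X,Y)n, Y)`, which vanishes by polarization of the constant
curvature hypothesis (`form_riemannVec_normal`). Division by the oriented area of the pair `X, Y`
turns this into the statement that `-½ X(H) dV/dA` is the round divergence of a tangential `C¹`
field, wherever `X ≠ 0`. Continuity and the trivial case `X = 0` near a point extend the identity to
the whole sphere (`IsSurface.balancing`), and the divergence theorem `integral_sDiv_eq_zero`
finishes.

Everything on S² is computed in ℝ³ with extensions constant along rays. Covariant differentiation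
along a map does not need the map to be an immersion, so the degenerate radial direction is
harmless. Only the local data `IsLocalRep` enter, and these may come from a different chart at each
point; thus the boundary of a ball and an immersed sphere are both instances of `IsSurface`. There
the mean curvature and the area density are characterized by identities in `γ` and `A` without
frames, which yields their `C¹` regularity although `frame` is chosen pointwise.

For the monotonicity statements take `X = a - ⟨a,x⟩x`, the round gradient of the height function,
which is conformal Killing for every metric conformal to the round one. If `H` is a non-decreasing
function of the height, then `X(H) ≥ 0`; its weighted integral vanishes, so `X(H) = 0`, and `H` is
constant along all meridians issuing from `a`. In the non-increasing case the same applies to `-H`.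
-/

/-- The extension of a map on `S²` that is constant along rays. -/
def hom {W : Type*} (f : S2 → W) (y : E3) : W := f (radialProj y)

lemma S2.ne_zero (x : S2) : (x : E3) ≠ 0 := by
  have := norm_eq_of_mem_sphere x
  intro h
  simp [h] at this

lemma S2.norm_eq (x : S2) : ‖(x : E3)‖ = 1 := norm_eq_of_mem_sphere x

lemma S2.inner_self (x : S2) : ⟪(x : E3), (x : E3)⟫ = 1 := by
  rw [real_inner_self_eq_norm_sq, S2.norm_eq]; norm_num

lemma coe_radialProj {y : E3} (h : y ≠ 0) : (radialProj y : E3) = ‖y‖⁻¹ • y := by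
  simp [radialProj, h]

@[simp] lemma radialProj_coe (x : S2) : radialProj (x : E3) = x := by
  ext1
  rw [coe_radialProj x.ne_zero, x.norm_eq]; simp

lemma radialProj_smul {t : ℝ} (ht : 0 < t) (y : E3) : radialProj (t • y) = radialProj y := by
  by_cases h : y = 0
  · simp [h]
  · ext1
    rw [coe_radialProj h, coe_radialProj (smul_ne_zero ht.ne' h), norm_smul, smul_smul,
      Real.norm_of_nonneg ht.le, mul_inv, mul_comm t⁻¹, mul_assoc, inv_mul_cancel₀ ht.ne', mul_one]

@[simp] lemma hom_coe {W : Type*} (f : S2 → W) (x : S2) : hom f (x : E3) = f x := by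
  simp [hom]

lemma hom_smul {W : Type*} (f : S2 → W) {t : ℝ} (ht : 0 < t) (y : E3) :
    hom f (t • y) = hom f y := by
  simp [hom, radialProj_smul ht]

lemma norm_smul_radialProj {y : E3} (h : y ≠ 0) : ‖y‖ • (radialProj y : E3) = y := by
  rw [coe_radialProj h, smul_smul, mul_inv_cancel₀ (norm_ne_zero_iff.2 h), one_smul]

lemma continuousAt_radialProj {y : E3} (h : y ≠ 0) : ContinuousAt radialProj y := by
  rw [Topology.IsInducing.subtypeVal.continuousAt_iff]
  have : (Subtype.val ∘ radialProj) =ᶠ[𝓝 y] fun y : E3 => ‖y‖⁻¹ • y := by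
    filter_upwards [isOpen_ne.mem_nhds h] with z hz
    exact coe_radialProj hz
  refine ContinuousAt.congr ?_ this.symm
  have : ‖y‖ ≠ 0 := norm_ne_zero_iff.2 h
  fun_prop (disch := assumption)

lemma eventually_radialProj {p : S2 → Prop} {x : S2} (h : ∀ᶠ z in 𝓝 x, p z) :
    ∀ᶠ y in 𝓝 (x : E3), p (radialProj y) := by
  have := continuousAt_radialProj x.ne_zero
  rw [ContinuousAt, radialProj_coe] at this
  exact this.eventually h

lemma eventually_coe {p : E3 → Prop} {x : S2} (h : ∀ᶠ y in 𝓝 (x : E3), p y) :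
    ∀ᶠ z : S2 in 𝓝 x, p (z : E3) :=
  continuous_subtype_val.continuousAt.eventually h

lemma hom_eventuallyEq_smul {W : Type*} (f : S2 → W) {t : ℝ} (ht : 0 < t) :
    (fun y => hom f (t • y)) = hom f := by
  funext y; exact hom_smul f ht y

/-- Near `y` the extension equals itself precomposed with the fixed dilation by `‖y‖⁻¹`, so
regularity on the sphere spreads along rays. -/
lemma contDiffAt_hom_of_radialProj {n : ℕ∞ω} {f : S2 → V} {y : E3} (hy : y ≠ 0)
    (h : ContDiffAt ℝ n (hom f) (radialProj y : E3)) : ContDiffAt ℝ n (hom f) y := by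
  have ht : 0 < ‖y‖⁻¹ := inv_pos.2 (norm_pos_iff.2 hy)
  rw [← hom_eventuallyEq_smul f ht]
  rw [coe_radialProj hy] at h
  exact ContDiffAt.comp (f := fun z : E3 => ‖y‖⁻¹ • z) y h (contDiffAt_id.const_smul _)

/-- The derivative of a function homogeneous of degree zero has degree `-1`; this is the origin of
the powers of `‖y‖` below. -/
lemma fderiv_hom {f : S2 → V} {y : E3} (hy : y ≠ 0)
    (h : DifferentiableAt ℝ (hom f) (radialProj y : E3)) (u : E3) :
    fderiv ℝ (hom f) y u = ‖y‖⁻¹ • sD f (radialProj y) u := by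
  have ht : 0 < ‖y‖⁻¹ := inv_pos.2 (norm_pos_iff.2 hy)
  have e : hom f = hom f ∘ (fun z : E3 => ‖y‖⁻¹ • z) := (hom_eventuallyEq_smul f ht).symm
  have h' : HasFDerivAt (hom f) (fderiv ℝ (hom f) (radialProj y : E3)) (‖y‖⁻¹ • y) := by
    rw [← coe_radialProj hy]; exact h.hasFDerivAt
  have e2 := (h'.comp y ((hasFDerivAt_id y).const_smul ‖y‖⁻¹)).fderiv
  change fderiv ℝ (hom f ∘ (fun z : E3 => ‖y‖⁻¹ • z)) y = _ at e2
  rw [← e] at e2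
  rw [e2]
  simp [sD]
  rfl

lemma sD_eq {f : S2 → V} (x : S2) (u : E3) : sD f x u = fderiv ℝ (hom f) (x : E3) u := rfl

/-- Euler's identity in degree zero. -/
lemma sD_self {f : S2 → V} {x : S2} (h : DifferentiableAt ℝ (hom f) (x : E3)) :
    sD f x (x : E3) = 0 := by
  have h1 : HasDerivAt (fun t : ℝ => hom f ((1 + t) • (x : E3))) (fderiv ℝ (hom f) (x : E3) (x : E3)) 0 := by
    have h2 : HasFDerivAt (hom f) (fderiv ℝ (hom f) (x : E3)) ((1 + (0 : ℝ)) • (x : E3)) := by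
      simpa using h.hasFDerivAt
    have h3 : HasDerivAt (fun t : ℝ => (1 + t) • (x : E3)) (x : E3) 0 := by
      simpa using ((hasDerivAt_id (0 : ℝ)).const_add 1).smul_const (x : E3)
    exact h2.comp_hasDerivAt 0 h3
  have h2 : HasDerivAt (fun t : ℝ => hom f ((1 + t) • (x : E3))) 0 0 := by
    refine (hasDerivAt_const (0 : ℝ) (hom f (x : E3))).congr_of_eventuallyEq ?_
    filter_upwards [Ioi_mem_nhds (show (-1 : ℝ) < 0 by norm_num)] with t ht
    exact hom_smul f (by simp at ht; linarith) _
  exact h1.unique h2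

lemma continuous_of_hom {W : Type*} [TopologicalSpace W] {f : S2 → W} (h : ∀ x : S2, ContinuousAt (hom f) (x : E3)) :
    Continuous f := by
  have : f = fun x : S2 => hom f (x : E3) := by funext x; simp
  rw [this, continuous_iff_continuousAt]
  intro x
  exact (h x).comp continuous_subtype_val.continuousAt

lemma continuous_sD {f : S2 → V} (h : ∀ x : S2, ContDiffAt ℝ 1 (hom f) (x : E3)) :
    Continuous fun x : S2 => fderiv ℝ (hom f) (x : E3) := by
  rw [continuous_iff_continuousAt]
  intro x
  exact ContinuousAt.comp (f := fun x : S2 => (x : E3)) (g := fderiv ℝ (hom f))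
    ((h x).continuousAt_fderiv one_ne_zero) continuous_subtype_val.continuousAt

end Homogeneous

/-! ### The divergence theorem on S² -/

/-- The divergence at `x ∈ S²` of the extension of a field along `S²` that is constant along rays. -/
def sDiv (Z : S2 → E3) (x : S2) : ℝ := ∑ i, sD Z x (EuclideanSpace.single i 1) i

/-- A radial cut-off function with support in an annulus. -/
def radialBump : ContDiffBump (1 : ℝ) := ⟨1 / 4, 1 / 2, by norm_num, by norm_num⟩

/-- The radial cut-off function on Euclidean space. -/
def annulusBump (y : E3) : ℝ := radialBump (‖y‖ ^ 2)

lemma contDiff_annulusBump : ContDiff ℝ 1 annulusBump :=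
  (radialBump.contDiff (n := 1)).comp (contDiff_norm_sq ℝ)

lemma annulusBump_eq_zero {y : E3} (h : ‖y‖ ^ 2 ≤ 1 / 2 ∨ 3 / 2 ≤ ‖y‖ ^ 2) : annulusBump y = 0 := by
  refine radialBump.zero_of_le_dist ?_
  simp only [radialBump, Real.dist_eq]
  rcases h with h | h
  · rw [abs_of_nonpos] <;> linarith
  · rw [abs_of_nonneg] <;> linarith

lemma tsupport_annulusBump : tsupport annulusBump ⊆ {y : E3 | 1 / 2 ≤ ‖y‖ ^ 2 ∧ ‖y‖ ^ 2 ≤ 3 / 2} := by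
  refine closure_minimal ?_ ?_
  · intro y hy
    by_contra h
    apply hy
    apply annulusBump_eq_zero
    simp only [mem_ofPred_eq, not_and_or, not_le] at h
    exact h.imp le_of_lt le_of_lt
  · exact (isClosed_le continuous_const (continuous_norm.pow 2)).inter
      (isClosed_le (continuous_norm.pow 2) continuous_const)

lemma ne_zero_of_mem_tsupport {y : E3} (h : y ∈ tsupport annulusBump) : y ≠ 0 := by
  rintro rfl
  have := (tsupport_annulusBump h).1
  norm_num at this

lemma hasCompactSupport_annulusBump : HasCompactSupport annulusBump := by
  refine HasCompactSupport.of_support_subset_isCompact (isCompact_closedBall (0 : E3) 2) ?_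
  intro y hy
  have := (tsupport_annulusBump (subset_tsupport _ hy)).2
  simp only [mem_closedBall, dist_zero_right]
  nlinarith [norm_nonneg y]

/-- Extensions constant along rays are singular at the origin; this makes their products with the
cut-off continuous on all of ℝ³. -/
lemma continuous_mul_of_tsupport {f g : E3 → ℝ} (hf : Continuous f)
    (hg : ∀ y ∈ tsupport f, ContinuousAt g y) : Continuous fun y => f y * g y := by
  rw [continuous_iff_continuousAt]
  intro y
  by_cases hy : y ∈ tsupport f
  · exact hf.continuousAt.mul (hg y hy)
  · have : (fun _ => (0 : ℝ)) =ᶠ[𝓝 y] fun y => f y * g y := by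
      filter_upwards [(isClosed_tsupport f).isOpen_compl.mem_nhds hy] with z hz
      rw [image_eq_zero_of_notMem_tsupport hz, zero_mul]
    exact continuousAt_const.congr this

lemma integrable_mul_of_tsupport {f g : E3 → ℝ} (hf : Continuous f) (hc : HasCompactSupport f)
    (hg : ∀ y ∈ tsupport f, ContinuousAt g y) : Integrable (fun y => f y * g y) :=
  (continuous_mul_of_tsupport hf hg).integrable_of_hasCompactSupport hc.mul_right

/-- Integration by parts moves the derivatives onto the cut-off, whose gradient is radial and hence
orthogonal to the extended tangential field. -/
lemma integral_annulusBump_mul_div {Z : S2 → E3}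
    (hZ : ∀ x : S2, ContDiffAt ℝ 1 (hom Z) (x : E3)) (ht : ∀ x : S2, ⟪(x : E3), Z x⟫ = 0) :
    ∫ y, annulusBump y * ∑ i, fderiv ℝ (hom Z) y (EuclideanSpace.single i 1) i = 0 := by
  have hZ' : ∀ y ∈ tsupport annulusBump, ContDiffAt ℝ 1 (hom Z) y := fun y hy =>
    contDiffAt_hom_of_radialProj (ne_zero_of_mem_tsupport hy) (hZ _)
  have hZi : ∀ i, ∀ y ∈ tsupport annulusBump, ContDiffAt ℝ 1 (fun z => hom Z z i) y := fun i y hy => by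
    have := hZ' y hy
    fun_prop
  have hsub : ∀ v, tsupport (fun y => fderiv ℝ annulusBump y v) ⊆ tsupport annulusBump := fun v =>
    closure_minimal (fun y hy => support_fderiv_subset ℝ (fun h => hy (by simp [h])))
      (isClosed_tsupport _)
  have hcont : ∀ v, Continuous (fun y => fderiv ℝ annulusBump y v) := fun v =>
    (contDiff_annulusBump.continuous_fderiv one_ne_zero).clm_apply continuous_const
  have hcs : ∀ v, HasCompactSupport (fun y => fderiv ℝ annulusBump y v) := fun v =>
    hasCompactSupport_annulusBump.of_isClosed_subset (isClosed_tsupport _) (hsub v)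
  have hdc : ∀ i v, ∀ y ∈ tsupport annulusBump,
      ContinuousAt (fun y => fderiv ℝ (fun z => hom Z z i) y v) y := fun i v y hy =>
    ((hZi i y hy).continuousAt_fderiv one_ne_zero).clm_apply continuousAt_const
  have hfi : ∀ i : Fin 3, ∀ y ∈ tsupport annulusBump, 
      fderiv ℝ (hom Z) y (EuclideanSpace.single i 1) i =
      fderiv ℝ (fun z => hom Z z i) y (EuclideanSpace.single i 1) := by
    intro i y hy
    have h1 := ((hZ' y hy).differentiableAt one_ne_zero).hasFDerivAt
    have h2 := ((EuclideanSpace.proj i : E3 →L[ℝ] ℝ).hasFDerivAt).comp y h1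
    rw [show (fun z => hom Z z i) = (EuclideanSpace.proj i : E3 →L[ℝ] ℝ) ∘ hom Z from rfl, h2.fderiv]
    rfl
  have hpart : ∀ i : Fin 3, ∫ y, annulusBump y * fderiv ℝ (fun z => hom Z z i) y (EuclideanSpace.single i 1)
      = - ∫ y, fderiv ℝ annulusBump y (EuclideanSpace.single i 1) * hom Z y i := by
    intro i
    refine integral_mul_fderiv_eq_neg_fderiv_mul_of_integrable ?_ ?_ ?_ ?_ ?_
    · exact integrable_mul_of_tsupport (hcont _) (hcs _) fun y hy => (hZi i y (hsub _ hy)).continuousAt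
    · exact integrable_mul_of_tsupport contDiff_annulusBump.continuous
        hasCompactSupport_annulusBump fun y hy => hdc i _ y hy
    · exact integrable_mul_of_tsupport contDiff_annulusBump.continuous
        hasCompactSupport_annulusBump fun y hy => (hZi i y hy).continuousAt
    · exact fun y _ => contDiff_annulusBump.contDiffAt.differentiableAt one_ne_zero
    · exact fun y hy => (hZi i y hy).differentiableAt one_ne_zero
  have e1 : ∀ y, annulusBump y * ∑ i, fderiv ℝ (hom Z) y (EuclideanSpace.single i 1) i =
      ∑ i, annulusBump y * fderiv ℝ (fun z => hom Z z i) y (EuclideanSpace.single i 1) := by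
    intro y
    by_cases hy : y ∈ tsupport annulusBump
    · rw [Finset.mul_sum]
      exact Finset.sum_congr rfl fun i _ => by rw [hfi i y hy]
    · simp [image_eq_zero_of_notMem_tsupport hy]
  simp_rw [e1]
  rw [integral_finsetSum _ fun i _ => integrable_mul_of_tsupport contDiff_annulusBump.continuous
        hasCompactSupport_annulusBump fun y hy => hdc i _ y hy]
  simp_rw [hpart]
  rw [Finset.sum_neg_distrib, ← integral_finsetSum _ fun i _ =>
    integrable_mul_of_tsupport (hcont _) (hcs _) fun y hy => (hZi i y (hsub _ hy)).continuousAt]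
  rw [neg_eq_zero]
  refine integral_eq_zero_of_ae (Eventually.of_forall fun y => ?_)
  have hb : HasFDerivAt annulusBump
      (deriv radialBump (‖y‖ ^ 2) • (2 • innerSL ℝ y)) y := by
    have h1 : HasDerivAt radialBump (deriv radialBump (‖y‖ ^ 2)) (‖y‖ ^ 2) :=
      ((radialBump.contDiff (n := 1)).differentiable one_ne_zero _).hasDerivAt
    exact h1.comp_hasFDerivAt y (hasStrictFDerivAt_norm_sq y).hasFDerivAt
  have e2 : ∑ i, fderiv ℝ annulusBump y (EuclideanSpace.single i 1) * hom Z y i =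
      deriv radialBump (‖y‖ ^ 2) * 2 * ⟪y, hom Z y⟫ := by
    rw [hb.fderiv]
    simp [PiLp.inner_apply, Fin.sum_univ_three]
    ring
  change ∑ i, fderiv ℝ annulusBump y (EuclideanSpace.single i 1) * hom Z y i = 0
  rw [e2]
  by_cases h0 : y = 0
  · simp [h0]
  · rw [← norm_smul_radialProj h0, real_inner_smul_left, norm_smul_radialProj h0, hom, ht]
    simp

/-- Polar coordinates and Fubini separate the spherical and the radial factor. -/
lemma integral_polar (h : E3 → ℝ) (D : S2 → ℝ) (k : ℝ → ℝ)
    (hh : ∀ y : E3, y ≠ 0 → h y = D (radialProj y) * k ‖y‖) :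
    ∫ y, h y = (∫ x, D x ∂roundArea) *
      ∫ r : Ioi (0 : ℝ), k r ∂(Measure.volumeIoiPow (Module.finrank ℝ E3 - 1)) := by
  calc ∫ y, h y = ∫ y : ({(0)}ᶜ : Set E3), h y ∂(volume.comap Subtype.val) := by
        rw [integral_subtype_comap (measurableSet_singleton (0 : E3)).compl h,
          restrict_compl_singleton]
    _ = ∫ x : S2 × Ioi (0 : ℝ), D x.1 * k (x.2 : ℝ) ∂(volume : Measure E3).toSphere.prod
          (Measure.volumeIoiPow (Module.finrank ℝ E3 - 1)) := by
        rw [← (volume : Measure E3).measurePreserving_homeomorphUnitSphereProd.integral_comp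
          (Homeomorph.measurableEmbedding _)]
        refine integral_congr_ae (Eventually.of_forall fun y => ?_)
        have hy : (y : E3) ≠ 0 := y.2
        dsimp only
        rw [hh _ hy]
        congr 2
        · ext1
          rw [coe_radialProj hy]
          simp
        · simp
    _ = _ := integral_prod_mul (fun x : S2 => D x) (fun r : Ioi (0 : ℝ) => k r)

/-- The divergence theorem on `S²`. -/
theorem integral_sDiv_eq_zero {Z : S2 → E3}
    (hZ : ∀ x : S2, ContDiffAt ℝ 1 (hom Z) (x : E3)) (ht : ∀ x : S2, ⟪(x : E3), Z x⟫ = 0) :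
    ∫ x, sDiv Z x ∂roundArea = 0 := by
  have h1 := integral_annulusBump_mul_div hZ ht
  rw [integral_polar _ (sDiv Z) (fun r => radialBump (r ^ 2) * r⁻¹)] at h1
  -- The radial factor is not zero: otherwise the same formula with spherical factor `1` would give
  -- integral zero to the cut-off divided by `‖y‖`, which is continuous, non-negative and not
  -- identically zero.
  · refine (mul_eq_zero.1 h1).resolve_right fun h2 => ?_
    have h3 := integral_polar (fun y => annulusBump y * ‖y‖⁻¹) (fun _ => 1)
      (fun r => radialBump (r ^ 2) * r⁻¹) (fun y _ => by simp [annulusBump])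
    rw [h2, mul_zero] at h3
    have hg : ∀ y ∈ tsupport annulusBump, ContinuousAt (fun y : E3 => ‖y‖⁻¹) y := fun y hy => by
      have : ‖y‖ ≠ 0 := norm_ne_zero_iff.2 (ne_zero_of_mem_tsupport hy)
      fun_prop (disch := assumption)
    have hc := continuous_mul_of_tsupport contDiff_annulusBump.continuous hg
    have hi := integrable_mul_of_tsupport contDiff_annulusBump.continuous
      hasCompactSupport_annulusBump hg
    have hnn : 0 ≤ fun y : E3 => annulusBump y * ‖y‖⁻¹ := fun y =>
      mul_nonneg radialBump.nonneg (by positivity)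
    have := (hc.integral_pos_of_hasCompactSupport_nonneg_nonzero (μ := volume)
      (x := EuclideanSpace.single 0 1) hasCompactSupport_annulusBump.mul_right hnn ?_)
    · linarith
    · have : annulusBump (EuclideanSpace.single 0 1) = 1 := by
        refine radialBump.one_of_mem_closedBall ?_
        simp [radialBump]
      simp [this]
  · intro y hy
    have hd : DifferentiableAt ℝ (hom Z) (radialProj y : E3) := (hZ _).differentiableAt one_ne_zero
    simp only [fderiv_hom hy hd, sDiv, annulusBump]
    simp only [PiLp.smul_apply, smul_eq_mul, ← Finset.mul_sum]
    ring

lemma continuous_sDiv {Z : S2 → E3} (hZ : ∀ x : S2, ContDiffAt ℝ 1 (hom Z) (x : E3)) :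
    Continuous (sDiv Z) := by
  have := continuous_sD hZ
  refine continuous_finsetSum _ fun i _ => ?_
  change Continuous fun x : S2 => (fderiv ℝ (hom Z) (x : E3) (EuclideanSpace.single i 1)) i
  fun_prop

lemma integrable_of_continuous {f : S2 → ℝ} (hf : Continuous f) : Integrable f roundArea := by
  have : IsFiniteMeasure roundArea := inferInstanceAs (IsFiniteMeasure (Measure.toSphere _))
  exact hf.integrable_of_hasCompactSupport (HasCompactSupport.of_compactSpace f)

/-! ### Bilinear forms given by 3 × 3 matrices -/

section Form

variable (m m' : Matrix (Fin 3) (Fin 3) ℝ) (u u' v v' : E3) (c : ℝ)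

lemma form_add_left : form m (u + u') v = form m u v + form m u' v := by
  simp [form, Fin.sum_univ_three]; ring

lemma form_add_right : form m u (v + v') = form m u v + form m u v' := by
  simp [form, Fin.sum_univ_three]; ring

lemma form_sub_left : form m (u - u') v = form m u v - form m u' v := by
  simp [form, Fin.sum_univ_three]; ring

lemma form_sub_right : form m u (v - v') = form m u v - form m u v' := by
  simp [form, Fin.sum_univ_three]; ring

lemma form_smul_left : form m (c • u) v = c * form m u v := by
  simp [form, Fin.sum_univ_three]; ring

lemma form_smul_right : form m u (c • v) = c * form m u v := by
  simp [form, Fin.sum_univ_three]; ring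

lemma form_neg_left : form m (-u) v = - form m u v := by
  simp [form, Fin.sum_univ_three]; ring

@[simp] lemma form_zero_left : form m 0 v = 0 := by simp [form]

@[simp] lemma form_zero_right : form m u 0 = 0 := by simp [form]

lemma form_symm (h : m.IsSymm) : form m u v = form m v u := by
  have := fun i j => h.apply i j
  simp only [form, Fin.sum_univ_three, this 0 1, this 0 2, this 1 2]; ring

lemma form_symm_of_posDef (h : m.PosDef) : form m u v = form m v u :=
  form_symm m u v (by
    have := h.1.eq
    rwa [Matrix.conjTranspose_eq_transpose_of_trivial] at this)

lemma form_eq_dotProduct : form m u v = (u : Fin 3 → ℝ) ⬝ᵥ (m.mulVec v) := by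
  simp [form, dotProduct, Matrix.mulVec, Fin.sum_univ_three]; ring

lemma form_pos (h : m.PosDef) (hu : u ≠ 0) : 0 < form m u u := by
  rw [form_eq_dotProduct]
  have h0 : (u : Fin 3 → ℝ) ≠ 0 := fun h0 => hu (by ext i; exact congrFun h0 i)
  simpa using h.dotProduct_mulVec_pos h0

lemma eq_of_form_eq (h : m.PosDef) (hu : ∀ w, form m u w = form m u' w) : u = u' := by
  by_contra hne
  have := form_pos m (u - u') h (sub_ne_zero.2 hne)
  rw [form_sub_left, hu] at this
  simp at this

end Form

/-- The product rule for `g(P, Q)`. Working within a set lets it serve for coordinate derivatives up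
to the boundary as well as for derivatives along a map (`t = univ`). -/
lemma form_hasFDerivWithinAt {M : E3 → Matrix (Fin 3) (Fin 3) ℝ} {L : Fin 3 → Fin 3 → E3 →L[ℝ] ℝ}
    {P Q : E3 → E3} {P' Q' : E3 →L[ℝ] E3} {t : Set E3} {x : E3}
    (hM : ∀ i j, HasFDerivWithinAt (fun y => M y i j) (L i j) t x)
    (hP : HasFDerivWithinAt P P' t x) (hQ : HasFDerivWithinAt Q Q' t x) :
    ∃ f' : E3 →L[ℝ] ℝ, HasFDerivWithinAt (fun y => form (M y) (P y) (Q y)) f' t x ∧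
      ∀ u, f' u = form (Matrix.of fun i j => L i j u) (P x) (Q x) + form (M x) (P' u) (Q x)
        + form (M x) (P x) (Q' u) := by
  have hPi : ∀ i, HasFDerivWithinAt (fun y => P y i) ((EuclideanSpace.proj i : E3 →L[ℝ] ℝ).comp P') t x :=
    fun i => (EuclideanSpace.proj i : E3 →L[ℝ] ℝ).hasFDerivAt.comp_hasFDerivWithinAt x hP
  have hQi : ∀ i, HasFDerivWithinAt (fun y => Q y i) ((EuclideanSpace.proj i : E3 →L[ℝ] ℝ).comp Q') t x :=
    fun i => (EuclideanSpace.proj i : E3 →L[ℝ] ℝ).hasFDerivAt.comp_hasFDerivWithinAt x hQ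
  refine ⟨_, HasFDerivWithinAt.fun_sum fun i _ => HasFDerivWithinAt.fun_sum fun j _ =>
    ((hM i j).mul (hPi i)).mul (hQi j), fun u => ?_⟩
  simp [form, Fin.sum_univ_three]
  ring

/-! ### Levi-Civita connection and curvature of a C² metric in coordinates -/

section Curvature

variable (s : Set E3) (G : E3 → Matrix (Fin 3) (Fin 3) ℝ)

/-- A coordinate domain on which a `C²` metric is given. -/
structure IsMetricOn (s : Set E3) (G : E3 → Matrix (Fin 3) (Fin 3) ℝ) : Prop where
  uniqueDiffOn : UniqueDiffOn ℝ s
  subset_closure : s ⊆ closure (interior s)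
  contDiffOn : ∀ i j, ContDiffOn ℝ 2 (fun x => G x i j) s
  posDef : ∀ x ∈ s, (G x).PosDef

/-- The derivative of a matrix field. -/
def dMat (p w : E3) : Matrix (Fin 3) (Fin 3) ℝ :=
  Matrix.of fun i j => fderivWithin ℝ (fun y => G y i j) s p w

/-- The second derivative of a matrix field. -/
def ddMat (p a b : E3) : Matrix (Fin 3) (Fin 3) ℝ :=
  Matrix.of fun i j => fderivWithin ℝ (fun y => fderivWithin ℝ (fun z => G z i j) s y b) s p a

/-- The derivative of the Christoffel vector, its two arguments being fixed. -/
def dChristoffelVec (p a u v : E3) : E3 :=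
  WithLp.toLp 2 fun k =>
    form (Matrix.of fun i j => fderivWithin ℝ (christoffel s G k i j) s p a) u v

/-- The curvature tensor `R(a, b) c`. -/
def riemannVec (p a b c : E3) : E3 :=
  dChristoffelVec s G p a b c - dChristoffelVec s G p b a c
    + christoffelVec s G p a (christoffelVec s G p b c)
    - christoffelVec s G p b (christoffelVec s G p a c)

lemma clm_apply_eq_sum (L : E3 →L[ℝ] ℝ) (w : E3) :
    L w = ∑ k, w k * L (EuclideanSpace.single k 1) := by
  conv_lhs => rw [← (EuclideanSpace.basisFun (Fin 3) ℝ).sum_repr w, map_sum]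
  simp

lemma dMat_apply (p w : E3) (i j : Fin 3) :
    dMat s G p w i j = ∑ k, w k * pd s k (fun y => G y i j) p := by
  rw [dMat, Matrix.of_apply, clm_apply_eq_sum]; rfl

lemma christoffelVec_apply (p u v : E3) (k : Fin 3) :
    christoffelVec s G p u v k = form (Matrix.of fun i j => christoffel s G k i j p) u v := rfl

lemma christoffelVec_add_left (p u u' v : E3) : christoffelVec s G p (u + u') v =
    christoffelVec s G p u v + christoffelVec s G p u' v := by
  ext k; simp [christoffelVec_apply, form_add_left]

lemma christoffelVec_add_right (p u v v' : E3) : christoffelVec s G p u (v + v') =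
    christoffelVec s G p u v + christoffelVec s G p u v' := by
  ext k; simp [christoffelVec_apply, form_add_right]

lemma christoffelVec_smul_left (p u v : E3) (c : ℝ) : christoffelVec s G p (c • u) v =
    c • christoffelVec s G p u v := by
  ext k; simp [christoffelVec_apply, form_smul_left]

lemma christoffelVec_smul_right (p u v : E3) (c : ℝ) : christoffelVec s G p u (c • v) =
    c • christoffelVec s G p u v := by
  ext k; simp [christoffelVec_apply, form_smul_right]

lemma dChristoffelVec_add_base (p a a' u v : E3) : dChristoffelVec s G p (a + a') u v =
    dChristoffelVec s G p a u v + dChristoffelVec s G p a' u v := by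
  ext k; simp [dChristoffelVec, form, Fin.sum_univ_three]; ring

lemma dChristoffelVec_smul_base (p a u v : E3) (c : ℝ) : dChristoffelVec s G p (c • a) u v =
    c • dChristoffelVec s G p a u v := by
  ext k; simp [dChristoffelVec, form, Fin.sum_univ_three]; ring

lemma dChristoffelVec_add_left (p a u u' v : E3) : dChristoffelVec s G p a (u + u') v =
    dChristoffelVec s G p a u v + dChristoffelVec s G p a u' v := by
  ext k; simp [dChristoffelVec, form_add_left]

lemma dChristoffelVec_smul_left (p a u v : E3) (c : ℝ) : dChristoffelVec s G p a (c • u) v =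
    c • dChristoffelVec s G p a u v := by
  ext k; simp [dChristoffelVec, form_smul_left]

lemma curvNum_eq (p u v : E3) : curvNum s G p u v = form (G p) u (riemannVec s G p u v v) := by
  have h1 : ∀ (k i j : Fin 3) (w : E3), fderivWithin ℝ (christoffel s G k i j) s p w =
      ∑ a, w a * pd s a (christoffel s G k i j) p := fun k i j w => by
    rw [clm_apply_eq_sum]; rfl
  have h2 : ∀ l, riemannVec s G p u v v l = ∑ k, ∑ i, ∑ j, riemann s G l k i j p * u i * v j * v k := by
    intro l
    simp only [riemannVec, dChristoffelVec, christoffelVec, riemann, PiLp.add_apply, PiLp.sub_apply,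
      form, Matrix.of_apply, h1, Fin.sum_univ_three]
    ring
  simp only [curvNum, form, h2, Finset.mul_sum]
  refine Finset.sum_congr rfl fun a _ => Finset.sum_congr rfl fun l _ => Finset.sum_congr rfl
    fun k _ => Finset.sum_congr rfl fun i _ => Finset.sum_congr rfl fun j _ => by ring

variable {s G}

lemma IsMetricOn.symm (h : IsMetricOn s G) {p : E3} (hp : p ∈ s) (i j : Fin 3) :
    G p i j = G p j i := by
  have := (h.posDef p hp).1
  simpa using (this.apply j i)

lemma IsMetricOn.dMat_symm (h : IsMetricOn s G) {p : E3} (hp : p ∈ s) (w : E3) :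
    (dMat s G p w).IsSymm := by
  ext i j
  simp only [dMat, Matrix.transpose_apply, Matrix.of_apply]
  rw [fderivWithin_congr (fun y hy => h.symm hy j i) (h.symm hp j i)]

lemma lower_christoffel (h : IsMetricOn s G) {p : E3} (hp : p ∈ s) (m i j : Fin 3) :
    ∑ k, G p k m * christoffel s G k i j p =
      (1 / 2) * (pd s i (fun y => G y j m) p + pd s j (fun y => G y i m) p
        - pd s m (fun y => G y i j) p) := by
  have hinv : ∀ l, ∑ k, G p k m * (G p)⁻¹ k l = if m = l then 1 else 0 := by
    intro l
    have h1 : G p * (G p)⁻¹ = 1 := Matrix.mul_nonsing_inv _ (h.posDef p hp).det_pos.ne'.isUnit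
    have h2 := congrFun (congrFun h1 m) l
    rw [Matrix.mul_apply, Matrix.one_apply] at h2
    rw [← h2]
    exact Finset.sum_congr rfl fun k _ => by rw [h.symm hp k m]
  calc _ = (1 / 2) * ∑ l, (∑ k, G p k m * (G p)⁻¹ k l) * (pd s i (fun y => G y j l) p
        + pd s j (fun y => G y i l) p - pd s l (fun y => G y i j) p) := by
        simp only [christoffel, Fin.sum_univ_three]; ring
    _ = _ := by
        simp [hinv]

/-- The Koszul formula for constant vector fields. Symmetry and metric compatibility of the
connection follow from it without touching the inverse matrix again. -/
lemma form_christoffelVec (h : IsMetricOn s G) {p : E3} (hp : p ∈ s) (u v w : E3) :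
    form (G p) (christoffelVec s G p u v) w = (1 / 2) * (form (dMat s G p u) v w
      + form (dMat s G p v) u w - form (dMat s G p w) u v) := by
  have h1 : form (G p) (christoffelVec s G p u v) w =
      ∑ m, ∑ i, ∑ j, (∑ k, G p k m * christoffel s G k i j p) * u i * v j * w m := by
    simp only [form, christoffelVec, Fin.sum_univ_three]; ring
  rw [h1]
  simp only [lower_christoffel h hp]
  simp only [form, dMat_apply, Fin.sum_univ_three]
  have h2 : ∀ k i j, pd s k (fun y => G y i j) p = pd s k (fun y => G y j i) p := fun k i j => by
    rw [pd, pd, fderivWithin_congr (fun y hy => h.symm hy i j) (h.symm hp i j)]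
  simp only [h2 _ 1 0, h2 _ 2 0, h2 _ 2 1]
  ring

lemma christoffelVec_symm (h : IsMetricOn s G) {p : E3} (hp : p ∈ s) (u v : E3) :
    christoffelVec s G p u v = christoffelVec s G p v u := by
  refine eq_of_form_eq _ _ _ (h.posDef p hp) fun w => ?_
  rw [form_christoffelVec h hp, form_christoffelVec h hp,
    form_symm _ u v (h.dMat_symm hp w)]
  ring

/-- Compatibility of the connection with the metric: two Koszul formulas are added. -/
lemma form_dMat (h : IsMetricOn s G) {p : E3} (hp : p ∈ s) (w u v : E3) :
    form (dMat s G p w) u v = form (G p) (christoffelVec s G p w u) v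
      + form (G p) u (christoffelVec s G p w v) := by
  rw [form_symm_of_posDef _ u _ (h.posDef p hp), form_christoffelVec h hp,
    form_christoffelVec h hp, form_symm _ v u (h.dMat_symm hp w)]
  rw [form_symm _ w v (h.dMat_symm hp u), form_symm _ w u (h.dMat_symm hp v)]
  ring

lemma contDiffOn_inv_apply {k : ℕ∞ω} (hG : ∀ i j, ContDiffOn ℝ k (fun x => G x i j) s)
    (hd : ∀ x ∈ s, (G x).det ≠ 0) (i j : Fin 3) : ContDiffOn ℝ k (fun x => (G x)⁻¹ i j) s := by
  have hdet : ContDiffOn ℝ k (fun x => (G x).det) s := by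
    simp only [Matrix.det_fin_three]
    fun_prop
  have hadj : ContDiffOn ℝ k (fun x => (G x).adjugate i j) s := by
    simp only [Matrix.adjugate_fin_three]
    fin_cases i <;> fin_cases j <;> simp <;> fun_prop
  simp only [Matrix.inv_def, Ring.inverse_eq_inv', Matrix.smul_apply, smul_eq_mul]
  exact (hdet.inv hd).mul hadj

lemma IsMetricOn.contDiffOn_pd (h : IsMetricOn s G) (k i j : Fin 3) :
    ContDiffOn ℝ 1 (pd s k (fun y => G y i j)) s :=
  ((h.contDiffOn i j).fderivWithin h.uniqueDiffOn (by norm_num)).clm_apply contDiffOn_const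

lemma IsMetricOn.contDiffOn_christoffel (h : IsMetricOn s G) (k i j : Fin 3) :
    ContDiffOn ℝ 1 (christoffel s G k i j) s := by
  have h1 := fun k i j => h.contDiffOn_pd k i j
  have h2 := fun l => contDiffOn_inv_apply (fun i j => (h.contDiffOn i j).of_le one_le_two)
    (fun x hx => (h.posDef x hx).det_pos.ne') k l
  unfold christoffel
  exact contDiffOn_const.mul (ContDiffOn.sum fun l _ => (h2 l).mul
    (((h1 i j l).add (h1 j i l)).sub (h1 l i j)))

lemma IsMetricOn.hasFDerivWithinAt_christoffelVec (h : IsMetricOn s G) {p : E3} (hp : p ∈ s)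
    (b c : E3) : ∃ P' : E3 →L[ℝ] E3,
      HasFDerivWithinAt (fun q => christoffelVec s G q b c) P' s p ∧
      ∀ a, P' a = dChristoffelVec s G p a b c := by
  have h1 : ∀ k, ∃ f' : E3 →L[ℝ] ℝ, HasFDerivWithinAt (fun q => christoffelVec s G q b c k) f' s p ∧
      ∀ a, f' a = dChristoffelVec s G p a b c k := by
    intro k
    obtain ⟨f', hf, hf'⟩ := form_hasFDerivWithinAt (t := s) (x := p)
      (M := fun q => Matrix.of fun i j => christoffel s G k i j q)
      (fun i j => ((h.contDiffOn_christoffel k i j).differentiableOn one_ne_zero p hp).hasFDerivWithinAt)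
      (hasFDerivWithinAt_const b p s) (hasFDerivWithinAt_const c p s)
    exact ⟨f', hf, fun a => by rw [hf']; simp [dChristoffelVec]⟩
  choose f' hf hf' using h1
  have h2 : HasFDerivWithinAt (fun q k => christoffelVec s G q b c k) (ContinuousLinearMap.pi f') s p :=
    hasFDerivWithinAt_pi.2 hf
  refine ⟨((EuclideanSpace.equiv (Fin 3) ℝ).symm : (Fin 3 → ℝ) →L[ℝ] E3).comp
    (ContinuousLinearMap.pi f'), ?_, fun a => ?_⟩
  · exact ((EuclideanSpace.equiv (Fin 3) ℝ).symm :
      (Fin 3 → ℝ) →L[ℝ] E3).hasFDerivAt.comp_hasFDerivWithinAt p h2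
  · ext k
    exact hf' k a

/-- Schwarz's theorem within `s`. It reaches boundary points because `s` lies in the closure of its
interior. -/
lemma IsMetricOn.ddMat_symm (h : IsMetricOn s G) {p : E3} (hp : p ∈ s) (a b : E3) :
    ddMat s G p a b = ddMat s G p b a := by
  ext i j
  have hd := ((h.contDiffOn i j).fderivWithin h.uniqueDiffOn (m := 1) (by norm_num)).differentiableOn
    one_ne_zero p hp
  have h1 : ∀ a b, fderivWithin ℝ (fun y => fderivWithin ℝ (fun z => G z i j) s y b) s p a =
      fderivWithin ℝ (fderivWithin ℝ (fun z => G z i j) s) s p a b := fun a b => by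
    rw [(hd.hasFDerivWithinAt.clm_apply (hasFDerivWithinAt_const b p s)).fderivWithin
      (h.uniqueDiffOn p hp)]
    simp
  simp only [ddMat, Matrix.of_apply, h1]
  exact (h.contDiffOn i j p hp).isSymmSndFDerivWithinAt (by simp) h.uniqueDiffOn
    (h.subset_closure hp) hp a b

lemma IsMetricOn.hasFDerivWithinAt_form_dMat (h : IsMetricOn s G) {p : E3} (hp : p ∈ s)
    (b c d : E3) : ∃ f' : E3 →L[ℝ] ℝ,
      HasFDerivWithinAt (fun q => form (dMat s G q b) c d) f' s p ∧
      ∀ a, f' a = form (ddMat s G p a b) c d := by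
  obtain ⟨f', hf, hf'⟩ := form_hasFDerivWithinAt (t := s) (x := p) (M := fun q => dMat s G q b)
      (fun i j => ((((h.contDiffOn i j).fderivWithin h.uniqueDiffOn (m := 1) (by norm_num)).clm_apply
        contDiffOn_const).differentiableOn one_ne_zero p hp).hasFDerivWithinAt)
      (hasFDerivWithinAt_const c p s) (hasFDerivWithinAt_const d p s)
  exact ⟨f', hf, fun a => by rw [hf']; simp [ddMat]⟩

/-- Differentiating the Koszul formula, rather than the Christoffel symbols, avoids the derivative
of the inverse metric. -/
lemma form_dChristoffelVec (h : IsMetricOn s G) {p : E3} (hp : p ∈ s) (a b c d : E3) :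
    form (G p) (dChristoffelVec s G p a b c) d =
      (1 / 2) * (form (ddMat s G p a b) c d + form (ddMat s G p a c) b d
        - form (ddMat s G p a d) b c)
      - form (dMat s G p a) (christoffelVec s G p b c) d := by
  obtain ⟨P', hP, hP'⟩ := h.hasFDerivWithinAt_christoffelVec hp b c
  obtain ⟨f', hf, hf'⟩ := form_hasFDerivWithinAt (t := s) (x := p) (M := G)
    (fun i j => ((h.contDiffOn i j).differentiableOn two_ne_zero p hp).hasFDerivWithinAt) hP
    (hasFDerivWithinAt_const d p s)
  obtain ⟨g1, hg1, hg1'⟩ := h.hasFDerivWithinAt_form_dMat hp b c d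
  obtain ⟨g2, hg2, hg2'⟩ := h.hasFDerivWithinAt_form_dMat hp c b d
  obtain ⟨g3, hg3, hg3'⟩ := h.hasFDerivWithinAt_form_dMat hp d b c
  have h1 := ((hg1.add hg2).sub hg3).const_mul (1 / 2 : ℝ)
  have h2 := hf.congr (fun q hq => (form_christoffelVec h hq b c d).symm)
    (form_christoffelVec h hp b c d).symm
  have h3 := congrArg (fun L : E3 →L[ℝ] ℝ => L a) ((h.uniqueDiffOn p hp).eq h1 h2)
  simp only [hf', hP', smul_apply, add_apply,
    sub_apply, hg1', hg2', hg3', smul_eq_mul, zero_apply,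
    form_zero_right, add_zero] at h3
  change _ = form (dMat s G p a) _ _ + _ at h3
  linarith

/-- With the last index lowered, only second derivatives of the metric and products of two
Christoffel vectors remain; the algebraic symmetries of the curvature tensor can be read off from
this expression. -/
lemma form_riemannVec (h : IsMetricOn s G) {p : E3} (hp : p ∈ s) (a b c d : E3) :
    form (G p) (riemannVec s G p a b c) d =
      (1 / 2) * (form (ddMat s G p a c) b d - form (ddMat s G p a d) b c
        - form (ddMat s G p b c) a d + form (ddMat s G p b d) a c)
      - form (G p) (christoffelVec s G p a d) (christoffelVec s G p b c)
      + form (G p) (christoffelVec s G p b d) (christoffelVec s G p a c) := by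
  simp only [riemannVec, form_add_left, form_sub_left, form_dChristoffelVec h hp, form_dMat h hp]
  rw [h.ddMat_symm hp b a]
  rw [form_symm_of_posDef _ (christoffelVec s G p b c) _ (h.posDef p hp),
    form_symm_of_posDef _ (christoffelVec s G p a c) _ (h.posDef p hp)]
  ring

lemma IsMetricOn.form_ddMat_symm (h : IsMetricOn s G) {p : E3} (hp : p ∈ s) (a b u v : E3) :
    form (ddMat s G p a b) u v = form (ddMat s G p a b) v u := by
  refine form_symm _ _ _ ?_
  ext i j
  simp only [ddMat, Matrix.transpose_apply, Matrix.of_apply]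
  have : ∀ y ∈ s, fderivWithin ℝ (fun z => G z j i) s y b = fderivWithin ℝ (fun z => G z i j) s y b :=
    fun y hy => by rw [fderivWithin_congr (fun y hy => h.symm hy j i) (h.symm hy j i)]
  rw [fderivWithin_congr this (this p hp)]

lemma riemannVec_antisymm (p a b c : E3) : riemannVec s G p a b c = - riemannVec s G p b a c := by
  simp only [riemannVec]; abel

lemma form_riemannVec_antisymm (h : IsMetricOn s G) {p : E3} (hp : p ∈ s) (a b c d : E3) :
    form (G p) (riemannVec s G p a b c) d = - form (G p) (riemannVec s G p a b d) c := by
  rw [form_riemannVec h hp, form_riemannVec h hp,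
    form_symm_of_posDef _ (christoffelVec s G p a d) _ (h.posDef p hp),
    form_symm_of_posDef _ (christoffelVec s G p b d) _ (h.posDef p hp)]
  ring

lemma form_riemannVec_pair_symm (h : IsMetricOn s G) {p : E3} (hp : p ∈ s) (a b c d : E3) :
    form (G p) (riemannVec s G p a b c) d = form (G p) (riemannVec s G p c d a) b := by
  rw [form_riemannVec h hp, form_riemannVec h hp,
    h.ddMat_symm hp c a, h.ddMat_symm hp c b, h.ddMat_symm hp d a, h.ddMat_symm hp d b,
    h.form_ddMat_symm hp a c d b, h.form_ddMat_symm hp b c d a, h.form_ddMat_symm hp a d c b,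
    h.form_ddMat_symm hp b d c a, christoffelVec_symm h hp c b, christoffelVec_symm h hp d a,
    christoffelVec_symm h hp d b, christoffelVec_symm h hp c a,
    form_symm_of_posDef _ (christoffelVec s G p a d) _ (h.posDef p hp)]
  ring

/-- The curvature term of the Codazzi equation vanishes. The curvature numerator of the planes
spanned by `V + t n` and `U` is even in `t` for constant curvature, so its part linear in `t` is
zero; by the symmetries of the curvature tensor that part is `-2 g(R(V,U)n, U)`. -/
lemma form_riemannVec_normal {κ : ℝ} (h : IsMetricOn s G) (hκ : HasConstCurv s G κ) {p : E3}
    (hp : p ∈ s) {V U n : E3} (hU : U ≠ 0) (hVU : form (G p) V U = 0) (hn : n ≠ 0) (hV : V ≠ 0)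
    (hnU : form (G p) n U = 0) (hnV : form (G p) n V = 0) :
    form (G p) (riemannVec s G p V U n) U = 0 := by
  have hsym := fun a b => form_symm_of_posDef (G p) a b (h.posDef p hp)
  have key : ∀ t : ℝ, curvNum s G p (V + t • n) U =
      κ * ((form (G p) V V + t ^ 2 * form (G p) n n) * form (G p) U U) := by
    intro t
    have hUp := form_pos (G p) U (h.posDef p hp) hU
    have hVp := form_pos (G p) V (h.posDef p hp) hV
    have hnp := form_pos (G p) n (h.posDef p hp) hn
    have e0 : form (G p) (V + t • n) (V + t • n) = form (G p) V V + t ^ 2 * form (G p) n n := by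
      simp only [form_add_left, form_add_right, form_smul_left, form_smul_right, hnV, hsym V n]
      ring
    have e1 : form (G p) (V + t • n) U = 0 := by
      simp only [form_add_left, form_smul_left, hVU, hnU]; ring
    have hpos : 0 < form (G p) V V + t ^ 2 * form (G p) n n := by positivity
    have hli : LinearIndependent ℝ ![V + t • n, U] := by
      rw [LinearIndependent.pair_iff]
      intro a b hab
      have ha : form (G p) (a • (V + t • n) + b • U) (V + t • n) = 0 := by rw [hab, form_zero_left]
      have hb : form (G p) (a • (V + t • n) + b • U) U = 0 := by rw [hab, form_zero_left]
      rw [form_add_left, form_smul_left, form_smul_left, hsym U, e1, e0, mul_zero, add_zero] at ha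
      rw [form_add_left, form_smul_left, form_smul_left, e1, mul_zero, zero_add] at hb
      exact ⟨(mul_eq_zero.1 ha).resolve_right hpos.ne', (mul_eq_zero.1 hb).resolve_right hUp.ne'⟩
    have := hκ p hp _ _ hli
    rw [e0, e1, div_eq_iff (by nlinarith [mul_pos hpos hUp])] at this
    rw [this]; ring
  have hlin : ∀ t : ℝ, riemannVec s G p (V + t • n) U U =
      riemannVec s G p V U U + t • riemannVec s G p n U U := by
    intro t
    simp only [riemannVec, dChristoffelVec_add_base, dChristoffelVec_smul_base,
      dChristoffelVec_add_left, dChristoffelVec_smul_left, christoffelVec_add_left,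
      christoffelVec_smul_left, christoffelVec_add_right, christoffelVec_smul_right]
    module
  -- Comparing `t = 1` with `t = -1` isolates the linear part.
  have k1 := key 1
  have k2 := key (-1)
  rw [curvNum_eq, hlin] at k1 k2
  simp only [form_add_left, form_add_right, form_smul_left, form_smul_right] at k1 k2
  rw [hsym V, hsym n, hsym V, hsym n] at k1 k2
  have e1 : form (G p) (riemannVec s G p n U U) V = - form (G p) (riemannVec s G p V U n) U := by
    rw [form_riemannVec_pair_symm h hp, riemannVec_antisymm, form_neg_left]
  have e2 : form (G p) (riemannVec s G p V U U) n = - form (G p) (riemannVec s G p V U n) U := by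
    rw [form_riemannVec_antisymm h hp]
  rw [e1, e2] at k1 k2
  linarith

end Curvature

/-! ### Covariant derivatives along a map and the structure equation -/

section Along

/-- The covariant derivative, in direction `u`, of a vector field `P` along a map `F`. -/
def cov (s : Set E3) (G : E3 → Matrix (Fin 3) (Fin 3) ℝ) (F P : E3 → E3) (y u : E3) : E3 :=
  fderiv ℝ P y u + christoffelVec s G (F y) (fderiv ℝ F y u) (P y)

variable {s : Set E3} {G : E3 → Matrix (Fin 3) (Fin 3) ℝ} {F : E3 → E3} {y : E3}

/-- The map stays in `s`, so a derivative within `s` suffices for an ordinary derivative of the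
composite, even at boundary points of `s`. -/
lemma hasFDerivAt_comp_of_mem {f : E3 → ℝ} (hf : DifferentiableWithinAt ℝ f s (F y))
    (hF : DifferentiableAt ℝ F y) (hFs : ∀ᶠ z in 𝓝 y, F z ∈ s) :
    HasFDerivAt (fun z => f (F z)) ((fderivWithin ℝ f s (F y)).comp (fderiv ℝ F y)) y :=
  hf.hasFDerivWithinAt.comp_hasFDerivAt y hF.hasFDerivAt hFs

/-- The Leibniz rule for the pulled-back connection; `F` may have a degenerate differential. -/
lemma hasFDerivAt_form_comp (hM : IsMetricOn s G) (hF : DifferentiableAt ℝ F y)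
    (hFs : ∀ᶠ z in 𝓝 y, F z ∈ s) {P Q : E3 → E3} (hP : DifferentiableAt ℝ P y)
    (hQ : DifferentiableAt ℝ Q y) :
    ∃ f' : E3 →L[ℝ] ℝ, HasFDerivAt (fun z => form (G (F z)) (P z) (Q z)) f' y ∧
      ∀ u, f' u = form (G (F y)) (cov s G F P y u) (Q y) + form (G (F y)) (P y) (cov s G F Q y u) := by
  have hy : F y ∈ s := hFs.self_of_nhds
  obtain ⟨f', hf, hf'⟩ := form_hasFDerivWithinAt (t := univ) (x := y) (M := fun z => G (F z))
    (fun i j => (hasFDerivAt_comp_of_mem ((hM.contDiffOn i j).differentiableOn two_ne_zero _ hy)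
      hF hFs).hasFDerivWithinAt) hP.hasFDerivAt.hasFDerivWithinAt hQ.hasFDerivAt.hasFDerivWithinAt
  refine ⟨f', hasFDerivWithinAt_univ.1 hf, fun u => ?_⟩
  have e := form_dMat hM hy (fderiv ℝ F y u) (P y) (Q y)
  rw [hf' u, cov, cov, form_add_left, form_add_right]
  change form (dMat s G (F y) (fderiv ℝ F y u)) _ _ + _ + _ = _
  rw [e]; ring

lemma cov_form_eq_zero (hM : IsMetricOn s G) (hF : DifferentiableAt ℝ F y)
    (hFs : ∀ᶠ z in 𝓝 y, F z ∈ s) {P Q : E3 → E3} (hP : DifferentiableAt ℝ P y)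
    (hQ : DifferentiableAt ℝ Q y) {c : ℝ} (h : ∀ᶠ z in 𝓝 y, form (G (F z)) (P z) (Q z) = c) (u : E3) :
    form (G (F y)) (cov s G F P y u) (Q y) + form (G (F y)) (P y) (cov s G F Q y u) = 0 := by
  obtain ⟨f', hf, hf'⟩ := hasFDerivAt_form_comp hM hF hFs hP hQ
  rw [← hf', hf.unique ((hasFDerivAt_const c y).congr_of_eventuallyEq h)]
  rfl

lemma cov_form_eq (hM : IsMetricOn s G) (hF : DifferentiableAt ℝ F y)
    (hFs : ∀ᶠ z in 𝓝 y, F z ∈ s) {P Q : E3 → E3} (hP : DifferentiableAt ℝ P y)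
    (hQ : DifferentiableAt ℝ Q y)
    (h : ∀ᶠ z in 𝓝 y, form (G (F z)) (P z) (P z) = form (G (F z)) (Q z) (Q z)) (u : E3) :
    form (G (F y)) (cov s G F P y u) (P y) = form (G (F y)) (cov s G F Q y u) (Q y) := by
  have hp := hM.posDef _ hFs.self_of_nhds
  obtain ⟨f', hf, hf'⟩ := hasFDerivAt_form_comp hM hF hFs hP hP
  obtain ⟨g', hg, hg'⟩ := hasFDerivAt_form_comp hM hF hFs hQ hQ
  have h1 := hf' u
  rw [hf.unique (hg.congr_of_eventuallyEq h), hg', form_symm_of_posDef _ (Q y) _ hp,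
    form_symm_of_posDef _ (P y) _ hp] at h1
  linarith

lemma hasFDerivAt_christoffelVec_comp (hM : IsMetricOn s G) (hF : DifferentiableAt ℝ F y)
    (hFs : ∀ᶠ z in 𝓝 y, F z ∈ s) {P Q : E3 → E3} (hP : DifferentiableAt ℝ P y)
    (hQ : DifferentiableAt ℝ Q y) :
    ∃ f' : E3 →L[ℝ] E3, HasFDerivAt (fun z => christoffelVec s G (F z) (P z) (Q z)) f' y ∧
      ∀ u, f' u = dChristoffelVec s G (F y) (fderiv ℝ F y u) (P y) (Q y)
        + christoffelVec s G (F y) (fderiv ℝ P y u) (Q y)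
        + christoffelVec s G (F y) (P y) (fderiv ℝ Q y u) := by
  have hy : F y ∈ s := hFs.self_of_nhds
  have h1 : ∀ k, ∃ f' : E3 →L[ℝ] ℝ, HasFDerivAt
      (fun z => christoffelVec s G (F z) (P z) (Q z) k) f' y ∧
      ∀ u, f' u = (dChristoffelVec s G (F y) (fderiv ℝ F y u) (P y) (Q y)
        + christoffelVec s G (F y) (fderiv ℝ P y u) (Q y)
        + christoffelVec s G (F y) (P y) (fderiv ℝ Q y u)) k := by
    intro k
    obtain ⟨f', hf, hf'⟩ := form_hasFDerivWithinAt (t := univ) (x := y)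
      (M := fun z => Matrix.of fun i j => christoffel s G k i j (F z))
      (fun i j => (hasFDerivAt_comp_of_mem ((hM.contDiffOn_christoffel k i j).differentiableOn
        one_ne_zero _ hy) hF hFs).hasFDerivWithinAt)
      hP.hasFDerivAt.hasFDerivWithinAt hQ.hasFDerivAt.hasFDerivWithinAt
    exact ⟨f', hasFDerivWithinAt_univ.1 hf, fun u => by rw [hf']; rfl⟩
  choose f' hf hf' using h1
  have h2 : HasFDerivAt (fun z k => christoffelVec s G (F z) (P z) (Q z) k)
      (ContinuousLinearMap.pi f') y := hasFDerivAt_pi.2 hf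
  refine ⟨((EuclideanSpace.equiv (Fin 3) ℝ).symm : (Fin 3 → ℝ) →L[ℝ] E3).comp
    (ContinuousLinearMap.pi f'), ?_, fun a => ?_⟩
  · exact ((EuclideanSpace.equiv (Fin 3) ℝ).symm :
      (Fin 3 → ℝ) →L[ℝ] E3).hasFDerivAt.comp y h2
  · ext k
    exact hf' k a

lemma hasFDerivAt_fderiv_apply {f : E3 → E3} (hf : ContDiffAt ℝ 2 f y) (b : E3) :
    HasFDerivAt (fun z => fderiv ℝ f z b) ((fderiv ℝ (fderiv ℝ f) y).flip b) y := by
  have h1 : DifferentiableAt ℝ (fderiv ℝ f) y :=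
    (hf.fderiv_right (m := 1) (by norm_num)).differentiableAt one_ne_zero
  have := h1.hasFDerivAt.clm_apply (hasFDerivAt_const b y)
  convert! this using 1
  ext; simp

lemma fderiv_fderiv_symm {f : E3 → E3} (hf : ContDiffAt ℝ 2 f y) (a b : E3) :
    fderiv ℝ (fderiv ℝ f) y a b = fderiv ℝ (fderiv ℝ f) y b a :=
  (hf.isSymmSndFDerivAt (by simp)) a b

lemma hasFDerivAt_cov (hM : IsMetricOn s G) (hF : ContDiffAt ℝ 2 F y)
    (hFs : ∀ᶠ z in 𝓝 y, F z ∈ s) {n : E3 → E3} (hn : ContDiffAt ℝ 2 n y) (b : E3) :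
    ∃ f' : E3 →L[ℝ] E3, HasFDerivAt (fun z => cov s G F n z b) f' y ∧
      ∀ u, f' u = fderiv ℝ (fderiv ℝ n) y u b
        + dChristoffelVec s G (F y) (fderiv ℝ F y u) (fderiv ℝ F y b) (n y)
        + christoffelVec s G (F y) (fderiv ℝ (fderiv ℝ F) y u b) (n y)
        + christoffelVec s G (F y) (fderiv ℝ F y b) (fderiv ℝ n y u) := by
  have h1 := hasFDerivAt_fderiv_apply hF b
  obtain ⟨f', hf, hf'⟩ := hasFDerivAt_christoffelVec_comp hM (hF.differentiableAt two_ne_zero) hFs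
    h1.differentiableAt (hn.differentiableAt two_ne_zero)
  refine ⟨_, (hasFDerivAt_fderiv_apply hn b).add hf, fun u => ?_⟩
  simp only [add_apply, ContinuousLinearMap.flip_apply, hf', h1.fderiv]
  abel

/-- The directions `a` and `b` are constant, so no bracket term appears in the definition of
curvature. -/
lemma cov_cov_sub (hM : IsMetricOn s G) (hF : ContDiffAt ℝ 2 F y)
    (hFs : ∀ᶠ z in 𝓝 y, F z ∈ s) {n : E3 → E3} (hn : ContDiffAt ℝ 2 n y) (a b : E3) :
    cov s G F (fun z => cov s G F n z b) y a - cov s G F (fun z => cov s G F n z a) y b =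
      riemannVec s G (F y) (fderiv ℝ F y a) (fderiv ℝ F y b) (n y) := by
  obtain ⟨f', hf, hf'⟩ := hasFDerivAt_cov hM hF hFs hn b
  obtain ⟨g', hg, hg'⟩ := hasFDerivAt_cov hM hF hFs hn a
  have e1 : cov s G F (fun z => cov s G F n z b) y a =
      f' a + christoffelVec s G (F y) (fderiv ℝ F y a) (cov s G F n y b) := by rw [cov, hf.fderiv]
  have e2 : cov s G F (fun z => cov s G F n z a) y b =
      g' b + christoffelVec s G (F y) (fderiv ℝ F y b) (cov s G F n y a) := by rw [cov, hg.fderiv]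
  rw [e1, e2, hf', hg', fderiv_fderiv_symm hn b a, fderiv_fderiv_symm hF b a, riemannVec]
  simp only [cov, christoffelVec_add_right]
  abel

/-- The pulled-back connection has no torsion: second derivatives of `F` commute and the Christoffel
symbols are symmetric. -/
lemma cov_fderiv_symm (hM : IsMetricOn s G) (hF : ContDiffAt ℝ 2 F y)
    (hFs : ∀ᶠ z in 𝓝 y, F z ∈ s) (a b : E3) :
    cov s G F (fun z => fderiv ℝ F z b) y a = cov s G F (fun z => fderiv ℝ F z a) y b := by
  simp only [cov, (hasFDerivAt_fderiv_apply hF _).fderiv, ContinuousLinearMap.flip_apply]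
  rw [fderiv_fderiv_symm hF b a, christoffelVec_symm hM hFs.self_of_nhds]

/-- Parseval's identity in the orthogonal basis `V, U, n`, multiplied by `l` to avoid division. The
remainder of `l q` after removing its components is orthogonal to the basis, hence to `p`, and `p`
has no `n`-component. -/
lemma form_decompose {m : Matrix (Fin 3) (Fin 3) ℝ} (hm : m.PosDef) {V U n p q : E3} {l : ℝ}
    (hl : l ≠ 0) (hVV : form m V V = l) (hUU : form m U U = l) (hnn : form m n n = 1)
    (hUV : form m U V = 0) (hnU : form m n U = 0) (hnV : form m n V = 0) (hp : form m p n = 0) :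
    l * form m p q = form m p V * form m q V + form m p U * form m q U := by
  have hs := fun a b => form_symm_of_posDef m a b hm
  have hli : LinearIndependent ℝ ![V, U, n] := by
    rw [Fintype.linearIndependent_iff]
    intro g hg
    simp only [Fin.sum_univ_three, Matrix.cons_val_zero, Matrix.cons_val_one, Matrix.cons_val] at hg
    have h1 := congrArg (fun w => form m w V) hg
    have h2 := congrArg (fun w => form m w U) hg
    have h3 := congrArg (fun w => form m w n) hg
    simp only [form_add_left, form_smul_left, form_zero_left, hVV, hUU, hnn, hUV, hnU, hnV,
      hs V U, hs V n, hs U n, mul_zero, add_zero, zero_add, mul_one] at h1 h2 h3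
    intro i
    fin_cases i
    · exact (mul_eq_zero.1 h1).resolve_right hl
    · exact (mul_eq_zero.1 h2).resolve_right hl
    · exact h3
  have hspan := hli.span_eq_top_of_card_eq_finrank (by simp)
  set r := l • q - form m q V • V - form m q U • U - (l * form m q n) • n with hr
  have h1 : form m r V = 0 := by
    simp only [hr, form_sub_left, form_smul_left, hVV, hUV, hnV]; ring
  have h2 : form m r U = 0 := by
    simp only [hr, form_sub_left, form_smul_left, hUU, hs V U, hUV, hnU]; ring
  have h3 : form m r n = 0 := by
    simp only [hr, form_sub_left, form_smul_left, hnn, hs V n, hs U n, hnV, hnU]; ring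
  have h4 : ∀ w : E3, form m r w = 0 := by
    intro w
    have hw : w ∈ Submodule.span ℝ (range ![V, U, n]) := by rw [hspan]; trivial
    induction hw using Submodule.span_induction with
    | mem w hw =>
      obtain ⟨i, rfl⟩ := hw
      fin_cases i
      exacts [h1, h2, h3]
    | zero => simp
    | add a b _ _ ha hb => rw [form_add_right, ha, hb, add_zero]
    | smul c a _ ha => rw [form_smul_right, ha, mul_zero]
  have h5 := h4 p
  simp only [hr, form_sub_left, form_smul_left, hs n p, hp, hs V p, hs U p, hs q p] at h5
  linarith

/-- The structure equation behind the balancing condition: for the one-form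
`ω(c) = g(∇_c n - ½ H dF(c), U)`, where `V` is a conformal Killing field along `F` and `U` is `V`
rotated by a right angle, one has `dω(V, U) = -½ V(H) |V|²`. -/
theorem exterior_derivative_traceless {κ : ℝ} (hM : IsMetricOn s G) (hκ : HasConstCurv s G κ)
    (hF : ContDiffAt ℝ 2 F y) (hFs : ∀ᶠ z in 𝓝 y, F z ∈ s) {n U V : E3 → E3} {H : E3 → ℝ}
    (hn : ContDiffAt ℝ 2 n y) (hU : DifferentiableAt ℝ U y) (hV : DifferentiableAt ℝ V y)
    (hH : DifferentiableAt ℝ H y) {a b : E3} (hVa : V y = fderiv ℝ F y a)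
    (hUb : U y = fderiv ℝ F y b) (hnn : ∀ᶠ z in 𝓝 y, form (G (F z)) (n z) (n z) = 1)
    (hnV : form (G (F y)) (n y) (V y) = 0) (hnU : form (G (F y)) (n y) (U y) = 0)
    (hUV : ∀ᶠ z in 𝓝 y, form (G (F z)) (U z) (V z) = 0)
    (hUU : ∀ᶠ z in 𝓝 y, form (G (F z)) (U z) (U z) = form (G (F z)) (V z) (V z)) {μ : ℝ}
    (hconf : ∀ c d, (c = a ∨ c = b) → (d = a ∨ d = b) →
      form (G (F y)) (cov s G F V y c) (fderiv ℝ F y d) + form (G (F y)) (cov s G F V y d)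
        (fderiv ℝ F y c) = μ * form (G (F y)) (fderiv ℝ F y c) (fderiv ℝ F y d))
    (hsym : form (G (F y)) (cov s G F n y a) (fderiv ℝ F y b) =
      form (G (F y)) (cov s G F n y b) (fderiv ℝ F y a))
    (htr : form (G (F y)) (cov s G F n y a) (fderiv ℝ F y a) + form (G (F y)) (cov s G F n y b)
      (fderiv ℝ F y b) = H y * form (G (F y)) (V y) (V y)) (hV0 : V y ≠ 0) :
    fderiv ℝ (fun z => form (G (F z)) (cov s G F n z b - (1 / 2 * H z) • fderiv ℝ F z b) (U z)) y a
      - fderiv ℝ (fun z => form (G (F z)) (cov s G F n z a - (1 / 2 * H z) • fderiv ℝ F z a) (U z)) y b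
      = - (1 / 2) * fderiv ℝ H y a * form (G (F y)) (V y) (V y) := by
  have hy : F y ∈ s := hFs.self_of_nhds
  have hp := hM.posDef _ hy
  have hs := fun a b => form_symm_of_posDef (G (F y)) a b hp
  have hF1 := hF.differentiableAt two_ne_zero
  have hn1 := hn.differentiableAt two_ne_zero
  set l := form (G (F y)) (V y) (V y) with hl
  have hlpos : 0 < l := form_pos _ _ hp hV0
  have hUl : form (G (F y)) (U y) (U y) = l := hUU.self_of_nhds
  have hUV0 : form (G (F y)) (U y) (V y) = 0 := hUV.self_of_nhds
  have hnn0 : form (G (F y)) (n y) (n y) = 1 := hnn.self_of_nhds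
  have hU0 : U y ≠ 0 := by
    intro h; rw [h] at hUl; simp at hUl; exact hlpos.ne hUl
  have hn0 : n y ≠ 0 := by
    intro h; rw [h] at hnn0; simp at hnn0
  -- The directional derivatives of `ω(c)`. Since `a` and `b` are constant, `dω(a, b)` is the
  -- difference of two of them.
  have hω : ∀ c d, fderiv ℝ (fun z => form (G (F z))
      (cov s G F n z c - (1 / 2 * H z) • fderiv ℝ F z c) (U z)) y d =
      form (G (F y)) (cov s G F (fun z => cov s G F n z c) y d) (U y)
      - 1 / 2 * fderiv ℝ H y d * form (G (F y)) (fderiv ℝ F y c) (U y)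
      - 1 / 2 * H y * form (G (F y)) (cov s G F (fun z => fderiv ℝ F z c) y d) (U y)
      + form (G (F y)) (cov s G F n y c) (cov s G F U y d)
      - 1 / 2 * H y * form (G (F y)) (fderiv ℝ F y c) (cov s G F U y d) := by
    intro c d
    obtain ⟨f', hf, hf'⟩ := hasFDerivAt_cov hM hF hFs hn c
    have h1 := hasFDerivAt_fderiv_apply hF c
    have h2 : HasFDerivAt (fun z => 1 / 2 * H z) ((1 / 2 : ℝ) • fderiv ℝ H y) y :=
      hH.hasFDerivAt.const_mul _
    have h3 : HasFDerivAt (fun z => cov s G F n z c - (1 / 2 * H z) • fderiv ℝ F z c) _ y :=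
      hf.sub (h2.smul h1)
    obtain ⟨g', hg, hg'⟩ := hasFDerivAt_form_comp hM hF1 hFs h3.differentiableAt hU
    have e : cov s G F (fun z => cov s G F n z c - (1 / 2 * H z) • fderiv ℝ F z c) y d =
        cov s G F (fun z => cov s G F n z c) y d - (1 / 2 * H y) • cov s G F (fun z => fderiv ℝ F z c) y d
          - (1 / 2 * fderiv ℝ H y d) • fderiv ℝ F y c := by
      have h4 : ∀ w w' : E3, christoffelVec s G (F y) w' (w - (1 / 2 * H y) • fderiv ℝ F y c) =
          christoffelVec s G (F y) w' w - (1 / 2 * H y) • christoffelVec s G (F y) w' (fderiv ℝ F y c) := by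
        intro w w'
        rw [sub_eq_add_neg, ← neg_smul, christoffelVec_add_right, christoffelVec_smul_right, neg_smul,
          ← sub_eq_add_neg]
      have e1 : cov s G F (fun z => cov s G F n z c) y d =
        f' d + christoffelVec s G (F y) (fderiv ℝ F y d) (cov s G F n y c) := by rw [cov, hf.fderiv]
      have e2 : cov s G F (fun z => fderiv ℝ F z c) y d = (fderiv ℝ (fderiv ℝ F) y).flip c d
        + christoffelVec s G (F y) (fderiv ℝ F y d) (fderiv ℝ F y c) := by rw [cov, h1.fderiv]
      rw [e1, e2, cov, h3.fderiv]
      simp only [h4, sub_apply, add_apply, smul_apply,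
        ContinuousLinearMap.smulRight_apply, smul_eq_mul]
      module
    rw [hg.fderiv, hg', e]
    simp only [form_sub_left, form_smul_left]
    ring
  have hR : form (G (F y)) (riemannVec s G (F y) (V y) (U y) (n y)) (U y) = 0 :=
    form_riemannVec_normal hM hκ hy hU0 (by rw [hs, hUV0]) hn0 hV0 hnU hnV
  rw [hVa, hUb, ← cov_cov_sub hM hF hFs hn, form_sub_left, ← hUb] at hR
  -- Because `|n| = 1`, `∇n` is tangential, and its products with `∇U` can be expanded in the frame
  -- `V, U`.
  have hpn : ∀ c, form (G (F y)) (cov s G F n y c) (n y) = 0 := by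
    intro c
    have := cov_form_eq_zero hM hF1 hFs hn1 hn1 hnn c
    rw [hs (n y)] at this
    linarith
  have dec := fun c q => form_decompose (p := cov s G F n y c) (q := q) hp hlpos.ne' rfl hUl hnn0 hUV0
    hnU hnV (hpn c)
  have d1 := dec b (cov s G F U y a)
  have d2 := dec a (cov s G F U y b)
  have u1 := fun c => cov_form_eq_zero hM hF1 hFs hU hV hUV c
  have u2 := fun c => cov_form_eq hM hF1 hFs hU hV hUU c
  have c1 := hconf a a (Or.inl rfl) (Or.inl rfl)
  have c2 := hconf a b (Or.inl rfl) (Or.inr rfl)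
  have c3 := hconf b b (Or.inr rfl) (Or.inr rfl)
  rw [hω, hω, cov_fderiv_symm hM hF hFs b a]
  rw [← hVa, ← hUb] at c2 hsym htr ⊢
  rw [← hVa] at c1
  rw [← hUb] at c3
  have u1a := u1 a
  have u1b := u1 b
  have u2a := u2 a
  have u2b := u2 b
  rw [hs (U y)] at u1a u1b
  rw [hs (V y) (U y), hUV0] at c2
  rw [← hl] at c1
  rw [hUl] at c3
  -- Orthogonality and equal length of `U` and `V`, combined with the conformal Killing equation,
  -- express all tangential components of `∇U` through `μ` and `g(∇_a V, U)`.
  have e1 : form (G (F y)) (cov s G F U y a) (V y) = - form (G (F y)) (cov s G F V y a) (U y) := by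
    linarith
  have e2 : form (G (F y)) (cov s G F U y b) (V y) = - (1 / 2) * μ * l := by linarith
  have e3 : form (G (F y)) (cov s G F U y a) (U y) = (1 / 2) * μ * l := by linarith
  have e4 : form (G (F y)) (cov s G F U y b) (U y) = - form (G (F y)) (cov s G F V y a) (U y) := by
    linarith
  rw [e1, e3] at d1
  rw [e2, e4] at d2
  rw [hs (V y) (U y), hs (V y) (cov s G F U y b), hs (U y) (cov s G F U y a), hUV0, hUl, e2, e3]
  apply mul_left_cancel₀ hlpos.ne'
  -- The terms with `g(∇_a V, U)` cancel by symmetry of the second fundamental form. Those with `μ`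
  -- cancel because the trace of the second fundamental form is `H`: here the subtraction of `½ H γ`
  -- matters.
  linear_combination l * hR + d1 - d2 + form (G (F y)) (cov s G F V y a) (U y) * hsym
    + (1 / 2) * μ * l * htr

end Along

/-! ### The cross product and the curl on S² -/

section Cross

/-- The cross product on Euclidean three-space. -/
def cross (u v : E3) : E3 :=
  !₂[u 1 * v 2 - u 2 * v 1, u 2 * v 0 - u 0 * v 2, u 0 * v 1 - u 1 * v 0]

@[simp] lemma cross_apply_zero (u v : E3) : cross u v 0 = u 1 * v 2 - u 2 * v 1 := rfl
@[simp] lemma cross_apply_one (u v : E3) : cross u v 1 = u 2 * v 0 - u 0 * v 2 := rfl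
@[simp] lemma cross_apply_two (u v : E3) : cross u v 2 = u 0 * v 1 - u 1 * v 0 := rfl

lemma inner_eq (u v : E3) : ⟪u, v⟫ = u 0 * v 0 + u 1 * v 1 + u 2 * v 2 := by
  simp [PiLp.inner_apply, Fin.sum_univ_three]; ring

@[simp] lemma cross_zero_left (v : E3) : cross 0 v = 0 := by
  ext i; fin_cases i <;> simp [cross]

@[simp] lemma cross_zero_right (v : E3) : cross v 0 = 0 := by
  ext i; fin_cases i <;> simp [cross]

lemma inner_cross_self_left (u v : E3) : ⟪u, cross u v⟫ = 0 := by
  simp [inner_eq]; ring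

lemma inner_cross_self_right (u v : E3) : ⟪v, cross u v⟫ = 0 := by
  simp [inner_eq]; ring

lemma inner_cross_rotate (u v w : E3) : ⟪u, cross v w⟫ = ⟪cross u v, w⟫ := by
  simp [inner_eq]; ring

lemma inner_cross_cross (u v w z : E3) :
    ⟪cross u v, cross w z⟫ = ⟪u, w⟫ * ⟪v, z⟫ - ⟪u, z⟫ * ⟪v, w⟫ := by
  simp [inner_eq]; ring

lemma cross_cross (u v w : E3) : cross u (cross v w) = ⟪u, w⟫ • v - ⟪u, v⟫ • w := by
  ext i; fin_cases i <;> simp [inner_eq] <;> ring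

/-- By the triple product expansion `x × (u × v) = 0`, so `u × v` is normal to the sphere. -/
lemma cross_eq_smul {x u v : E3} (hx : ⟪x, x⟫ = 1) (hu : ⟪x, u⟫ = 0) (hv : ⟪x, v⟫ = 0) :
    cross u v = ⟪x, cross u v⟫ • x := by
  have h1 : cross x (cross u v) = 0 := by rw [cross_cross, hu, hv]; simp
  have h2 := cross_cross x x (cross u v)
  rw [h1, cross_zero_right, hx, one_smul] at h2
  exact (sub_eq_zero.1 h2.symm).symm

lemma ContDiffAt.cross {n : ℕ∞ω} {P Q : E3 → E3} {y : E3} (hP : ContDiffAt ℝ n P y)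
    (hQ : ContDiffAt ℝ n Q y) : ContDiffAt ℝ n (fun z => cross (P z) (Q z)) y := by
  rw [contDiffAt_euclidean]
  have hP' : ∀ i, ContDiffAt ℝ n (fun z => P z i) y := contDiffAt_euclidean.1 hP
  have hQ' : ∀ i, ContDiffAt ℝ n (fun z => Q z i) y := contDiffAt_euclidean.1 hQ
  intro i
  fin_cases i
  · exact ((hP' 1).mul (hQ' 2)).sub ((hP' 2).mul (hQ' 1))
  · exact ((hP' 2).mul (hQ' 0)).sub ((hP' 0).mul (hQ' 2))
  · exact ((hP' 0).mul (hQ' 1)).sub ((hP' 1).mul (hQ' 0))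

lemma hasFDerivAt_radialProj {y : E3} (hy : y ≠ 0) :
    ∃ L : E3 →L[ℝ] E3, HasFDerivAt (fun z => (radialProj z : E3)) L y ∧
      ∀ u, L u = ‖y‖⁻¹ • u - (‖y‖⁻¹ ^ 3 * ⟪y, u⟫) • y := by
  have hn : ‖y‖ ≠ 0 := norm_ne_zero_iff.2 hy
  have h1 : HasFDerivAt (fun z : E3 => ‖z‖ ^ 2) (2 • innerSL ℝ y) y :=
    (hasStrictFDerivAt_norm_sq y).hasFDerivAt
  have h2 : HasDerivAt (fun t : ℝ => (Real.sqrt t)⁻¹) (-(1 / (2 * Real.sqrt (‖y‖ ^ 2))) /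
      (Real.sqrt (‖y‖ ^ 2)) ^ 2) (‖y‖ ^ 2) := by
    refine (Real.hasDerivAt_sqrt (by positivity)).inv ?_
    rw [Real.sqrt_sq (norm_nonneg y)]; exact hn
  have h3 := (h2.comp_hasFDerivAt y h1).smul (hasFDerivAt_id y)
  refine ⟨_, h3.congr_of_eventuallyEq ?_, fun u => ?_⟩
  · filter_upwards [isOpen_ne.mem_nhds hy] with z hz
    simp [coe_radialProj hz, Real.sqrt_sq (norm_nonneg z)]
  · simp only [Real.sqrt_sq (norm_nonneg y), Function.comp_apply, add_apply, smul_apply,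
      ContinuousLinearMap.smulRight_apply, ContinuousLinearMap.id_apply, innerSL_apply_apply, id,
      nsmul_eq_mul, smul_eq_mul]
    rw [sub_eq_add_neg, ← neg_smul]
    congr 2
    field_simp
    norm_num

lemma contDiffAt_radialProj {n : ℕ∞ω} {y : E3} (hy : y ≠ 0) :
    ContDiffAt ℝ n (fun z => (radialProj z : E3)) y := by
  have h : ContDiffAt ℝ n (fun z : E3 => ‖z‖⁻¹ • z) y :=
    ((contDiffAt_norm ℝ hy).inv (norm_ne_zero_iff.2 hy)).smul contDiffAt_id
  refine h.congr_of_eventuallyEq ?_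
  filter_upwards [isOpen_ne.mem_nhds hy] with z hz
  exact coe_radialProj hz

lemma sD_coe (x : S2) (u : E3) : sD (fun z : S2 => (z : E3)) x u = u - ⟪(x : E3), u⟫ • (x : E3) := by
  obtain ⟨L, hL, hL'⟩ := hasFDerivAt_radialProj x.ne_zero
  rw [sD, hL.fderiv, hL', x.norm_eq]
  simp

/-- The divergence of `η × x` is the normal component of the curl of `η`. -/
lemma sDiv_cross {η : S2 → E3} {x : S2} (hη : DifferentiableAt ℝ (hom η) (x : E3)) {u v : E3}
    (hu : ⟪(x : E3), u⟫ = 0) (hv : ⟪(x : E3), v⟫ = 0) :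
    ⟪fderiv ℝ (hom η) (x : E3) u, v⟫ - ⟪fderiv ℝ (hom η) (x : E3) v, u⟫ =
      ⟪(x : E3), cross u v⟫ * sDiv (fun z => cross (η z) (z : E3)) x := by
  set L := fderiv ℝ (hom η) (x : E3) with hL
  have hd : ∀ w, sD (fun z : S2 => cross (η z) (z : E3)) x w =
      cross (L w) (x : E3) + cross (η x) (w - ⟪(x : E3), w⟫ • (x : E3)) := by
    intro w
    obtain ⟨R, hR, hR'⟩ := hasFDerivAt_radialProj x.ne_zero
    have hRx : ∀ w, R w = w - ⟪(x : E3), w⟫ • (x : E3) := fun w => by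
      rw [hR', x.norm_eq]; simp
    have h1 : ∀ i, HasFDerivAt (fun y => hom η y i) ((EuclideanSpace.proj i : E3 →L[ℝ] ℝ).comp L) (x : E3) :=
      fun i => (EuclideanSpace.proj i : E3 →L[ℝ] ℝ).hasFDerivAt.comp (x : E3) hη.hasFDerivAt
    have h2 : ∀ i, HasFDerivAt (fun y => (radialProj y : E3) i)
        ((EuclideanSpace.proj i : E3 →L[ℝ] ℝ).comp R) (x : E3) :=
      fun i => (EuclideanSpace.proj i : E3 →L[ℝ] ℝ).hasFDerivAt.comp (x : E3) hR
    have hdiff : DifferentiableAt ℝ (fun y => cross (hom η y) (radialProj y : E3)) (x : E3) := by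
      rw [differentiableAt_euclidean]
      intro i
      fin_cases i
      · exact (((h1 1).mul (h2 2)).sub ((h1 2).mul (h2 1))).differentiableAt
      · exact (((h1 2).mul (h2 0)).sub ((h1 0).mul (h2 2))).differentiableAt
      · exact (((h1 0).mul (h2 1)).sub ((h1 1).mul (h2 0))).differentiableAt
    have hc : ∀ i (f' : E3 →L[ℝ] ℝ), HasFDerivAt (fun y => cross (hom η y) (radialProj y : E3) i) f'
        (x : E3) → sD (fun z : S2 => cross (η z) (z : E3)) x w i = f' w := by
      intro i f' hf'
      have h3 := (EuclideanSpace.proj i : E3 →L[ℝ] ℝ).hasFDerivAt.comp (x : E3) hdiff.hasFDerivAt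
      have h4 := hf'.unique h3
      rw [h4]; rfl
    rw [← hRx]
    ext i
    fin_cases i
    · refine (hc 0 _ (((h1 1).mul (h2 2)).sub ((h1 2).mul (h2 1)))).trans ?_
      simp; ring
    · refine (hc 1 _ (((h1 2).mul (h2 0)).sub ((h1 0).mul (h2 2)))).trans ?_
      simp; ring
    · refine (hc 2 _ (((h1 0).mul (h2 1)).sub ((h1 1).mul (h2 0)))).trans ?_
      simp; ring
  have hexp : ∀ w i, L w i = w 0 * L (EuclideanSpace.single 0 1) i
      + w 1 * L (EuclideanSpace.single 1 1) i + w 2 * L (EuclideanSpace.single 2 1) i := by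
    intro w i
    have := clm_apply_eq_sum ((EuclideanSpace.proj i : E3 →L[ℝ] ℝ).comp L) w
    simpa [Fin.sum_univ_three] using this
  have hcr := cross_eq_smul x.inner_self hu hv
  have h0 := congrArg (fun w : E3 => w 0) hcr
  have h1 := congrArg (fun w : E3 => w 1) hcr
  have h2 := congrArg (fun w : E3 => w 2) hcr
  set t := ⟪(x : E3), cross u v⟫ with ht
  simp only [cross_apply_zero, cross_apply_one, cross_apply_two, PiLp.smul_apply, smul_eq_mul] at h0 h1 h2
  simp only [sDiv, hd, Fin.sum_univ_three]
  rw [inner_eq, inner_eq]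
  simp only [hexp u, hexp v]
  simp [inner_eq]
  generalize L (EuclideanSpace.single 0 1) = a at *
  generalize L (EuclideanSpace.single 1 1) = b at *
  generalize L (EuclideanSpace.single 2 1) = c at *
  -- The coefficients are the components of the Euclidean curl of the extension of `η`, paired with
  -- `u × v = t x`.
  linear_combination (b 2 - c 1) * h0 + (c 0 - a 2) * h1 + (a 1 - b 0) * h2

end Cross

/-! ### First and second fundamental forms in local coordinates -/

/-- Near `x`, the tensors `γ` and `A` along `S²` are the first and second fundamental forms of the
map `f` into the metric `(s, G)` of constant curvature, with unit normal `m`. -/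
structure IsLocalRep (κ : ℝ) (s : Set E3) (G : E3 → Matrix (Fin 3) (Fin 3) ℝ) (f m : S2 → E3)
    (γ A : S2 → E3 → E3 → ℝ) (x : S2) : Prop where
  metric : IsMetricOn s G
  curv : HasConstCurv s G κ
  smooth : ContDiffAt ℝ 3 (hom f) (x : E3)
  normal_smooth : ContDiffAt ℝ 2 (hom m) (x : E3)
  mem : ∀ᶠ z in 𝓝 x, f z ∈ s
  unit : ∀ᶠ z in 𝓝 x, form (G (f z)) (m z) (m z) = 1
  normal : ∀ᶠ z in 𝓝 x, ∀ u, form (G (f z)) (m z) (sD f z u) = 0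
  first : ∀ᶠ z in 𝓝 x, ∀ u v, γ z u v = form (G (f z)) (sD f z u) (sD f z v)
  second : ∀ᶠ z in 𝓝 x, ∀ u v, A z u v = secondFF s G f (m z) z u v

lemma contDiffAt_comp_of_mem {k : ℕ∞ω} {s : Set E3} {f : E3 → ℝ} {F : E3 → E3} {y : E3}
    (hf : ContDiffWithinAt ℝ k f s (F y)) (hF : ContDiffAt ℝ k F y) (hFs : ∀ᶠ z in 𝓝 y, F z ∈ s) :
    ContDiffAt ℝ k (fun z => f (F z)) y := by
  rw [← contDiffWithinAt_univ] at hF ⊢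
  exact hf.comp_of_preimage_mem_nhdsWithin y hF (by rw [nhdsWithin_univ]; exact hFs)

lemma contDiffAt_form {k : ℕ∞ω} {M : E3 → Matrix (Fin 3) (Fin 3) ℝ} {P Q : E3 → E3} {y : E3}
    (hM : ∀ i j, ContDiffAt ℝ k (fun z => M z i j) y) (hP : ContDiffAt ℝ k P y)
    (hQ : ContDiffAt ℝ k Q y) : ContDiffAt ℝ k (fun z => form (M z) (P z) (Q z)) y := by
  have hP' : ∀ i, ContDiffAt ℝ k (fun z => P z i) y := contDiffAt_euclidean.1 hP
  have hQ' : ∀ i, ContDiffAt ℝ k (fun z => Q z i) y := contDiffAt_euclidean.1 hQ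
  exact ContDiffAt.sum fun i _ => ContDiffAt.sum fun j _ => ((hM i j).mul (hP' i)).mul (hQ' j)

/-- The Christoffel symbols of a `C²` metric are `C¹`, so no derivative is lost beyond the one taken
of `F` and `n`. -/
lemma contDiffAt_cov {s : Set E3} {G : E3 → Matrix (Fin 3) (Fin 3) ℝ} {F n : E3 → E3} {y : E3}
    (hM : IsMetricOn s G) (hF : ContDiffAt ℝ 2 F y) (hFs : ∀ᶠ z in 𝓝 y, F z ∈ s)
    (hn : ContDiffAt ℝ 2 n y) (b : E3) : ContDiffAt ℝ 1 (fun z => cov s G F n z b) y := by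
  have hd : ∀ {f : E3 → E3}, ContDiffAt ℝ 2 f y → ContDiffAt ℝ 1 (fun z => fderiv ℝ f z b) y :=
    fun hf => (hf.fderiv_right (m := 1) (by norm_num)).clm_apply contDiffAt_const
  refine (hd hn).add ?_
  rw [contDiffAt_euclidean]
  intro k
  exact contDiffAt_form (M := fun z => Matrix.of fun i j => christoffel s G k i j (F z))
    (fun i j => contDiffAt_comp_of_mem (hM.contDiffOn_christoffel k i j _ hFs.self_of_nhds)
      (hF.of_le one_le_two) hFs) (hd hF) (hn.of_le one_le_two)

namespace IsLocalRep

variable {κ : ℝ} {s : Set E3} {G : E3 → Matrix (Fin 3) (Fin 3) ℝ} {f m : S2 → E3}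
    {γ A : S2 → E3 → E3 → ℝ} {x : S2}

lemma eventually (h : IsLocalRep κ s G f m γ A x) : ∀ᶠ z in 𝓝 x, IsLocalRep κ s G f m γ A z := by
  have h1 := eventually_coe (h.smooth.eventually (by simp))
  have h2 := eventually_coe (h.normal_smooth.eventually (by simp))
  filter_upwards [h1, h2, h.mem.eventually_nhds, h.unit.eventually_nhds, h.normal.eventually_nhds,
    h.first.eventually_nhds, h.second.eventually_nhds] with z a1 a2 a3 a4 a5 a6 a7
  exact ⟨h.metric, h.curv, a1, a2, a3, a4, a5, a6, a7⟩

lemma smooth_two (h : IsLocalRep κ s G f m γ A x) : ContDiffAt ℝ 2 (hom f) (x : E3) :=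
  h.smooth.of_le (by norm_num)

lemma differentiableAt (h : IsLocalRep κ s G f m γ A x) : DifferentiableAt ℝ (hom f) (x : E3) :=
  h.smooth.differentiableAt (by norm_num)

lemma normal_differentiableAt (h : IsLocalRep κ s G f m γ A x) :
    DifferentiableAt ℝ (hom m) (x : E3) :=
  h.normal_smooth.differentiableAt (by norm_num)

lemma hom_mem (h : IsLocalRep κ s G f m γ A x) : ∀ᶠ y in 𝓝 (x : E3), hom f y ∈ s :=
  eventually_radialProj h.mem

lemma posDef (h : IsLocalRep κ s G f m γ A x) : (G (f x)).PosDef :=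
  h.metric.posDef _ h.mem.self_of_nhds

lemma hom_unit (h : IsLocalRep κ s G f m γ A x) :
    ∀ᶠ y in 𝓝 (x : E3), form (G (hom f y)) (hom m y) (hom m y) = 1 :=
  eventually_radialProj h.unit

lemma eventually_ne_zero (x : S2) : ∀ᶠ y in 𝓝 (x : E3), y ≠ 0 := isOpen_ne.mem_nhds x.ne_zero

lemma eventually_radialProj' (h : IsLocalRep κ s G f m γ A x) :
    ∀ᶠ y in 𝓝 (x : E3), IsLocalRep κ s G f m γ A (radialProj y) :=
  eventually_radialProj h.eventually

lemma fderiv_eq {y : E3} (hy : y ≠ 0) (h : IsLocalRep κ s G f m γ A (radialProj y)) (u : E3) :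
    sD f (radialProj y) u = ‖y‖ • fderiv ℝ (hom f) y u := by
  rw [fderiv_hom hy h.differentiableAt, smul_smul, mul_inv_cancel₀ (norm_ne_zero_iff.2 hy), one_smul]

lemma hom_normal (h : IsLocalRep κ s G f m γ A x) :
    ∀ᶠ y in 𝓝 (x : E3), ∀ u, form (G (hom f y)) (hom m y) (fderiv ℝ (hom f) y u) = 0 := by
  filter_upwards [eventually_ne_zero x, h.eventually_radialProj'] with y hy hr u
  rw [fderiv_hom hy hr.differentiableAt, form_smul_right]
  exact mul_eq_zero_of_right _ (hr.normal.self_of_nhds u)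

/-- The differential of the extension has degree `-1` while `γ` is extended with degree zero; the
factor `‖y‖²` makes up for this. -/
lemma first_eq (h : IsLocalRep κ s G f m γ A x) : ∀ᶠ y in 𝓝 (x : E3), ∀ u v,
    γ (radialProj y) u v = ‖y‖ ^ 2 * form (G (hom f y)) (fderiv ℝ (hom f) y u)
      (fderiv ℝ (hom f) y v) := by
  filter_upwards [eventually_ne_zero x, h.eventually_radialProj'] with y hy hr u v
  rw [hr.first.self_of_nhds, fderiv_eq hy hr, fderiv_eq hy hr, form_smul_left, form_smul_right]
  change _ * (_ * form (G (hom f y)) _ _) = _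
  ring

lemma cov_hom {y : E3} (hy : y ≠ 0) (h : IsLocalRep κ s G f m γ A (radialProj y)) (u : E3) :
    cov s G (hom f) (hom m) (radialProj y : E3) u = ‖y‖ • cov s G (hom f) (hom m) y u := by
  have hn : ‖y‖ ≠ 0 := norm_ne_zero_iff.2 hy
  have h1 : fderiv ℝ (hom m) (radialProj y : E3) u = ‖y‖ • fderiv ℝ (hom m) y u := by
    rw [fderiv_hom hy h.normal_differentiableAt, smul_smul, mul_inv_cancel₀ hn, one_smul]
    rfl
  have h2 := fderiv_eq hy h u
  rw [sD_eq] at h2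
  rw [cov, cov, h1, h2, smul_add, christoffelVec_smul_left, hom_coe, hom_coe]
  rfl

lemma sD2_eq (h : IsLocalRep κ s G f m γ A x) (u v : E3) :
    sD2 f x u v = fderiv ℝ (fderiv ℝ (hom f)) (x : E3) v u :=
  congrArg (fun L : E3 →L[ℝ] E3 => L v) (hasFDerivAt_fderiv_apply h.smooth_two u).fderiv

/-- The Weingarten equation: differentiate `g(n, df(v)) = 0` in the direction `u`. -/
lemma second_self (h : IsLocalRep κ s G f m γ A x) (u v : E3) :
    A x u v = form (G (f x)) (cov s G (hom f) (hom m) (x : E3) u) (sD f x v) := by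
  have h1 := hasFDerivAt_fderiv_apply h.smooth_two v
  have h2 := cov_form_eq_zero h.metric h.differentiableAt h.hom_mem h.normal_differentiableAt
    h1.differentiableAt (h.hom_normal.mono fun y hy => hy v) u
  rw [h.second.self_of_nhds, secondFF, h.sD2_eq, fderiv_fderiv_symm h.smooth_two v u]
  have e : cov s G (hom f) (fun z => fderiv ℝ (hom f) z v) (x : E3) u =
      fderiv ℝ (fderiv ℝ (hom f)) (x : E3) u v + christoffelVec s G (f x) (sD f x u) (sD f x v) := by
    rw [cov, h1.fderiv, hom_coe, ContinuousLinearMap.flip_apply, sD_eq, sD_eq]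
  rw [hom_coe, hom_coe, form_symm_of_posDef _ (m x) _ h.posDef, e] at h2
  rw [sD_eq x v] at h2 ⊢
  linarith

lemma second_eq (h : IsLocalRep κ s G f m γ A x) : ∀ᶠ y in 𝓝 (x : E3), ∀ u v,
    A (radialProj y) u v = ‖y‖ ^ 2 * form (G (hom f y)) (cov s G (hom f) (hom m) y u)
      (fderiv ℝ (hom f) y v) := by
  filter_upwards [eventually_ne_zero x, h.eventually_radialProj'] with y hy hr u v
  rw [hr.second_self, fderiv_eq hy hr, cov_hom hy hr, form_smul_left, form_smul_right]
  change _ * (_ * form (G (hom f y)) _ _) = _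
  ring

lemma contDiffAt_metric (h : IsLocalRep κ s G f m γ A x) (i j : Fin 3) :
    ContDiffAt ℝ 1 (fun z => G (hom f z) i j) (x : E3) :=
  contDiffAt_comp_of_mem (((h.metric.contDiffOn i j).of_le one_le_two) _ (h.hom_mem.self_of_nhds))
    (h.smooth.of_le (by norm_num)) h.hom_mem

lemma contDiffAt_fderiv (h : IsLocalRep κ s G f m γ A x) (u : E3) :
    ContDiffAt ℝ 1 (fun z => fderiv ℝ (hom f) z u) (x : E3) :=
  (h.smooth_two.fderiv_right (m := 1) (by norm_num)).clm_apply contDiffAt_const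

lemma contDiffAt_first (h : IsLocalRep κ s G f m γ A x) (u v : E3) :
    ContDiffAt ℝ 1 (hom fun z => γ z u v) (x : E3) := by
  have h1 : ContDiffAt ℝ 1 (fun y => ‖y‖ ^ 2 * form (G (hom f y)) (fderiv ℝ (hom f) y u)
      (fderiv ℝ (hom f) y v)) (x : E3) :=
    (contDiff_norm_sq ℝ).contDiffAt.mul
      (contDiffAt_form h.contDiffAt_metric (h.contDiffAt_fderiv u) (h.contDiffAt_fderiv v))
  exact h1.congr_of_eventuallyEq (h.first_eq.mono fun y hy => hy u v)

lemma contDiffAt_second (h : IsLocalRep κ s G f m γ A x) (u v : E3) :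
    ContDiffAt ℝ 1 (hom fun z => A z u v) (x : E3) := by
  have h1 : ContDiffAt ℝ 1 (fun y => ‖y‖ ^ 2 * form (G (hom f y)) (cov s G (hom f) (hom m) y u)
      (fderiv ℝ (hom f) y v)) (x : E3) :=
    (contDiff_norm_sq ℝ).contDiffAt.mul
      (contDiffAt_form h.contDiffAt_metric (contDiffAt_cov h.metric h.smooth_two h.hom_mem
        h.normal_smooth u) (h.contDiffAt_fderiv v))
  exact h1.congr_of_eventuallyEq (h.second_eq.mono fun y hy => hy u v)

lemma second_symm (h : IsLocalRep κ s G f m γ A x) (u v : E3) : A x u v = A x v u := by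
  rw [h.second.self_of_nhds, h.second.self_of_nhds, secondFF, secondFF, h.sD2_eq, h.sD2_eq,
    fderiv_fderiv_symm h.smooth_two, christoffelVec_symm h.metric h.mem.self_of_nhds]

lemma form_eq_form_of_linear {M : Matrix (Fin 3) (Fin 3) ℝ} {P Q : E3 → E3}
    (hP : ∀ w : E3, P w = w 0 • P (EuclideanSpace.single 0 1) + w 1 • P (EuclideanSpace.single 1 1)
      + w 2 • P (EuclideanSpace.single 2 1))
    (hQ : ∀ w : E3, Q w = w 0 • Q (EuclideanSpace.single 0 1) + w 1 • Q (EuclideanSpace.single 1 1)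
      + w 2 • Q (EuclideanSpace.single 2 1)) (u v : E3) :
    form M (P u) (Q v) = form (Matrix.of fun i j =>
      form M (P (EuclideanSpace.single i 1)) (Q (EuclideanSpace.single j 1))) u v := by
  have h : ∀ g : Fin 3 → Fin 3 → ℝ, form (Matrix.of g) u v = ∑ i, ∑ j, g i j * u i * v j :=
    fun g => rfl
  rw [h, hP u, hQ v]
  simp only [form_add_left, form_add_right, form_smul_left, form_smul_right, Fin.sum_univ_three]
  ring

lemma sD_eq_sum (f : S2 → E3) (x : S2) (w : E3) : sD f x w = w 0 • sD f x (EuclideanSpace.single 0 1)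
    + w 1 • sD f x (EuclideanSpace.single 1 1) + w 2 • sD f x (EuclideanSpace.single 2 1) := by
  simp only [sD, ← map_smul, ← map_add]
  congr 1
  ext i; fin_cases i <;> simp

lemma cov_eq_sum (w y : E3) (F n : E3 → E3) : cov s G F n y w =
    w 0 • cov s G F n y (EuclideanSpace.single 0 1) + w 1 • cov s G F n y (EuclideanSpace.single 1 1)
      + w 2 • cov s G F n y (EuclideanSpace.single 2 1) := by
  have h1 : w = w 0 • EuclideanSpace.single 0 1 + w 1 • EuclideanSpace.single 1 1
      + w 2 • EuclideanSpace.single 2 1 := by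
    ext i; fin_cases i <;> simp
  conv_lhs => rw [h1]
  simp only [cov, map_add, map_smul, christoffelVec_add_left, christoffelVec_smul_left, smul_add]
  abel

lemma first_eq_form (h : IsLocalRep κ s G f m γ A x) (u v : E3) : γ x u v =
    form (Matrix.of fun i j => γ x (EuclideanSpace.single i 1) (EuclideanSpace.single j 1)) u v := by
  simp only [h.first.self_of_nhds]
  exact form_eq_form_of_linear (sD_eq_sum f x) (sD_eq_sum f x) u v

lemma second_eq_form (h : IsLocalRep κ s G f m γ A x) (u v : E3) : A x u v =
    form (Matrix.of fun i j => A x (EuclideanSpace.single i 1) (EuclideanSpace.single j 1)) u v := by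
  simp only [h.second_self]
  exact form_eq_form_of_linear (fun w => cov_eq_sum w _ _ _) (sD_eq_sum f x) u v

lemma first_symm (h : IsLocalRep κ s G f m γ A x) (u v : E3) : γ x u v = γ x v u := by
  rw [h.first.self_of_nhds, h.first.self_of_nhds, form_symm_of_posDef _ _ _ h.posDef]

lemma first_nonneg (h : IsLocalRep κ s G f m γ A x) (u : E3) : 0 ≤ γ x u u := by
  rw [h.first.self_of_nhds]
  by_cases h0 : sD f x u = 0
  · simp [h0]
  · exact (form_pos _ _ h.posDef h0).le

/-- The ray direction lies in the kernel of `γ`, which is thereby a tensor on all of ℝ³ determined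
by tangent vectors. -/
lemma first_self (h : IsLocalRep κ s G f m γ A x) (u : E3) : γ x (x : E3) u = 0 := by
  rw [h.first.self_of_nhds, sD_self h.differentiableAt, form_zero_left]

lemma second_self_left (h : IsLocalRep κ s G f m γ A x) (u : E3) : A x (x : E3) u = 0 := by
  rw [h.second_symm, h.second_self, sD_self h.differentiableAt, form_zero_right]

end IsLocalRep

/-! ### Surfaces parametrized by S² and the balancing condition -/

/-- The standard basis vectors of Euclidean three-space. -/
abbrev stdVec (i : Fin 3) : E3 := EuclideanSpace.single i 1

/-- A surface immersed in spaces of constant curvature `κ`, parametrized by `S²`: first fundamental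
form `γ`, second fundamental form `A`, mean curvature `H`, and density `a` of the area form. -/
structure IsSurface (κ : ℝ) (γ A : S2 → E3 → E3 → ℝ) (H a : S2 → ℝ) : Prop where
  rep : ∀ x, ∃ s G f m, IsLocalRep κ s G f m γ A x
  trace : ∀ x u v, H x * (γ x u u * γ x v v - γ x u v ^ 2) =
    A x u u * γ x v v + A x v v * γ x u u - 2 * A x u v * γ x u v
  area_pos : ∀ x, 0 < a x
  area : ∀ x u v, γ x u u * γ x v v - γ x u v ^ 2 = a x ^ 2 * ⟪(x : E3), cross u v⟫ ^ 2

/-- `X` is a tangential `C¹` conformal Killing field of the metric `γ`. -/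
structure IsKilling (γ : S2 → E3 → E3 → ℝ) (X : S2 → E3) : Prop where
  smooth : ∀ x : S2, ContDiffAt ℝ 1 (hom X) (x : E3)
  tangent : ∀ x : S2, ⟪(x : E3), X x⟫ = 0
  conformal : ∀ x : S2, ∃ μ : ℝ, ∀ u v : E3, ⟪(x : E3), u⟫ = 0 → ⟪(x : E3), v⟫ = 0 →
    sD (fun z => γ z u v) x (X x) + γ x (sD X x u) v + γ x u (sD X x v) = μ * γ x u v

/-- The vector representing the linear form `γ(X, ·)`. -/
def flat (γ : S2 → E3 → E3 → ℝ) (X : S2 → E3) (x : S2) : E3 :=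
  WithLp.toLp 2 fun j => γ x (X x) (stdVec j)

/-- The field `X` rotated by a right angle with respect to `γ`. -/
def rotate (γ : S2 → E3 → E3 → ℝ) (a : S2 → ℝ) (X : S2 → E3) (x : S2) : E3 :=
  (a x)⁻¹ • cross (x : E3) (flat γ X x)

/-- The vector representing the one-form `A(·, Y) - ½ H γ(·, Y)`. -/
def traceless (γ A : S2 → E3 → E3 → ℝ) (H : S2 → ℝ) (Y : S2 → E3) (x : S2) : E3 :=
  WithLp.toLp 2 fun j => A x (stdVec j) (Y x) - 1 / 2 * H x * γ x (stdVec j) (Y x)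

namespace IsSurface

variable {κ : ℝ} {γ A : S2 → E3 → E3 → ℝ} {H a : S2 → ℝ} {X : S2 → E3}

lemma first_symm (h : IsSurface κ γ A H a) (x : S2) (u v : E3) : γ x u v = γ x v u := by
  obtain ⟨s, G, f, m, hr⟩ := h.rep x
  exact hr.first_symm u v

lemma first_smul_left (h : IsSurface κ γ A H a) (x : S2) (c : ℝ) (u v : E3) :
    γ x (c • u) v = c * γ x u v := by
  obtain ⟨s, G, f, m, hr⟩ := h.rep x
  rw [hr.first_eq_form, hr.first_eq_form u, form_smul_left]

lemma first_self (h : IsSurface κ γ A H a) (x : S2) (v : E3) : γ x (x : E3) v = 0 := by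
  obtain ⟨s, G, f, m, hr⟩ := h.rep x
  exact hr.first_self v

lemma first_nonneg (h : IsSurface κ γ A H a) (x : S2) (v : E3) : 0 ≤ γ x v v := by
  obtain ⟨s, G, f, m, hr⟩ := h.rep x
  exact hr.first_nonneg v

lemma first_eq_sum (h : IsSurface κ γ A H a) (x : S2) (u v : E3) :
    γ x u v = ∑ i, ∑ j, γ x (stdVec i) (stdVec j) * u i * v j := by
  obtain ⟨s, G, f, m, hr⟩ := h.rep x
  exact hr.first_eq_form u v

lemma second_eq_sum (h : IsSurface κ γ A H a) (x : S2) (u v : E3) :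
    A x u v = ∑ i, ∑ j, A x (stdVec i) (stdVec j) * u i * v j := by
  obtain ⟨s, G, f, m, hr⟩ := h.rep x
  exact hr.second_eq_form u v

lemma contDiffAt_first (h : IsSurface κ γ A H a) (x : S2) (u v : E3) :
    ContDiffAt ℝ 1 (hom fun z => γ z u v) (x : E3) := by
  obtain ⟨s, G, f, m, hr⟩ := h.rep x
  exact hr.contDiffAt_first u v

lemma contDiffAt_second (h : IsSurface κ γ A H a) (x : S2) (u v : E3) :
    ContDiffAt ℝ 1 (hom fun z => A z u v) (x : E3) := by
  obtain ⟨s, G, f, m, hr⟩ := h.rep x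
  exact hr.contDiffAt_second u v

/-- The numbers `⟨x, e_i × e_j⟩` for the three coordinate planes are the coordinates of the unit
vector `x`, so the Gram determinants add up to `a²`. This writes `a²` as a polynomial in the
components of `γ`. -/
lemma area_sq (h : IsSurface κ γ A H a) (x : S2) : a x ^ 2 =
    (γ x (stdVec 0) (stdVec 0) * γ x (stdVec 1) (stdVec 1) - γ x (stdVec 0) (stdVec 1) ^ 2)
    + (γ x (stdVec 1) (stdVec 1) * γ x (stdVec 2) (stdVec 2) - γ x (stdVec 1) (stdVec 2) ^ 2)
    + (γ x (stdVec 2) (stdVec 2) * γ x (stdVec 0) (stdVec 0) - γ x (stdVec 2) (stdVec 0) ^ 2) := by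
  have h1 := x.inner_self
  rw [inner_eq] at h1
  rw [h.area, h.area, h.area]
  simp [inner_eq]
  linear_combination (-(a x) ^ 2) * h1

lemma contDiffAt_area (h : IsSurface κ γ A H a) (x : S2) : ContDiffAt ℝ 1 (hom a) (x : E3) := by
  have h1 := h.contDiffAt_first x
  have h2 : hom a = fun y => Real.sqrt (
    (hom (fun z => γ z (stdVec 0) (stdVec 0)) y * hom (fun z => γ z (stdVec 1) (stdVec 1)) y
      - hom (fun z => γ z (stdVec 0) (stdVec 1)) y ^ 2)
    + (hom (fun z => γ z (stdVec 1) (stdVec 1)) y * hom (fun z => γ z (stdVec 2) (stdVec 2)) y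
      - hom (fun z => γ z (stdVec 1) (stdVec 2)) y ^ 2)
    + (hom (fun z => γ z (stdVec 2) (stdVec 2)) y * hom (fun z => γ z (stdVec 0) (stdVec 0)) y
      - hom (fun z => γ z (stdVec 2) (stdVec 0)) y ^ 2)) := by
    funext y
    simp only [hom]
    rw [← h.area_sq, Real.sqrt_sq (h.area_pos _).le]
  rw [h2]
  refine ContDiffAt.sqrt ?_ ?_
  · exact ((((h1 _ _).mul (h1 _ _)).sub ((h1 _ _).pow 2)).add
      (((h1 _ _).mul (h1 _ _)).sub ((h1 _ _).pow 2))).add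
      (((h1 _ _).mul (h1 _ _)).sub ((h1 _ _).pow 2))
  · simp only [hom_coe]
    rw [← h.area_sq]
    exact (pow_pos (h.area_pos x) 2).ne'

/-- Adding the trace identity over the three coordinate planes gives `H a²` as a polynomial in the
components of `γ` and `A`, with `a²` positive. -/
lemma contDiffAt_meanCurv (h : IsSurface κ γ A H a) (x : S2) : ContDiffAt ℝ 1 (hom H) (x : E3) := by
  have h1 := h.contDiffAt_first x
  have h2 := h.contDiffAt_second x
  have hs : ∀ i j : Fin 3, ContDiffAt ℝ 1 (fun y =>
      hom (fun z => A z (stdVec i) (stdVec i)) y * hom (fun z => γ z (stdVec j) (stdVec j)) y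
      + hom (fun z => A z (stdVec j) (stdVec j)) y * hom (fun z => γ z (stdVec i) (stdVec i)) y
      - 2 * hom (fun z => A z (stdVec i) (stdVec j)) y
        * hom (fun z => γ z (stdVec i) (stdVec j)) y) (x : E3) := fun i j =>
    (((h2 _ _).mul (h1 _ _)).add ((h2 _ _).mul (h1 _ _))).sub
      ((contDiffAt_const.mul (h2 _ _)).mul (h1 _ _))
  have h3 := ((((hs 0 1).add (hs 1 2)).add (hs 2 0)).div ((h.contDiffAt_area x).pow 2)
    (by rw [hom_coe]; exact (pow_pos (h.area_pos x) 2).ne'))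
  refine h3.congr_of_eventuallyEq (Eventually.of_forall fun y => ?_)
  simp only [hom, Pi.div_apply]
  rw [eq_div_iff (pow_pos (h.area_pos _) 2).ne', h.area_sq, mul_add, mul_add, h.trace, h.trace, h.trace]

/-- If `γ(u,u) = 0`, the area identity for `u` and `x × u` equates `-γ(u, x × u)²` with the positive
number `a² |u|⁴`. -/
lemma first_pos (h : IsSurface κ γ A H a) (x : S2) {u : E3} (hu : ⟪(x : E3), u⟫ = 0) (h0 : u ≠ 0) :
    0 < γ x u u := by
  refine lt_of_le_of_ne (h.first_nonneg x u) fun h1 => ?_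
  have h2 := h.area x u (cross (x : E3) u)
  have h3 : ⟪(x : E3), cross u (cross (x : E3) u)⟫ = ⟪u, u⟫ := by
    rw [cross_cross, inner_sub_right, real_inner_smul_right, real_inner_smul_right, x.inner_self,
      real_inner_comm, hu]
    ring
  rw [← h1, h3, zero_mul] at h2
  have h4 : 0 < ⟪u, u⟫ := real_inner_self_pos.2 h0
  have h5 := h.area_pos x
  have h6 : 0 < a x ^ 2 * ⟪u, u⟫ ^ 2 := by positivity
  nlinarith [sq_nonneg (γ x u (cross (x : E3) u))]

lemma inner_flat (h : IsSurface κ γ A H a) (x : S2) (w : E3) : ⟪flat γ X x, w⟫ = γ x (X x) w := by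
  rw [h.first_eq_sum]
  simp only [inner_eq, flat, h.first_eq_sum x (X x) (stdVec _)]
  simp [Fin.sum_univ_three]
  ring

lemma inner_rotate (x : S2) : ⟪(x : E3), rotate γ a X x⟫ = 0 := by
  rw [rotate, real_inner_smul_right, inner_cross_self_left, mul_zero]

/-- The rotated field is Euclidean-orthogonal to the vector representing `γ(X, ·)`. -/
lemma first_rotate (h : IsSurface κ γ A H a) (x : S2) : γ x (X x) (rotate γ a X x) = 0 := by
  rw [← h.inner_flat, rotate, real_inner_smul_right, inner_cross_self_right, mul_zero]

lemma inner_cross_rotate (h : IsSurface κ γ A H a) (x : S2) :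
    ⟪(x : E3), cross (X x) (rotate γ a X x)⟫ = (a x)⁻¹ * γ x (X x) (X x) := by
  rw [Balancing.inner_cross_rotate, rotate, real_inner_smul_right, inner_cross_cross, x.inner_self,
    real_inner_comm (flat γ X x) (X x), h.inner_flat, real_inner_comm (flat γ X x) (x : E3),
    h.inner_flat, h.first_symm x (X x) (x : E3), h.first_self]
  ring

/-- The area identity for the orthogonal pair `X, Y`, whose oriented round area is `|X|²/a`, reads
`|X|² |Y|² = |X|⁴`. Zeros of `X` are treated apart. -/
lemma first_rotate_rotate (h : IsSurface κ γ A H a) {x : S2} (hX : ⟪(x : E3), X x⟫ = 0) :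
    γ x (rotate γ a X x) (rotate γ a X x) = γ x (X x) (X x) := by
  by_cases h0 : X x = 0
  · have : flat γ X x = 0 := by
      ext i
      change γ x (X x) (stdVec i) = 0
      rw [h0, ← zero_smul ℝ (0 : E3), h.first_smul_left, zero_mul]
    have h1 : rotate γ a X x = X x := by rw [rotate, this, cross_zero_right, smul_zero, h0]
    rw [h1]
  · have h1 := h.area x (X x) (rotate γ a X x)
    rw [h.first_rotate, h.inner_cross_rotate] at h1
    have h2 := h.first_pos x hX h0
    have h3 := (h.area_pos x).ne'
    field_simp at h1
    nlinarith

lemma contDiffAt_rotate (h : IsSurface κ γ A H a) {x : S2} (hX : ContDiffAt ℝ 1 (hom X) (x : E3)) :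
    ContDiffAt ℝ 1 (hom (rotate γ a X)) (x : E3) := by
  have h1 := h.contDiffAt_first x
  have hX' : ∀ i, ContDiffAt ℝ 1 (fun z => hom X z i) (x : E3) := contDiffAt_euclidean.1 hX
  have h2 : ContDiffAt ℝ 1 (hom (flat γ X)) (x : E3) := by
    rw [contDiffAt_euclidean]
    intro j
    have : ContDiffAt ℝ 1 (fun y => ∑ i, hom (fun z => γ z (stdVec i) (stdVec j)) y * hom X y i) (x : E3) :=
      ContDiffAt.sum fun i _ => (h1 _ _).mul (hX' i)
    refine this.congr_of_eventuallyEq (Eventually.of_forall fun y => ?_)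
    change γ (radialProj y) (X (radialProj y)) (stdVec j) = _
    rw [h.first_eq_sum]
    simp [Fin.sum_univ_three, hom]
  exact ((h.contDiffAt_area x).inv (by rw [hom_coe]; exact (h.area_pos x).ne')).smul
    (ContDiffAt.cross (contDiffAt_radialProj x.ne_zero) h2)

lemma inner_traceless (h : IsSurface κ γ A H a) (Y : S2 → E3) (x : S2) (c : E3) :
    ⟪traceless γ A H Y x, c⟫ = A x c (Y x) - 1 / 2 * H x * γ x c (Y x) := by
  rw [h.first_eq_sum, h.second_eq_sum]
  simp only [inner_eq, traceless, h.first_eq_sum x (stdVec _) (Y x),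
    h.second_eq_sum x (stdVec _) (Y x)]
  simp [Fin.sum_univ_three]
  ring

lemma contDiffAt_traceless (h : IsSurface κ γ A H a) {Y : S2 → E3} {x : S2}
    (hY : ContDiffAt ℝ 1 (hom Y) (x : E3)) :
    ContDiffAt ℝ 1 (hom (traceless γ A H Y)) (x : E3) := by
  have h1 := h.contDiffAt_first x
  have h2 := h.contDiffAt_second x
  have hY' : ∀ i, ContDiffAt ℝ 1 (fun z => hom Y z i) (x : E3) := contDiffAt_euclidean.1 hY
  rw [contDiffAt_euclidean]
  intro j
  have : ContDiffAt ℝ 1 (fun y => (∑ i, hom (fun z => A z (stdVec j) (stdVec i)) y * hom Y y i)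
      - 1 / 2 * hom H y * (∑ i, hom (fun z => γ z (stdVec j) (stdVec i)) y * hom Y y i)) (x : E3) :=
    (ContDiffAt.sum fun i _ => (h2 _ _).mul (hY' i)).sub
      ((contDiffAt_const.mul (h.contDiffAt_meanCurv x)).mul
        (ContDiffAt.sum fun i _ => (h1 _ _).mul (hY' i)))
  refine this.congr_of_eventuallyEq (Eventually.of_forall fun y => ?_)
  change A (radialProj y) (stdVec j) (Y (radialProj y)) - 1 / 2 * H (radialProj y) *
    γ (radialProj y) (stdVec j) (Y (radialProj y)) = _
  rw [h.first_eq_sum, h.second_eq_sum]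
  simp [Fin.sum_univ_three, hom]

end IsSurface

/-- On the unit sphere `‖y‖²` equals one and is stationary in tangential directions, so the
homogeneity factor drops out of tangential derivatives. -/
lemma fderiv_norm_sq_mul {φ : E3 → ℝ} {x : S2} (hφ : DifferentiableAt ℝ φ (x : E3)) {d : E3}
    (hd : ⟪(x : E3), d⟫ = 0) :
    fderiv ℝ (fun y : E3 => ‖y‖ ^ 2 * φ y) (x : E3) d = fderiv ℝ φ (x : E3) d := by
  have h1 : HasFDerivAt (fun z : E3 => ‖z‖ ^ 2) (2 • innerSL ℝ (x : E3)) (x : E3) :=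
    (hasStrictFDerivAt_norm_sq (x : E3)).hasFDerivAt
  have h2 : HasFDerivAt (fun y : E3 => ‖y‖ ^ 2 * φ y) _ (x : E3) := h1.mul hφ.hasFDerivAt
  rw [h2.fderiv]
  simp [x.norm_eq, hd]

lemma fderiv_inner_const {P : E3 → E3} {y : E3} (hP : DifferentiableAt ℝ P y) (c d : E3) :
    fderiv ℝ (fun z => ⟪P z, c⟫) y d = ⟪fderiv ℝ P y d, c⟫ := by
  rw [(hP.hasFDerivAt.inner ℝ (hasFDerivAt_const c y)).fderiv]
  simp [fderivInnerCLM_apply]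

/-- The integrand of the balancing condition is a divergence, away from the zeros of `X`. -/
lemma IsSurface.sDiv_eq_of_ne_zero {κ : ℝ} {γ A : S2 → E3 → E3 → ℝ} {H a : S2 → ℝ} {X : S2 → E3}
    (h : IsSurface κ γ A H a) (hX : IsKilling γ X) {x : S2} (h0 : X x ≠ 0) :
    sDiv (fun z => cross (traceless γ A H (rotate γ a X) z) (z : E3)) x =
      - (1 / 2) * (sD H x (X x) * a x) := by
  obtain ⟨s, G, f, m, hr⟩ := h.rep x
  set Y := rotate γ a X with hY
  have hYs : ContDiffAt ℝ 1 (hom Y) (x : E3) := h.contDiffAt_rotate (hX.smooth x)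
  have hη := (h.contDiffAt_traceless hYs).differentiableAt one_ne_zero
  have hXt := hX.tangent x
  have hYt : ⟪(x : E3), Y x⟫ = 0 := IsSurface.inner_rotate x
  have hfield : ∀ {P : S2 → E3}, ContDiffAt ℝ 1 (hom P) (x : E3) →
      DifferentiableAt ℝ (fun y => fderiv ℝ (hom f) y (hom P y)) (x : E3) := fun hP =>
    ((hr.smooth_two.fderiv_right (m := 1) (by norm_num)).clm_apply hP).differentiableAt one_ne_zero
  have hH : DifferentiableAt ℝ (hom H) (x : E3) := (h.contDiffAt_meanCurv x).differentiableAt one_ne_zero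
  have hpos := h.first_pos x hXt h0
  have hfx : ∀ u v, form (G (hom f (x : E3))) (fderiv ℝ (hom f) (x : E3) u) (fderiv ℝ (hom f) (x : E3) v) =
      γ x u v := fun u v => by
    rw [hr.first.self_of_nhds, hom_coe]; rfl
  have hsx : ∀ u v, form (G (hom f (x : E3))) (cov s G (hom f) (hom m) (x : E3) u)
      (fderiv ℝ (hom f) (x : E3) v) = A x u v := fun u v => by
    rw [hr.second_self, hom_coe]; rfl
  obtain ⟨μ, hμ⟩ := hX.conformal x
  have key := exterior_derivative_traceless (y := (x : E3)) (F := hom f) (n := hom m)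
    (U := fun y => fderiv ℝ (hom f) y (hom Y y)) (V := fun y => fderiv ℝ (hom f) y (hom X y))
    (H := hom H) (a := X x) (b := Y x) (μ := μ)
    hr.metric hr.curv hr.smooth_two hr.hom_mem hr.normal_smooth (hfield hYs) (hfield (hX.smooth x)) hH
    (by rw [hom_coe]) (by rw [hom_coe]) hr.hom_unit (hr.hom_normal.self_of_nhds _)
    (hr.hom_normal.self_of_nhds _) ?_ ?_ ?_ ?_ ?_ ?_
  -- Tangential derivatives of `⟨traceless, c⟩` agree with those of the one-form written in the
  -- local representation.
  · have hloc : ∀ c d, ⟪(x : E3), d⟫ = 0 → ⟪fderiv ℝ (hom (traceless γ A H Y)) (x : E3) d, c⟫ =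
        fderiv ℝ (fun z => form (G (hom f z)) (cov s G (hom f) (hom m) z c
          - (1 / 2 * hom H z) • fderiv ℝ (hom f) z c) (fderiv ℝ (hom f) z (hom Y z))) (x : E3) d := by
      intro c d hd
      have hφ : DifferentiableAt ℝ (fun z => form (G (hom f z)) (cov s G (hom f) (hom m) z c
          - (1 / 2 * hom H z) • fderiv ℝ (hom f) z c) (fderiv ℝ (hom f) z (hom Y z))) (x : E3) := by
        refine (contDiffAt_form hr.contDiffAt_metric
          ((contDiffAt_cov hr.metric hr.smooth_two hr.hom_mem hr.normal_smooth c).sub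
            ((contDiffAt_const.mul (h.contDiffAt_meanCurv x)).smul (hr.contDiffAt_fderiv c)))
          ((hr.smooth_two.fderiv_right (m := 1) (by norm_num)).clm_apply hYs)).differentiableAt one_ne_zero
      rw [← fderiv_norm_sq_mul hφ hd, ← fderiv_inner_const hη]
      congr 1
      refine Filter.EventuallyEq.fderiv_eq ?_
      filter_upwards [hr.first_eq, hr.second_eq] with y h1 h2
      simp only [hom]
      rw [h.inner_traceless, h1, h2, form_sub_left, form_smul_left]
      simp only [hom]
      ring
    -- The curl identity for `X, Y` gives `(|X|²/a) · div = dω(X, Y) = -½ X(H) |X|²`, and `|X|²` can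
    -- be cancelled.
    have h1 := sDiv_cross hη hXt hYt
    rw [hloc _ _ hXt, hloc _ _ hYt, key, h.inner_cross_rotate] at h1
    have h2 : form (G (hom f (x : E3))) (fderiv ℝ (hom f) (x : E3) (hom X (x : E3)))
        (fderiv ℝ (hom f) (x : E3) (hom X (x : E3))) = γ x (X x) (X x) := by rw [hfx, hom_coe]
    rw [h2] at h1
    have h3 := (h.area_pos x).ne'
    have h4 := hpos.ne'
    rw [sD_eq]
    field_simp at h1 ⊢
    linarith
  · filter_upwards [hr.first_eq, IsLocalRep.eventually_ne_zero x] with y hy hy0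
    have h1 := h.first_rotate (X := X) (radialProj y)
    rw [h.first_symm, hy] at h1
    exact (mul_eq_zero.1 h1).resolve_left (pow_ne_zero 2 (norm_ne_zero_iff.2 hy0))
  · filter_upwards [hr.first_eq, IsLocalRep.eventually_ne_zero x] with y hy hy0
    have h1 := h.first_rotate_rotate (X := X) (hX.tangent (radialProj y))
    rw [hy, hy] at h1
    exact mul_left_cancel₀ (pow_ne_zero 2 (norm_ne_zero_iff.2 hy0)) h1
  · intro c d hc hd
    have hct : ⟪(x : E3), c⟫ = 0 := by rcases hc with rfl | rfl <;> assumption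
    have hdt : ⟪(x : E3), d⟫ = 0 := by rcases hd with rfl | rfl <;> assumption
    -- Absence of torsion gives `∇_c df(X) = ∇_X df(c) + df(∂_c X)`; symmetrizing turns the Lie
    -- derivative of `γ` into the symmetric part of `∇ df(X)`.
    have hcov : ∀ c, cov s G (hom f) (fun y => fderiv ℝ (hom f) y (hom X y)) (x : E3) c =
        cov s G (hom f) (fun y => fderiv ℝ (hom f) y c) (x : E3) (X x)
          + fderiv ℝ (hom f) (x : E3) (sD X x c) := by
      intro c
      rw [cov_fderiv_symm hr.metric hr.smooth_two hr.hom_mem, cov, cov,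
        (hasFDerivAt_fderiv_apply hr.smooth_two (X x)).fderiv]
      have h1 : DifferentiableAt ℝ (fderiv ℝ (hom f)) (x : E3) :=
        (hr.smooth_two.fderiv_right (m := 1) (by norm_num)).differentiableAt one_ne_zero
      have h2 := h1.hasFDerivAt.clm_apply ((hX.smooth x).differentiableAt one_ne_zero).hasFDerivAt
      rw [h2.fderiv, sD_eq]
      simp only [hom_coe, add_apply, ContinuousLinearMap.comp_apply, ContinuousLinearMap.flip_apply]
      abel
    obtain ⟨f', hf, hf'⟩ := hasFDerivAt_form_comp hr.metric hr.differentiableAt hr.hom_mem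
      (hasFDerivAt_fderiv_apply hr.smooth_two c).differentiableAt
      (hasFDerivAt_fderiv_apply hr.smooth_two d).differentiableAt
    have h1 : sD (fun z => γ z c d) x (X x) = f' (X x) := by
      rw [← hf.fderiv, ← fderiv_norm_sq_mul hf.differentiableAt hXt]
      exact congrArg (fun L : E3 →L[ℝ] ℝ => L (X x))
        (Filter.EventuallyEq.fderiv_eq (hr.first_eq.mono fun y hy => hy c d))
    have h2 := hμ c d hct hdt
    rw [h1, hf', ← hfx, ← hfx, ← hfx, form_symm_of_posDef _ (fderiv ℝ (hom f) (x : E3) c)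
      (cov s G (hom f) _ _ _) (by rw [hom_coe]; exact hr.posDef),
      form_symm_of_posDef _ (fderiv ℝ (hom f) (x : E3) c)
      (fderiv ℝ (hom f) (x : E3) (sD X x d)) (by rw [hom_coe]; exact hr.posDef)] at h2
    rw [hcov, hcov, form_add_left, form_add_left]
    linarith
  · rw [hsx, hsx, hr.second_symm]
  · simp only [hom_coe] at hfx hsx ⊢
    rw [hsx, hsx, hfx]
    have h1 := h.trace x (X x) (Y x)
    rw [h.first_rotate, h.first_rotate_rotate hXt] at h1
    apply mul_right_cancel₀ hpos.ne'
    linarith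
  · simp only [hom_coe]
    intro h1
    have h2 := hfx (X x) (X x)
    rw [h1, form_zero_left] at h2
    exact hpos.ne h2

/-- The balancing condition for surfaces in spaces of constant curvature. -/
theorem IsSurface.balancing {κ : ℝ} {γ A : S2 → E3 → E3 → ℝ} {H a : S2 → ℝ} {X : S2 → E3}
    (h : IsSurface κ γ A H a) (hX : IsKilling γ X) :
    Integrable (fun x => sD H x (X x) * a x) roundArea ∧
      ∫ x, sD H x (X x) * a x ∂roundArea = 0 := by
  set Z : S2 → E3 := fun z => cross (traceless γ A H (rotate γ a X) z) (z : E3) with hZ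
  have hZs : ∀ x : S2, ContDiffAt ℝ 1 (hom Z) (x : E3) := fun x =>
    ContDiffAt.cross (h.contDiffAt_traceless (h.contDiffAt_rotate (hX.smooth x)))
      (contDiffAt_radialProj x.ne_zero)
  have hZt : ∀ x : S2, ⟪(x : E3), Z x⟫ = 0 := fun x => inner_cross_self_right _ _
  have hcX : Continuous X := continuous_of_hom fun x => (hX.smooth x).continuousAt
  have hca : Continuous a := continuous_of_hom fun x => (h.contDiffAt_area x).continuousAt
  have hcL : Continuous fun x : S2 => sD H x (X x) * a x :=
    ((continuous_sD h.contDiffAt_meanCurv).clm_apply hcX).mul hca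
  have hcR := continuous_sDiv hZs
  -- The identity holds on a closed set containing all points with `X ≠ 0`. A point outside it has a
  -- neighbourhood on which `X`, and with it `Z`, vanishes, so both sides are zero there. Nothing
  -- need be known about the zeros of `X`.
  have key : ∀ x, sDiv Z x = - (1 / 2) * (sD H x (X x) * a x) := by
    have hclosed : IsClosed {x | sDiv Z x = - (1 / 2) * (sD H x (X x) * a x)} :=
      isClosed_eq hcR (continuous_const.mul hcL)
    intro x
    by_contra hx
    have hev : ∀ᶠ z in 𝓝 x, X z = 0 := by
      filter_upwards [hclosed.isOpen_compl.mem_nhds hx] with z hz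
      by_contra h0
      exact hz (h.sDiv_eq_of_ne_zero hX h0)
    have hZ0 : ∀ᶠ z in 𝓝 x, Z z = 0 := by
      filter_upwards [hev] with z hz
      have h1 : flat γ X z = 0 := by
        ext i
        change γ z (X z) (stdVec i) = 0
        rw [hz, ← zero_smul ℝ (0 : E3), h.first_smul_left, zero_mul]
      have h2 : rotate γ a X z = 0 := by rw [rotate, h1, cross_zero_right, smul_zero]
      have h3 : traceless γ A H (rotate γ a X) z = 0 := by
        ext i
        change A z (stdVec i) (rotate γ a X z) - _ = 0
        rw [h2, h.first_eq_sum, h.second_eq_sum]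
        simp
      change cross _ _ = 0
      rw [h3, cross_zero_left]
    apply hx
    rw [hev.self_of_nhds]
    have h4 : fderiv ℝ (hom Z) (x : E3) = 0 := by
      rw [Filter.EventuallyEq.fderiv_eq (f₁ := hom Z) (f := fun _ => (0 : E3))
        (eventually_radialProj hZ0)]
      simp
    simp [sDiv, sD_eq, h4]
  refine ⟨integrable_of_continuous hcL, ?_⟩
  have h1 := integral_sDiv_eq_zero hZs hZt
  simp_rw [key] at h1
  rw [integral_const_mul] at h1
  linarith

/-! ### Traces and determinants in the tangent frame -/

lemma finrank_tangent (x : S2) : Module.finrank ℝ (ℝ ∙ (x : E3))ᗮ = 2 := by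
  have : Fact (Module.finrank ℝ E3 = 2 + 1) := ⟨by simp⟩
  exact Submodule.finrank_orthogonal_span_singleton x.ne_zero

lemma trace_inv_mul_submatrix {ι : Type*} [Fintype ι] [DecidableEq ι] (e : Fin 2 ≃ ι)
    (g q : Matrix ι ι ℝ) : Matrix.trace (g⁻¹ * q) =
      (q (e 0) (e 0) * g (e 1) (e 1) + q (e 1) (e 1) * g (e 0) (e 0) - q (e 1) (e 0) * g (e 0) (e 1)
        - q (e 0) (e 1) * g (e 1) (e 0)) / g.det := by
  have h1 : Matrix.trace (g⁻¹ * q) = Matrix.trace ((g⁻¹ * q).submatrix e e) := by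
    simp only [Matrix.trace, Matrix.diag, Matrix.submatrix_apply]
    exact (e.sum_comp fun i => (g⁻¹ * q) i i).symm
  rw [h1, ← Matrix.submatrix_mul_equiv _ _ e e e, ← Matrix.inv_submatrix_equiv,
    ← Matrix.det_submatrix_equiv_self e g, Matrix.inv_def, Matrix.adjugate_fin_two,
    Matrix.trace_fin_two]
  simp [Matrix.mul_apply, Fin.sum_univ_two]
  ring

/-- An enumeration of the frame of the tangent plane. -/
def frameEquiv (x : S2) : Fin 2 ≃ Fin (Module.finrank ℝ (ℝ ∙ (x : E3))ᗮ) :=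
  finCongr (finrank_tangent x).symm

lemma inner_frame (x : S2) (i) : ⟪(x : E3), (frame x i : E3)⟫ = 0 :=
  Submodule.mem_orthogonal_singleton_iff_inner_right.1 (frame x i).2

lemma eq_frame_sum {x : S2} {u : E3} (hu : ⟪(x : E3), u⟫ = 0) :
    u = ⟪(frame x (frameEquiv x 0) : E3), u⟫ • (frame x (frameEquiv x 0) : E3)
      + ⟪(frame x (frameEquiv x 1) : E3), u⟫ • (frame x (frameEquiv x 1) : E3) := by
  have h1 := (frame x).sum_repr' ⟨u, Submodule.mem_orthogonal_singleton_iff_inner_right.2 hu⟩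
  rw [← (frameEquiv x).sum_comp, Fin.sum_univ_two] at h1
  exact (congrArg Subtype.val h1).symm

/-- Lagrange's identity. The orientation of the chosen frame is unknown, so only the square is
determined. -/
lemma inner_cross_frame_sq (x : S2) :
    ⟪(x : E3), cross (frame x (frameEquiv x 0)) (frame x (frameEquiv x 1))⟫ ^ 2 = 1 := by
  have h0 := inner_frame x (frameEquiv x 0)
  have h1 := inner_frame x (frameEquiv x 1)
  have hc := cross_eq_smul x.inner_self h0 h1
  have ho : ∀ i j, ⟪(frame x i : E3), (frame x j : E3)⟫ = if i = j then 1 else 0 := fun i j =>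
    orthonormal_iff_ite.1 (frame x).orthonormal i j
  have h2 := inner_cross_cross (frame x (frameEquiv x 0) : E3) (frame x (frameEquiv x 1))
    (frame x (frameEquiv x 0)) (frame x (frameEquiv x 1))
  rw [ho, ho, ho, ho, hc, real_inner_smul_left, real_inner_smul_right, x.inner_self] at h2
  simp at h2
  linarith

lemma inner_cross_sq {x : S2} {u v : E3} (hu : ⟪(x : E3), u⟫ = 0) (hv : ⟪(x : E3), v⟫ = 0) :
    ⟪(x : E3), cross u v⟫ ^ 2 = ⟪u, u⟫ * ⟪v, v⟫ - ⟪u, v⟫ ^ 2 := by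
  have h2 := inner_cross_cross u v u v
  rw [cross_eq_smul x.inner_self hu hv, real_inner_smul_left, real_inner_smul_right,
    x.inner_self, real_inner_comm u v] at h2
  linarith

section Frame

variable {g q : Matrix (Fin 3) (Fin 3) ℝ} {x : S2} {u v : E3}

/-- A change of basis multiplies the Gram determinant by the square of its determinant. -/
lemma det_frame (hg : ∀ u v, form g u v = form g v u) (hu : ⟪(x : E3), u⟫ = 0)
    (hv : ⟪(x : E3), v⟫ = 0) : form g u u * form g v v - form g u v ^ 2 =
      (Matrix.of fun a b => form g (frame x a) (frame x b)).det * ⟪(x : E3), cross u v⟫ ^ 2 := by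
  have h1 := inner_cross_frame_sq x
  rw [← Matrix.det_submatrix_equiv_self (frameEquiv x), Matrix.det_fin_two]
  simp only [Matrix.submatrix_apply, Matrix.of_apply]
  rw [eq_frame_sum hu, eq_frame_sum hv]
  set b0 := (frame x (frameEquiv x 0) : E3)
  set b1 := (frame x (frameEquiv x 1) : E3)
  generalize ⟪b0, u⟫ = α
  generalize ⟪b1, u⟫ = β
  generalize ⟪b0, v⟫ = α'
  generalize ⟪b1, v⟫ = β'
  have h2 : ⟪(x : E3), cross (α • b0 + β • b1) (α' • b0 + β' • b1)⟫ =
      (α * β' - β * α') * ⟪(x : E3), cross b0 b1⟫ := by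
    simp [inner_eq]; ring
  rw [h2, mul_pow, h1]
  simp only [form_add_left, form_add_right, form_smul_left, form_smul_right, hg b1 b0]
  ring

/-- Both sides scale by the squared determinant of the change of basis, which turns the trace in the
frame into an identity for arbitrary tangent vectors. -/
lemma trace_frame (hg : ∀ u v, form g u v = form g v u) (hq : ∀ u v, form q u v = form q v u)
    (hd : (Matrix.of fun a b => form g (frame x a) (frame x b)).det ≠ 0)
    (hu : ⟪(x : E3), u⟫ = 0) (hv : ⟪(x : E3), v⟫ = 0) :
    Matrix.trace ((Matrix.of fun a b => form g (frame x a) (frame x b))⁻¹ *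
      (Matrix.of fun a b => form q (frame x a) (frame x b))) *
        (form g u u * form g v v - form g u v ^ 2) =
      form q u u * form g v v + form q v v * form g u u - 2 * form q u v * form g u v := by
  rw [trace_inv_mul_submatrix (frameEquiv x), det_frame hg hu hv, div_mul_eq_mul_div,
    div_eq_iff hd, mul_comm (Matrix.det _), ← mul_assoc]
  congr 1
  have h1 := inner_cross_frame_sq x
  simp only [Matrix.of_apply]
  rw [eq_frame_sum hu, eq_frame_sum hv]
  set b0 := (frame x (frameEquiv x 0) : E3)
  set b1 := (frame x (frameEquiv x 1) : E3)
  generalize ⟪b0, u⟫ = α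
  generalize ⟪b1, u⟫ = β
  generalize ⟪b0, v⟫ = α'
  generalize ⟪b1, v⟫ = β'
  have h2 : ⟪(x : E3), cross (α • b0 + β • b1) (α' • b0 + β' • b1)⟫ =
      (α * β' - β * α') * ⟪(x : E3), cross b0 b1⟫ := by
    simp [inner_eq]; ring
  rw [h2, mul_pow, h1]
  simp only [form_add_left, form_add_right, form_smul_left, form_smul_right, hg b1 b0, hq b1 b0]
  ring

lemma inner_cross_sub_proj (x : S2) (u v : E3) : ⟪(x : E3), cross (u - ⟪(x : E3), u⟫ • (x : E3))
    (v - ⟪(x : E3), v⟫ • (x : E3))⟫ = ⟪(x : E3), cross u v⟫ := by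
  simp [inner_eq]; ring

lemma inner_sub_proj (x : S2) (u : E3) : ⟪(x : E3), u - ⟪(x : E3), u⟫ • (x : E3)⟫ = 0 := by
  rw [inner_sub_right, real_inner_smul_right, x.inner_self]; ring

lemma form_sub_proj (h : ∀ w, form g (x : E3) w = 0) (hg : ∀ u v, form g u v = form g v u) (u v : E3) :
    form g (u - ⟪(x : E3), u⟫ • (x : E3)) (v - ⟪(x : E3), v⟫ • (x : E3)) = form g u v := by
  simp only [form_sub_left, form_sub_right, form_smul_left, form_smul_right, h, hg _ (x : E3)]
  ring

end Frame

namespace IsLocalRep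

variable {κ : ℝ} {s : Set E3} {G : E3 → Matrix (Fin 3) (Fin 3) ℝ} {f m : S2 → E3}
    {γ A : S2 → E3 → E3 → ℝ} {x : S2}

lemma trace_meanCurv (h : IsLocalRep κ s G f m γ A x) {a : ℝ} (ha : 0 < a)
    (harea : ∀ u v, γ x u u * γ x v v - γ x u v ^ 2 = a ^ 2 * ⟪(x : E3), cross u v⟫ ^ 2) (u v : E3) :
    meanCurv s G f (m x) x * (γ x u u * γ x v v - γ x u v ^ 2) =
    A x u u * γ x v v + A x v v * γ x u u - 2 * A x u v * γ x u v := by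
  set g : Matrix (Fin 3) (Fin 3) ℝ := Matrix.of fun i j => γ x (stdVec i) (stdVec j)
  set q : Matrix (Fin 3) (Fin 3) ℝ := Matrix.of fun i j => A x (stdVec i) (stdVec j)
  have hg : ∀ u v, γ x u v = form g u v := h.first_eq_form
  have hq : ∀ u v, A x u v = form q u v := h.second_eq_form
  have hgs : ∀ u v, form g u v = form g v u := fun u v => by rw [← hg, ← hg, h.first_symm]
  have hqs : ∀ u v, form q u v = form q v u := fun u v => by rw [← hq, ← hq, h.second_symm]
  have e1 : (Matrix.of fun a b => form (G (f x)) (sD f x (frame x a)) (sD f x (frame x b))) =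
      Matrix.of fun a b => form g (frame x a) (frame x b) := by
    ext i j
    simp only [Matrix.of_apply]
    rw [← hg, h.first.self_of_nhds]
  have e2 : (Matrix.of fun a b => secondFF s G f (m x) x (frame x a) (frame x b)) =
      Matrix.of fun a b => form q (frame x a) (frame x b) := by
    ext i j
    simp only [Matrix.of_apply]
    rw [← hq, h.second.self_of_nhds]
  have hd : (Matrix.of fun a b => form g (frame x a) (frame x b)).det ≠ 0 := by
    intro h0
    have h1 := det_frame (x := x) hgs (inner_frame x (frameEquiv x 0)) (inner_frame x (frameEquiv x 1))
    rw [h0, ← hg, ← hg, ← hg, harea, inner_cross_frame_sq] at h1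
    nlinarith
  rw [meanCurv, e1, e2]
  simp only [hg, hq]
  have gx : ∀ w, form g (x : E3) w = 0 := fun w => by rw [← hg, h.first_self]
  have qx : ∀ w, form q (x : E3) w = 0 := fun w => by rw [← hq, h.second_self_left]
  have := trace_frame hgs hqs hd (inner_sub_proj x u) (inner_sub_proj x v)
  simpa only [form_sub_proj gx hgs, form_sub_proj qx hqs] using this

end IsLocalRep

/-! ### Regularity of unit normals -/

/-- A unit normal field to a `C²` field of planes is of class `C²`. -/
lemma contDiffAt_normal {s : Set E3} {G : E3 → Matrix (Fin 3) (Fin 3) ℝ} {F N n : E3 → E3} {y : E3}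
    (hM : IsMetricOn s G) (hF : ContDiffAt ℝ 2 F y) (hFs : ∀ᶠ z in 𝓝 y, F z ∈ s)
    (hN : ContDiffAt ℝ 2 N y) (hnn : ∀ᶠ z in 𝓝 y, form (G (F z)) (n z) (n z) = 1)
    (hnN : ∀ᶠ z in 𝓝 y, ∀ w, ⟪N z, w⟫ = 0 → form (G (F z)) (n z) w = 0)
    (hpos : ∀ᶠ z in 𝓝 y, 0 < ⟪N z, n z⟫) : ContDiffAt ℝ 2 n y := by
  -- `W` is the `G`-dual of the covector `⟨N, ·⟩`, a `C²` normal field that is not normalized.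
  set W : E3 → E3 := fun z => WithLp.toLp 2 fun i => ∑ j, (G (F z))⁻¹ i j * N z j with hW
  have hN' : ∀ i, ContDiffAt ℝ 2 (fun z => N z i) y := contDiffAt_euclidean.1 hN
  have hWs : ContDiffAt ℝ 2 W y := by
    rw [contDiffAt_euclidean]
    intro i
    change ContDiffAt ℝ 2 (fun z => ∑ j, (G (F z))⁻¹ i j * N z j) y
    exact ContDiffAt.sum fun j _ => (contDiffAt_comp_of_mem (contDiffOn_inv_apply hM.contDiffOn
      (fun x hx => (hM.posDef x hx).det_pos.ne') i j _ hFs.self_of_nhds) hF hFs).mul (hN' j)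
  have hGs : ∀ i j, ContDiffAt ℝ 2 (fun z => G (F z) i j) y := fun i j =>
    contDiffAt_comp_of_mem (hM.contDiffOn i j _ hFs.self_of_nhds) hF hFs
  have hWf : ∀ z, F z ∈ s → ∀ w, form (G (F z)) (W z) w = ⟪N z, w⟫ := by
    intro z hz w
    have hinv : ∀ m l, ∑ k, G (F z) k m * (G (F z))⁻¹ k l = if m = l then 1 else 0 := by
      intro m l
      have h1 : G (F z) * (G (F z))⁻¹ = 1 := Matrix.mul_nonsing_inv _ (hM.posDef _ hz).det_pos.ne'.isUnit
      have h2 := congrFun (congrFun h1 m) l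
      rw [Matrix.mul_apply, Matrix.one_apply] at h2
      rw [← h2]
      exact Finset.sum_congr rfl fun k _ => by rw [hM.symm hz k m]
    have h3 : form (G (F z)) (W z) w =
        ∑ m, ∑ l, (∑ k, G (F z) k m * (G (F z))⁻¹ k l) * N z l * w m := by
      simp only [form, hW, Fin.sum_univ_three]; ring
    rw [h3]
    simp [hinv, inner_eq, Fin.sum_univ_three]
  have hW0 : ∀ z, F z ∈ s → N z ≠ 0 → 0 < form (G (F z)) (W z) (W z) := by
    intro z hz hNz
    refine form_pos _ _ (hM.posDef _ hz) fun h0 => hNz ?_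
    have := hWf z hz (N z)
    rw [h0, form_zero_left] at this
    exact inner_self_eq_zero.1 this.symm
  -- A normal to the plane `N^⊥` is a multiple of `W`; the length and the sign condition force `n =
  -- W/|W|`.
  have key : n =ᶠ[𝓝 y] fun z => (Real.sqrt (form (G (F z)) (W z) (W z)))⁻¹ • W z := by
    filter_upwards [hFs, hnn, hnN, hpos] with z hz h1 h2 h3
    have hNz : N z ≠ 0 := by
      intro h0; rw [h0, inner_zero_left] at h3; exact h3.false
    have hNN : ⟪N z, N z⟫ ≠ 0 := (real_inner_self_pos.2 hNz).ne'
    set c := form (G (F z)) (n z) (N z) / ⟪N z, N z⟫ with hc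
    have h4 : n z = c • W z := by
      refine eq_of_form_eq _ _ _ (hM.posDef _ hz) fun w => ?_
      rw [form_smul_left, hWf z hz]
      -- Removing the `N`-component of `w` leaves a vector of the plane, to which `n` is normal.
      have h5 := h2 (w - (⟪N z, w⟫ / ⟪N z, N z⟫) • N z) (by
        rw [inner_sub_right, real_inner_smul_right]; field_simp; ring)
      rw [form_sub_right, form_smul_right] at h5
      rw [hc]
      field_simp at h5 ⊢
      linarith
    have hpW := hW0 z hz hNz
    rw [h4, ← hWf z hz, form_smul_right] at h3
    have hcpos : 0 < c := pos_of_mul_pos_left h3 hpW.le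
    rw [h4, form_smul_left, form_smul_right] at h1
    rw [h4]
    congr 1
    apply eq_inv_of_mul_eq_one_left
    have h6 : (c * Real.sqrt (form (G (F z)) (W z) (W z))) ^ 2 = 1 := by
      rw [mul_pow, Real.sq_sqrt hpW.le]; linarith
    have h7 : 0 ≤ c * Real.sqrt (form (G (F z)) (W z) (W z)) := by positivity
    nlinarith
  refine ContDiffAt.congr_of_eventuallyEq ?_ key
  have hNy : N y ≠ 0 := by
    intro h0
    have := hpos.self_of_nhds
    rw [h0, inner_zero_left] at this; exact this.false
  have h8 := hW0 y hFs.self_of_nhds hNy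
  exact (((contDiffAt_form hGs hWs hWs).sqrt h8.ne').inv (Real.sqrt_pos.2 h8).ne').smul hWs

/-! ### Manifold differentiability versus radial extensions -/

section Manifold

lemma fact_finrank : Fact (Module.finrank ℝ E3 = 2 + 1) := ⟨by simp⟩

lemma contMDiff_coe {n : ℕ∞ω} : ContMDiff (𝓡 2) 𝓘(ℝ, E3) n (fun x : S2 => (x : E3)) :=
  haveI := fact_finrank
  contMDiff_coe_sphere

/-- Off the origin the normalization is smooth into ℝ³ with values in the sphere, so it is smooth
into the submanifold. -/
lemma contMDiffAt_radialProj {n : ℕ∞ω} {y : E3} (hy : y ≠ 0) :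
    ContMDiffAt 𝓘(ℝ, E3) (𝓡 2) n radialProj y := by
  let U : TopologicalSpace.Opens E3 := ⟨{0}ᶜ, isOpen_compl_singleton⟩
  have h1 : ContMDiff 𝓘(ℝ, E3) 𝓘(ℝ, E3) n (fun z : U => (radialProj z : E3)) := fun z =>
    contMDiffAt_subtype_iff.2 (contDiffAt_radialProj z.2).contMDiffAt
  have := fact_finrank
  have h2 : ContMDiff 𝓘(ℝ, E3) (𝓡 2) n (fun z : U => radialProj z) :=
    h1.codRestrict_sphere (n := 2) (fun z => (radialProj (z : E3)).2)
  exact contMDiffAt_subtype_iff.1 (h2 (⟨y, hy⟩ : U))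

variable {V : Type*} [NormedAddCommGroup V] [NormedSpace ℝ V]

lemma contMDiff_of_hom {n : ℕ∞ω} {f : S2 → V} (h : ∀ x : S2, ContDiffAt ℝ n (hom f) (x : E3)) :
    ContMDiff (𝓡 2) 𝓘(ℝ, V) n f := by
  intro x
  have h1 := (h x).contMDiffAt.comp x (contMDiff_coe x)
  refine h1.congr_of_eventuallyEq (Eventually.of_forall fun z => by simp)

lemma contDiffAt_hom {n : ℕ∞ω} {f : S2 → V} {x : S2} (h : ContMDiffAt (𝓡 2) 𝓘(ℝ, V) n f x) :
    ContDiffAt ℝ n (hom f) (x : E3) := by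
  have h0 : ContMDiffAt (𝓡 2) 𝓘(ℝ, V) n f (radialProj (x : E3)) := by rwa [radialProj_coe]
  exact (h0.comp (x : E3) (contMDiffAt_radialProj x.ne_zero)).contDiffAt

end Manifold

/-! ### Gradients of height functions are conformal Killing -/

section Gradient

/-- The gradient on the round sphere of the height function `⟪a, ·⟫`. -/
def heightGrad (a : E3) (x : S2) : E3 := a - ⟪a, (x : E3)⟫ • (x : E3)

lemma inner_heightGrad (a : E3) (x : S2) : ⟪(x : E3), heightGrad a x⟫ = 0 := by
  rw [heightGrad, real_inner_comm (x : E3) a]; exact inner_sub_proj x a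

lemma contDiffAt_heightGrad {n : ℕ∞ω} (a : E3) (x : S2) :
    ContDiffAt ℝ n (hom (heightGrad a)) (x : E3) := by
  have h := contDiffAt_radialProj (n := n) x.ne_zero
  exact contDiffAt_const.sub ((contDiffAt_const.inner ℝ h).smul h)

lemma hasFDerivAt_coe_radialProj (x : S2) : HasFDerivAt (fun z => (radialProj z : E3))
    (ContinuousLinearMap.id ℝ E3 - (innerSL ℝ (x : E3)).smulRight (x : E3)) (x : E3) := by
  obtain ⟨L, hL, hL'⟩ := hasFDerivAt_radialProj x.ne_zero
  convert! hL using 1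
  ext1 u
  rw [hL', x.norm_eq]
  simp

lemma sD_heightGrad (a : E3) (x : S2) {u : E3} (hu : ⟪(x : E3), u⟫ = 0) :
    sD (heightGrad a) x u = - ⟪a, u⟫ • (x : E3) - ⟪a, (x : E3)⟫ • u := by
  have h := hasFDerivAt_coe_radialProj x
  have h1 := ((hasFDerivAt_const a (x : E3)).inner ℝ h).smul h
  have h2 : HasFDerivAt (hom (heightGrad a)) _ (x : E3) := (hasFDerivAt_const a (x : E3)).sub h1
  rw [sD_eq, h2.fderiv]
  simp [hu, fderivInnerCLM_apply]
  abel

/-- On tangent vectors the derivative of the gradient is `-⟨a,x⟩` times the identity, up to a normal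
part. Hence the Lie derivative of the round metric has factor `-2⟨a,x⟩`, and the conformal factor
adds `X(ρ)/ρ`. -/
lemma isKilling_heightGrad {γ : S2 → E3 → E3 → ℝ} {ρ : S2 → ℝ} (hρ : ∀ x, 0 < ρ x)
    (hρd : ∀ x : S2, DifferentiableAt ℝ (hom ρ) (x : E3))
    (hγ : ∀ x u v, γ x u v = ρ x * (⟪u, v⟫ - ⟪(x : E3), u⟫ * ⟪(x : E3), v⟫)) (a : E3) :
    IsKilling γ (heightGrad a) where
  smooth x := contDiffAt_heightGrad a x
  tangent x := inner_heightGrad a x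
  conformal x := by
    refine ⟨(sD ρ x (heightGrad a x) - 2 * ρ x * ⟪a, (x : E3)⟫) / ρ x, fun u v hu hv => ?_⟩
    have h := hasFDerivAt_coe_radialProj x
    have h1 := (h.inner ℝ (hasFDerivAt_const u (x : E3))).mul (h.inner ℝ (hasFDerivAt_const v (x : E3)))
    have h2 := (hρd x).hasFDerivAt.mul (h1.const_sub ⟪u, v⟫)
    have h3 : HasFDerivAt (hom fun z => γ z u v) _ (x : E3) :=
      h2.congr_of_eventuallyEq (Eventually.of_forall fun y => by simp [hom, hγ])
    have h4 : sD (fun z => γ z u v) x (heightGrad a x) = sD ρ x (heightGrad a x) * ⟪u, v⟫ := by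
      rw [sD_eq, h3.fderiv, sD_eq]
      simp [hu, hv]
      ring
    rw [h4, sD_heightGrad a x hu, sD_heightGrad a x hv, hγ, hγ, hγ]
    have h5 := (hρ x).ne'
    simp only [inner_sub_left, inner_sub_right, real_inner_smul_left, real_inner_smul_right, hu, hv,
      x.inner_self, real_inner_comm (x : E3) u]
    field_simp
    ring

end Gradient

/-! ### Monotone functions of a height function -/

section Monotone

lemma inner_meridian {a b : E3} (ha : ‖a‖ = 1) (hab : ⟪a, b⟫ = 0) (t : ℝ) :
    ⟪a, Real.cos t • a + Real.sin t • b⟫ = Real.cos t := by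
  rw [inner_add_right, real_inner_smul_right, real_inner_smul_right, hab,
    real_inner_self_eq_norm_sq, ha]
  ring

lemma norm_meridian {a b : E3} (ha : ‖a‖ = 1) (hb : ‖b‖ = 1) (hab : ⟪a, b⟫ = 0) (t : ℝ) :
    Real.cos t • a + Real.sin t • b ∈ sphere (0 : E3) 1 := by
  have h1 : ‖Real.cos t • a + Real.sin t • b‖ ^ 2 = 1 := by
    have haa : ⟪a, a⟫ = 1 := by rw [real_inner_self_eq_norm_sq, ha]; norm_num
    have hbb : ⟪b, b⟫ = 1 := by rw [real_inner_self_eq_norm_sq, hb]; norm_num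
    rw [← real_inner_self_eq_norm_sq]
    simp only [inner_add_left, inner_add_right, real_inner_smul_left, real_inner_smul_right, hab,
      real_inner_comm a b, haa, hbb]
    linarith [Real.cos_sq_add_sin_sq t]
  rw [mem_sphere_zero_iff_norm]
  nlinarith [norm_nonneg (Real.cos t • a + Real.sin t • b)]

/-- A point on a meridian of the sphere with pole `a`. -/
def meridian {a b : E3} (ha : ‖a‖ = 1) (hb : ‖b‖ = 1) (hab : ⟪a, b⟫ = 0) (t : ℝ) : S2 :=
  ⟨Real.cos t • a + Real.sin t • b, norm_meridian ha hb hab t⟩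

lemma exists_meridian {a : E3} (ha : ‖a‖ = 1) (x : S2) : ∃ (b : E3) (hb : ‖b‖ = 1) (hab : ⟪a, b⟫ = 0),
    ∃ t ∈ Icc 0 Real.pi, x = meridian ha hb hab t := by
  set h := ⟪a, (x : E3)⟫ with hh
  have habs : |h| ≤ 1 := by
    have := abs_real_inner_le_norm a (x : E3)
    rwa [ha, x.norm_eq, mul_one] at this
  have ht : Real.arccos h ∈ Icc 0 Real.pi := ⟨Real.arccos_nonneg _, Real.arccos_le_pi _⟩
  have hcos : Real.cos (Real.arccos h) = h := Real.cos_arccos (abs_le.1 habs).1 (abs_le.1 habs).2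
  have hsin : Real.sin (Real.arccos h) = Real.sqrt (1 - h ^ 2) := Real.sin_arccos h
  have hn : ‖(x : E3) - h • a‖ ^ 2 = 1 - h ^ 2 := by
    rw [norm_sub_sq_real, real_inner_smul_right, real_inner_comm a, ← hh, norm_smul, ha, x.norm_eq,
      Real.norm_eq_abs, mul_one, sq_abs]
    ring
  have hn' : ‖(x : E3) - h • a‖ = Real.sqrt (1 - h ^ 2) := by
    rw [← hn, Real.sqrt_sq (norm_nonneg _)]
  by_cases h0 : (x : E3) - h • a = 0
  -- At the poles `±a` every meridian qualifies; any unit vector tangent at `a` serves as its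
  -- direction.
  · have ha' : a ∈ sphere (0 : E3) 1 := by simpa using ha
    let i : Fin (Module.finrank ℝ (ℝ ∙ a)ᗮ) := frameEquiv ⟨a, ha'⟩ 0
    refine ⟨frame ⟨a, ha'⟩ i, ?_, inner_frame ⟨a, ha'⟩ i, Real.arccos h, ht, ?_⟩
    · exact (frame ⟨a, ha'⟩).orthonormal.1 i
    · ext1
      rw [h0, norm_zero] at hn'
      simp only [meridian, hcos, hsin, ← hn', zero_smul, add_zero]
      exact sub_eq_zero.1 h0
  · have hne : ‖(x : E3) - h • a‖ ≠ 0 := norm_ne_zero_iff.2 h0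
    refine ⟨‖(x : E3) - h • a‖⁻¹ • ((x : E3) - h • a), ?_, ?_, Real.arccos h, ht, ?_⟩
    · rw [norm_smul, norm_inv, norm_norm, inv_mul_cancel₀ hne]
    · rw [real_inner_smul_right, inner_sub_right, real_inner_smul_right, real_inner_self_eq_norm_sq, ha,
        ← hh]
      ring
    · ext1
      simp only [meridian, hcos, hsin, ← hn', smul_smul, mul_inv_cancel₀ hne, one_smul]
      abel

lemma hasDerivAt_meridian {H : S2 → ℝ} (hH : ∀ x : S2, DifferentiableAt ℝ (hom H) (x : E3)) {a b : E3}
    (ha : ‖a‖ = 1) (hb : ‖b‖ = 1) (hab : ⟪a, b⟫ = 0) (t : ℝ) :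
    HasDerivAt (fun t => H (meridian ha hb hab t))
      (sD H (meridian ha hb hab t) (-Real.sin t • a + Real.cos t • b)) t := by
  have h1 : HasDerivAt (fun t => Real.cos t • a + Real.sin t • b)
      (-Real.sin t • a + Real.cos t • b) t :=
    ((Real.hasDerivAt_cos t).smul_const a).add ((Real.hasDerivAt_sin t).smul_const b)
  have h2 := (hH (meridian ha hb hab t)).hasFDerivAt.comp_hasDerivAt_of_eq t h1 rfl
  refine h2.congr_of_eventuallyEq (Eventually.of_forall fun t => ?_)
  exact (hom_coe H (meridian ha hb hab t)).symm

lemma heightGrad_meridian {a b : E3} (ha : ‖a‖ = 1) (hb : ‖b‖ = 1) (hab : ⟪a, b⟫ = 0) (t : ℝ) :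
    heightGrad a (meridian ha hb hab t) = -Real.sin t • (-Real.sin t • a + Real.cos t • b) := by
  have h1 : ⟪a, (meridian ha hb hab t : E3)⟫ = Real.cos t := inner_meridian ha hab t
  rw [heightGrad, h1]
  simp only [meridian, smul_add, smul_smul]
  have h2 : a = (Real.cos t ^ 2 + Real.sin t ^ 2) • a := by rw [Real.cos_sq_add_sin_sq, one_smul]
  nth_rewrite 1 [h2]
  module

/-- No differentiability of `f` is needed: `H` is differentiable and non-increasing along each
meridian from `a`, and the gradient is `-sin t` times the meridian's velocity. At the poles it
vanishes. -/
lemma sD_heightGrad_nonneg {H : S2 → ℝ} (hH : ∀ x : S2, DifferentiableAt ℝ (hom H) (x : E3)) {a : E3}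
    (ha : ‖a‖ = 1) {f : ℝ → ℝ} (hf : MonotoneOn f (Icc (-1) 1)) (hHf : ∀ x : S2, H x = f ⟪a, (x : E3)⟫)
    (x : S2) : 0 ≤ sD H x (heightGrad a x) := by
  obtain ⟨b, hb, hab, t, ht, rfl⟩ := exists_meridian ha x
  rw [heightGrad_meridian]
  rcases eq_or_lt_of_le ht.1 with h0 | h0
  · simp [← h0, sD]
  rcases eq_or_lt_of_le ht.2 with h1 | h1
  · simp [h1, sD]
  have hs := Real.sin_pos_of_pos_of_lt_pi h0 h1
  have hd := hasDerivAt_meridian hH ha hb hab t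
  have hanti : AntitoneOn (fun t => H (meridian ha hb hab t)) (Icc 0 Real.pi) := by
    intro t1 ht1 t2 ht2 h12
    have e : ∀ t, ⟪a, (meridian ha hb hab t : E3)⟫ = Real.cos t := fun t => inner_meridian ha hab t
    simp only [hHf, e]
    exact hf ⟨Real.neg_one_le_cos _, Real.cos_le_one _⟩ ⟨Real.neg_one_le_cos _, Real.cos_le_one _⟩
      (Real.strictAntiOn_cos.antitoneOn ht1 ht2 h12)
  have h2 : sD H (meridian ha hb hab t) (-Real.sin t • a + Real.cos t • b) ≤ 0 := by
    rw [← hd.deriv, ← derivWithin_of_mem_nhds (Icc_mem_nhds h0 h1)]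
    exact hanti.derivWithin_nonpos
  have h3 : sD H (meridian ha hb hab t) (-Real.sin t • (-Real.sin t • a + Real.cos t • b)) =
      -Real.sin t * sD H (meridian ha hb hab t) (-Real.sin t • a + Real.cos t • b) := by
    simp only [sD]
    rw [map_smul, smul_eq_mul]
  rw [h3]
  nlinarith

/-- The mean value theorem along a meridian: at an interior point `sin t > 0`, so the derivative of
`H` along the meridian vanishes. Every value is thus the value at the pole. -/
lemma eq_const_of_sD_heightGrad {H : S2 → ℝ} (hH : ∀ x : S2, DifferentiableAt ℝ (hom H) (x : E3)) {a : E3}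
    (ha : ‖a‖ = 1) (h0 : ∀ x : S2, sD H x (heightGrad a x) = 0) (x : S2) :
    H x = H ⟨a, by simpa using ha⟩ := by
  obtain ⟨b, hb, hab, t, ht, rfl⟩ := exists_meridian ha x
  have e0 : (⟨a, by simpa using ha⟩ : S2) = meridian ha hb hab 0 := by
    ext1; simp [meridian]
  rw [e0]
  rcases eq_or_lt_of_le ht.1 with h1 | h1
  · rw [← h1]
  have hd := hasDerivAt_meridian hH ha hb hab
  obtain ⟨c, hc, hc'⟩ := exists_hasDerivAt_eq_slope (fun t => H (meridian ha hb hab t)) _ h1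
    (fun t _ => (hd t).continuousAt.continuousWithinAt) (fun t _ => hd t)
  have hs := Real.sin_pos_of_pos_of_lt_pi hc.1 (hc.2.trans_le ht.2)
  have h2 := h0 (meridian ha hb hab c)
  rw [heightGrad_meridian] at h2
  simp only [sD] at h2 hc'
  rw [map_smul, smul_eq_mul, hc', mul_eq_zero] at h2
  have h3 := h2.resolve_left (by linarith)
  rw [div_eq_zero_iff] at h3
  have h4 := h3.resolve_right (by linarith)
  linarith

/-- A continuous non-negative function with zero integral vanishes, since the area measure charges
all non-empty open sets. -/
lemma sD_eq_zero_of_integral {H w : S2 → ℝ} (hH : ∀ x : S2, ContDiffAt ℝ 1 (hom H) (x : E3))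
    (hw : Continuous w) (hw0 : ∀ x, 0 < w x) {a : E3} (hnn : ∀ x, 0 ≤ sD H x (heightGrad a x))
    (hint : ∫ x, sD H x (heightGrad a x) * w x ∂roundArea = 0) (x : S2) :
    sD H x (heightGrad a x) = 0 := by
  have hop : Measure.IsOpenPosMeasure roundArea :=
    inferInstanceAs (Measure.IsOpenPosMeasure (Measure.toSphere _))
  have hcX : Continuous (heightGrad a) :=
    continuous_of_hom fun x => (contDiffAt_heightGrad (n := 1) a x).continuousAt
  have hc : Continuous fun x => sD H x (heightGrad a x) * w x :=
    ((continuous_sD hH).clm_apply hcX).mul hw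
  rw [integral_eq_zero_iff_of_nonneg (fun x => mul_nonneg (hnn x) (hw0 x).le)
    (integrable_of_continuous hc)] at hint
  have h1 := (Continuous.ae_eq_iff_eq roundArea hc (continuous_const (y := (0 : ℝ)))).1 hint
  exact (mul_eq_zero.1 (congrFun h1 x)).resolve_right (hw0 x).ne'

/-- The mean curvature of a conformally immersed round sphere is not a monotone non-constant
function of a height function. -/
theorem IsSurface.not_isMonotoneOfHeight {κ : ℝ} {γ A : S2 → E3 → E3 → ℝ} {H w ρ : S2 → ℝ}
    (h : IsSurface κ γ A H w) (hρ : ∀ x, 0 < ρ x)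
    (hγ : ∀ x u v, γ x u v = ρ x * (⟪u, v⟫ - ⟪(x : E3), u⟫ * ⟪(x : E3), v⟫)) :
    ¬ IsMonotoneOfHeight H := by
  rintro ⟨⟨x, y, hxy⟩, a, ha, f, hf, hHf⟩
  -- The trace of `γ` over the standard basis is `2ρ`, so `ρ` inherits differentiability from `γ`.
  have hρd : ∀ x : S2, DifferentiableAt ℝ (hom ρ) (x : E3) := by
    intro x
    have h1 := fun i => (h.contDiffAt_first x (stdVec i) (stdVec i)).differentiableAt one_ne_zero
    refine (((h1 0).add ((h1 1).add (h1 2))).const_mul (1 / 2)).congr_of_eventuallyEq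
      (Eventually.of_forall fun y => ?_)
    have h2 := (radialProj y).inner_self
    rw [inner_eq] at h2
    simp only [hom, Pi.add_apply, hγ, inner_eq]
    simp
    linear_combination (1 / 2) * ρ (radialProj y) * h2
  have hH := h.contDiffAt_meanCurv
  have hHd : ∀ x : S2, DifferentiableAt ℝ (hom H) (x : E3) := fun x => (hH x).differentiableAt one_ne_zero
  have hw : Continuous w := continuous_of_hom fun x => (h.contDiffAt_area x).continuousAt
  have hint := (h.balancing (isKilling_heightGrad hρ hρd hγ a)).2
  have key : ∀ x : S2, sD H x (heightGrad a x) = 0 := by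
    rcases hf with hf | hf
    · exact sD_eq_zero_of_integral hH hw h.area_pos (sD_heightGrad_nonneg hHd ha hf hHf) hint
    · have hneg : ∀ x u, sD (fun z => - H z) x u = - sD H x u := fun x u => by
        have : (hom fun z => - H z) = fun y => - hom H y := rfl
        rw [sD_eq, this, fderiv_fun_neg, sD_eq]; rfl
      have h1 := sD_eq_zero_of_integral (H := fun z => - H z) (a := a) (fun x => (hH x).neg) hw h.area_pos
        (sD_heightGrad_nonneg (H := fun z => - H z) (fun x => (hHd x).neg) ha hf.neg (fun x => by simp [hHf]))
        (by simp_rw [hneg, neg_mul]; rw [integral_neg, hint, neg_zero])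
      intro x
      have := h1 x
      rw [hneg] at this
      linarith
  exact hxy ((eq_const_of_sD_heightGrad hHd ha key x).trans
    (eq_const_of_sD_heightGrad hHd ha key y).symm)

end Monotone

/-! ### The boundary of a ball of constant curvature -/

section

/-- The first fundamental form of `∂B³`, extended by zero to the normal direction. -/
def ballFirst (G : E3 → Matrix (Fin 3) (Fin 3) ℝ) (x : S2) (u v : E3) : ℝ :=
  form (G x) (u - ⟪(x : E3), u⟫ • (x : E3)) (v - ⟪(x : E3), v⟫ • (x : E3))

/-- The second fundamental form of `∂B³`. -/
def ballSecond (G : E3 → Matrix (Fin 3) (Fin 3) ℝ) (ν : S2 → E3) (x : S2) (u v : E3) : ℝ :=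
  secondFF B3 G (fun y : S2 => (y : E3)) (ν x) x u v

lemma ballFirst_tangent {G : E3 → Matrix (Fin 3) (Fin 3) ℝ} {x : S2} {u v : E3}
    (hu : ⟪(x : E3), u⟫ = 0) (hv : ⟪(x : E3), v⟫ = 0) : ballFirst G x u v = form (G x) u v := by
  simp [ballFirst, hu, hv]

variable {G : E3 → Matrix (Fin 3) (Fin 3) ℝ} {ν : S2 → E3} {κ : ℝ}

lemma S2.mem_B3 (x : S2) : (x : E3) ∈ B3 := sphere_subset_closedBall x.2

lemma IsConstCurvMetricOnBall.isMetricOn (hG : IsConstCurvMetricOnBall G κ) : IsMetricOn B3 G where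
  uniqueDiffOn := uniqueDiffOn_convex (convex_closedBall _ _) (by
    rw [interior_closedBall _ one_ne_zero]; exact nonempty_ball.2 one_pos)
  subset_closure := by
    rw [interior_closedBall _ one_ne_zero, closure_ball _ one_ne_zero]
  contDiffOn := hG.contDiffOn
  posDef := hG.posDef

/-- The outward condition selects the sign, with the position vector as Euclidean normal; no
continuity of `ν` is assumed. -/
lemma contDiffAt_outwardNormal (hG : IsConstCurvMetricOnBall G κ) (hν : IsOutwardUnitNormal G ν)
    (x : S2) : ContDiffAt ℝ 2 (hom ν) (x : E3) := by
  have hs : ContDiffAt ℝ 2 (hom fun y : S2 => (y : E3)) (x : E3) := contDiffAt_radialProj x.ne_zero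
  exact contDiffAt_normal (F := hom fun y : S2 => (y : E3)) (N := hom fun y : S2 => (y : E3))
    hG.isMetricOn hs (Eventually.of_forall fun z => (radialProj z).mem_B3) hs
    (Eventually.of_forall fun z => hν.unit (radialProj z))
    (Eventually.of_forall fun z w hw => hν.normal (radialProj z) w hw)
    (Eventually.of_forall fun z => hν.outward (radialProj z))

lemma isLocalRep_ball (hG : IsConstCurvMetricOnBall G κ) (hν : IsOutwardUnitNormal G ν) (x : S2) :
    IsLocalRep κ B3 G (fun y : S2 => (y : E3)) ν (ballFirst G) (ballSecond G ν) x where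
  metric := hG.isMetricOn
  curv := hG.constCurv
  smooth := contDiffAt_radialProj x.ne_zero
  normal_smooth := contDiffAt_outwardNormal hG hν x
  mem := Eventually.of_forall fun z => z.mem_B3
  unit := Eventually.of_forall fun z => hν.unit z
  normal := Eventually.of_forall fun z u => by
    rw [sD_coe]; exact hν.normal z _ (inner_sub_proj z u)
  first := Eventually.of_forall fun z u v => by rw [sD_coe, sD_coe]; rfl
  second := Eventually.of_forall fun z u v => rfl

/-- Cauchy–Schwarz: positivity on `m(b₀,b₀) b₁ - m(b₀,b₁) b₀` is positivity of `m(b₀,b₀)` times the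
Gram determinant. -/
lemma det_frame_pos {m : Matrix (Fin 3) (Fin 3) ℝ} (hm : m.PosDef) (x : S2) :
    0 < (Matrix.of fun a b => form m (frame x a) (frame x b)).det := by
  have hs := fun a b => form_symm_of_posDef m a b hm
  have h0 := inner_frame x (frameEquiv x 0)
  have h1 := inner_frame x (frameEquiv x 1)
  have h2 := det_frame hs h0 h1
  rw [inner_cross_frame_sq, mul_one] at h2
  rw [← h2]
  have ho : ∀ i j, ⟪(frame x i : E3), (frame x j : E3)⟫ = if i = j then 1 else 0 := fun i j =>
    orthonormal_iff_ite.1 (frame x).orthonormal i j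
  set b0 : E3 := (frame x (frameEquiv x 0) : E3)
  set b1 : E3 := (frame x (frameEquiv x 1) : E3)
  have h00 : ⟪b0, b0⟫ = 1 := by rw [ho, if_pos rfl]
  have h11 : ⟪b1, b1⟫ = 1 := by rw [ho, if_pos rfl]
  have h10 : ⟪b1, b0⟫ = 0 := by rw [ho, if_neg (by simp)]
  have hb0 : b0 ≠ 0 := by
    intro h; rw [h, inner_zero_left] at h00; exact zero_ne_one h00
  have p0 := form_pos m b0 hm hb0
  have hw : form m b0 b0 • b1 - form m b0 b1 • b0 ≠ 0 := by
    intro h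
    have := congrArg (fun w => ⟪b1, w⟫) h
    simp only [inner_sub_right, real_inner_smul_right, h11, h10, inner_zero_right, mul_one, mul_zero,
      sub_zero] at this
    exact p0.ne' this
  have p1 := form_pos m _ hm hw
  simp only [form_sub_left, form_sub_right, form_smul_left, form_smul_right, hs b1 b0] at p1
  have p2 : 0 < form m b0 b0 * (form m b0 b0 * form m b1 b1 - form m b0 b1 ^ 2) := by
    convert p1 using 1; ring
  exact (pos_iff_pos_of_mul_pos p2).1 p0

lemma isSurface_ball (hG : IsConstCurvMetricOnBall G κ) (hν : IsOutwardUnitNormal G ν) :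
    IsSurface κ (ballFirst G) (ballSecond G ν) (boundaryMeanCurv G ν) (areaDensity G) := by
  have hpos : ∀ x : S2, 0 < areaDensity G x := fun x =>
    Real.sqrt_pos.2 (det_frame_pos (hG.posDef _ x.mem_B3) x)
  have harea : ∀ (x : S2) (u v : E3), ballFirst G x u u * ballFirst G x v v - ballFirst G x u v ^ 2 =
      areaDensity G x ^ 2 * ⟪(x : E3), cross u v⟫ ^ 2 := by
    intro x u v
    have h1 := det_frame (fun a b => form_symm_of_posDef (G x) a b (hG.posDef _ x.mem_B3))
      (inner_sub_proj x u) (inner_sub_proj x v)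
    rw [inner_cross_sub_proj] at h1
    rw [areaDensity, Real.sq_sqrt (det_frame_pos (hG.posDef _ x.mem_B3) x).le, ← h1]
    rfl
  exact ⟨fun x => ⟨_, _, _, _, isLocalRep_ball hG hν x⟩,
    fun x u v => (isLocalRep_ball hG hν x).trace_meanCurv (hpos x) (harea x) u v, hpos, harea⟩

/-- `ballFirst` contains the tangential projection. The derivatives of that projection cancel the
normal components of the derivatives of `X`, which are found by differentiating `⟨x, X⟩ = 0`. -/
lemma isKilling_ball (hG : IsConstCurvMetricOnBall G κ) {X : S2 → E3}
    (hX : IsConformalKilling G X) : IsKilling (ballFirst G) X where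
  smooth x := contDiffAt_hom (hX.contMDiff x)
  tangent := hX.tangent
  conformal x := by
    obtain ⟨μ, hμ⟩ := hX.conformal
    refine ⟨μ x, fun u v hu hv => ?_⟩
    rw [ballFirst_tangent hu hv, ← hμ x u v hu hv, lieDeriv]
    have hsm : ContDiffAt ℝ 2 (hom fun y : S2 => (y : E3)) (x : E3) := contDiffAt_radialProj x.ne_zero
    have hXd : DifferentiableAt ℝ (hom X) (x : E3) :=
      (contDiffAt_hom (hX.contMDiff x)).differentiableAt one_ne_zero
    have hs := fun a b => form_symm_of_posDef (G x) a b (hG.posDef _ x.mem_B3)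
    have hGd : ∀ i j, DifferentiableAt ℝ (fun y => G (radialProj y) i j) (x : E3) := fun i j =>
      (contDiffAt_comp_of_mem (F := hom fun y : S2 => (y : E3)) (hG.contDiffOn i j _
        (radialProj (x : E3)).mem_B3) hsm (Eventually.of_forall fun z =>
          (radialProj z).mem_B3)).differentiableAt two_ne_zero
    have h := hasFDerivAt_coe_radialProj x
    have hP : ∀ u : E3, ∃ L : E3 →L[ℝ] E3, HasFDerivAt (fun y => u - ⟪(radialProj y : E3), u⟫ •
        (radialProj y : E3)) L (x : E3) ∧ (⟪(x : E3), u⟫ = 0 → L (X x) = - ⟪X x, u⟫ • (x : E3)) := by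
      intro u
      have h1 := (hasFDerivAt_const u (x : E3)).sub ((h.inner ℝ (hasFDerivAt_const u (x : E3))).smul h)
      refine ⟨_, h1, fun hu => ?_⟩
      simp [hu, hX.tangent, fderivInnerCLM_apply]
    obtain ⟨Lu, hLu, hLu'⟩ := hP u
    obtain ⟨Lv, hLv, hLv'⟩ := hP v
    obtain ⟨f1, hf1, hf1'⟩ := form_hasFDerivWithinAt (t := univ) (M := fun y => G (radialProj y))
      (fun i j => (hGd i j).hasFDerivAt.hasFDerivWithinAt) hLu.hasFDerivWithinAt hLv.hasFDerivWithinAt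
    obtain ⟨f2, hf2, hf2'⟩ := form_hasFDerivWithinAt (t := univ) (M := fun y => G (radialProj y))
      (fun i j => (hGd i j).hasFDerivAt.hasFDerivWithinAt) (hasFDerivWithinAt_const u _ _)
      (hasFDerivWithinAt_const v _ _)
    have e1 : sD (fun z => ballFirst G z u v) x (X x) = f1 (X x) := by
      rw [← (hasFDerivWithinAt_univ.1 hf1).fderiv]; rfl
    have e2 : sD (fun z : S2 => form (G z) u v) x (X x) = f2 (X x) := by
      rw [← (hasFDerivWithinAt_univ.1 hf2).fderiv]; rfl
    have e3 : ∀ u, ⟪(x : E3), u⟫ = 0 → ⟪(x : E3), sD X x u⟫ = - ⟪u, X x⟫ := by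
      intro u hu
      have h1 := h.inner ℝ hXd.hasFDerivAt
      have h2 : HasFDerivAt (fun y => ⟪(radialProj y : E3), hom X y⟫) (0 : E3 →L[ℝ] ℝ) (x : E3) :=
        (hasFDerivAt_const (0 : ℝ) (x : E3)).congr_of_eventuallyEq
          (Eventually.of_forall fun y => hX.tangent (radialProj y))
      have h3 := congrArg (fun L : E3 →L[ℝ] ℝ => L u) (h1.unique h2)
      simp [fderivInnerCLM_apply, hu] at h3
      rw [sD_eq]
      linarith
    rw [e1, e2, hf1', hf2', hLu' hu, hLv' hv, ballFirst, ballFirst, e3 u hu, e3 v hv]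
    simp only [radialProj_coe, hu, hv, zero_smul, sub_zero, zero_apply, form_zero_left, form_zero_right,
      add_zero, form_smul_left, form_smul_right, form_sub_left, form_sub_right,
      real_inner_comm (X x)]
    ring

end

lemma not_isMonotoneOfHeight_boundaryMeanCurv {κ : ℝ} {G : E3 → Matrix (Fin 3) (Fin 3) ℝ}
    {ν : S2 → E3} (hG : IsConstCurvMetricOnBall G κ) (hν : IsOutwardUnitNormal G ν)
    (hc : IsConformalToRound G) : ¬ IsMonotoneOfHeight (boundaryMeanCurv G ν) := by
  obtain ⟨ρ, hρ, h⟩ := hc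
  refine (isSurface_ball hG hν).not_isMonotoneOfHeight hρ fun x u v => ?_
  rw [ballFirst, h x _ _ (inner_sub_proj x u) (inner_sub_proj x v)]
  simp only [inner_sub_left, inner_sub_right, real_inner_smul_left, real_inner_smul_right,
    x.inner_self, real_inner_comm (x : E3) u]
  ring

/-! ### Riemannian metrics in charts -/

section Chart

variable {N : Type*} [TopologicalSpace N] [ChartedSpace E3 N] [IsManifold (𝓡 3) ∞ N]
  {φ : OpenPartialHomeomorph N E3}

lemma isManifold_one (N : Type*) [TopologicalSpace N] [ChartedSpace E3 N] [IsManifold (𝓡 3) ∞ N] :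
    IsManifold (𝓡 3) 1 N :=
  IsManifold.of_le (n := ∞) (by norm_cast)

lemma contMDiffOn_symm (hφ : φ ∈ atlas E3 N) : ContMDiffOn (𝓡 3) (𝓡 3) ∞ φ.symm φ.target :=
  contMDiffOn_symm_of_mem_maximalAtlas (IsManifold.subset_maximalAtlas hφ)

lemma contMDiffOn_chart (hφ : φ ∈ atlas E3 N) : ContMDiffOn (𝓡 3) (𝓡 3) ∞ φ φ.source :=
  contMDiffOn_of_mem_maximalAtlas (IsManifold.subset_maximalAtlas hφ)

lemma mdifferentiable_chart (hφ : φ ∈ atlas E3 N) : φ.MDifferentiable (𝓡 3) (𝓡 3) :=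
  haveI := isManifold_one N
  mdifferentiable_of_mem_atlas hφ

/-- A coordinate field is the tangent map of the inverse chart applied to a constant field; this
gives the regularity of the metric coefficients. -/
lemma contMDiffAt_coordVec (hφ : φ ∈ atlas E3 N) {y : E3} (hy : y ∈ φ.target) (e : E3) :
    ContMDiffAt (𝓡 3) (𝓡 3).tangent 2 (fun z : E3 =>
      (⟨φ.symm z, mfderiv (𝓡 3) (𝓡 3) φ.symm z e⟩ : TangentBundle (𝓡 3) N)) y := by
  have := isManifold_one N
  have h1 : ContMDiffOn (𝓡 3).tangent (𝓡 3).tangent 2 (tangentMapWithin (𝓡 3) (𝓡 3) φ.symm φ.target)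
      (Bundle.TotalSpace.proj ⁻¹' φ.target) :=
    (contMDiffOn_symm hφ).contMDiffOn_tangentMapWithin (by norm_cast) φ.open_target.uniqueMDiffOn
  have h2 : ContMDiff (𝓡 3) (𝓡 3).tangent 2 (fun z : E3 => (⟨z, e⟩ : TangentBundle (𝓡 3) E3)) :=
    fun z => contMDiffAt_vectorSpace_iff_contDiffAt.2 contDiffAt_const
  have h3 := (h1.contMDiffAt (x := (⟨y, e⟩ : TangentBundle (𝓡 3) E3)) 
    ((φ.open_target.preimage (FiberBundle.continuous_proj E3 _)).mem_nhds hy)).comp y h2.contMDiffAt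
  refine h3.congr_of_eventuallyEq ?_
  filter_upwards [φ.open_target.mem_nhds hy] with z hz
  simp only [Function.comp_def, tangentMapWithin]
  rw [mfderivWithin_of_isOpen φ.open_target hz]

lemma contDiffOn_metricInChart (g : SmoothMetric N) (hφ : φ ∈ atlas E3 N) (i j : Fin 3) :
    ContDiffOn ℝ 2 (fun y => metricInChart g φ y i j) φ.target := by
  intro y hy
  have h1 : ContMDiffAt (𝓡 3) _ 2 _ y := (g.contMDiff.of_le (by norm_cast)).contMDiffAt.comp y
    (((contMDiffOn_symm hφ).contMDiffAt (φ.open_target.mem_nhds hy)).of_le (by norm_cast))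
  have h2 := ContMDiffAt.clm_bundle_apply₂ (F₁ := E3) (F₂ := E3) (E₁ := fun p : N => TangentSpace (𝓡 3) p)
    (E₂ := fun p : N => TangentSpace (𝓡 3) p) (E₃ := Bundle.Trivial N ℝ) h1
    (contMDiffAt_coordVec hφ hy (EuclideanSpace.single i (1 : ℝ)))
    (contMDiffAt_coordVec hφ hy (EuclideanSpace.single j (1 : ℝ)))
  have h3 := (Bundle.contMDiffAt_totalSpace.1 h2).2
  exact h3.contDiffAt.contDiffWithinAt

/-- The inner product on tangent vectors, in the model space. -/
def modelInner (g : SmoothMetric N) (p : N) : E3 →L[ℝ] E3 →L[ℝ] ℝ := g.inner p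

/-- The differential of a chart. -/
def dChart (φ : OpenPartialHomeomorph N E3) (p : N) : E3 →L[ℝ] E3 := mfderiv (𝓡 3) (𝓡 3) φ p

/-- The differential of the inverse of a chart. -/
def dChartSymm (φ : OpenPartialHomeomorph N E3) (y : E3) : E3 →L[ℝ] E3 :=
  mfderiv (𝓡 3) (𝓡 3) φ.symm y

lemma form_metricInChart (g : SmoothMetric N) (φ : OpenPartialHomeomorph N E3) (y u v : E3) :
    form (metricInChart g φ y) u v =
      modelInner g (φ.symm y) (dChartSymm φ y u) (dChartSymm φ y v) := by
  have h := fun w : E3 => (EuclideanSpace.basisFun (Fin 3) ℝ).sum_repr w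
  simp only [EuclideanSpace.basisFun_repr, EuclideanSpace.basisFun_apply] at h
  have key : ∀ (B : E3 →L[ℝ] E3 →L[ℝ] ℝ) (L : E3 →L[ℝ] E3), form (Matrix.of fun i j =>
      B (L (EuclideanSpace.single i 1)) (L (EuclideanSpace.single j 1))) u v = B (L u) (L v) := by
    intro B L
    conv_rhs => rw [← h u, ← h v]
    simp [form, Fin.sum_univ_three]
    ring
  exact key _ _

lemma dChartSymm_dChart (hφ : φ ∈ atlas E3 N) {p : N} (hp : p ∈ φ.source) (v : E3) :
    dChartSymm φ (φ p) (dChart φ p v) = v :=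
  congrArg (fun L : E3 →L[ℝ] E3 => L v) ((mdifferentiable_chart hφ).symm_comp_deriv hp)

lemma form_metricInChart_chart (g : SmoothMetric N) (hφ : φ ∈ atlas E3 N) {p : N} (hp : p ∈ φ.source)
    (u v : E3) :
    form (metricInChart g φ (φ p)) (dChart φ p u) (dChart φ p v) = modelInner g p u v := by
  rw [form_metricInChart, dChartSymm_dChart hφ hp, dChartSymm_dChart hφ hp, φ.left_inv hp]

lemma isMetricOn_metricInChart (g : SmoothMetric N) (hφ : φ ∈ atlas E3 N) :
    IsMetricOn φ.target (metricInChart g φ) where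
  uniqueDiffOn := φ.open_target.uniqueDiffOn
  subset_closure := by rw [φ.open_target.interior_eq]; exact subset_closure
  contDiffOn := contDiffOn_metricInChart g hφ
  posDef y hy := by
    refine Matrix.PosDef.of_dotProduct_mulVec_pos ?_ fun u hu => ?_
    · ext i j
      exact g.symm _ _ _
    · have h1 := form_metricInChart g φ y (WithLp.toLp 2 u) (WithLp.toLp 2 u)
      rw [form_eq_dotProduct] at h1
      change 0 < u ⬝ᵥ _
      refine lt_of_lt_of_eq (g.pos _ _ fun h0 => hu ?_) h1.symm
      have h2 := (mdifferentiable_chart hφ).symm.mfderiv_injective hy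
      have h3 := h2 (h0.trans (map_zero _).symm)
      exact congrArg WithLp.ofLp h3

end Chart

/-! ### Invariance under change of coordinates -/

section ChangeOfCoordinates

variable {s s' : Set E3} {G G' : E3 → Matrix (Fin 3) (Fin 3) ℝ} {ψ : E3 → E3}

/-- The transformation law of Christoffel symbols. The pulled-back connection is symmetric and
compatible with the metric, and the Koszul formula determines such a connection. -/
lemma form_christoffelVec_of_isometry (hM : IsMetricOn s G) (hM' : IsMetricOn s' G') {p : E3}
    (hs : s ∈ 𝓝 p) (hs' : ∀ᶠ y in 𝓝 p, ψ y ∈ s') (hψ : ContDiffAt ℝ 2 ψ p)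
    (hG : ∀ᶠ y in 𝓝 p, ∀ v w, form (G y) v w = form (G' (ψ y)) (fderiv ℝ ψ y v) (fderiv ℝ ψ y w))
    (a b w : E3) : form (G p) (christoffelVec s G p a b) w = form (G' (ψ p))
      (cov s' G' ψ (fun y => fderiv ℝ ψ y b) p a) (fderiv ℝ ψ p w) := by
  have hp := mem_of_mem_nhds hs
  have hd := fun v => hasFDerivAt_fderiv_apply hψ v
  set B : E3 → E3 → E3 := fun a b => cov s' G' ψ (fun y => fderiv ℝ ψ y b) p a with hB
  have hB' : ∀ a b, B a b = B b a := by
    intro a b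
    simp only [hB, cov]
    rw [(hd _).fderiv, (hd _).fderiv, christoffelVec_symm hM' hs'.self_of_nhds,
      ContinuousLinearMap.flip_apply, ContinuousLinearMap.flip_apply, fderiv_fderiv_symm hψ]
  have hs2 := fun u v => form_symm_of_posDef (G' (ψ p)) u v (hM'.posDef _ hs'.self_of_nhds)
  have key : ∀ a v w, form (dMat s G p a) v w = form (G' (ψ p)) (B a v) (fderiv ℝ ψ p w) +
      form (G' (ψ p)) (fderiv ℝ ψ p v) (B a w) := by
    intro a v w
    obtain ⟨f, hf, hf'⟩ := hasFDerivAt_form_comp hM' (hψ.differentiableAt two_ne_zero) hs'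
      (hd v).differentiableAt (hd w).differentiableAt
    obtain ⟨f2, hf2, hf2'⟩ := form_hasFDerivWithinAt (t := s) (x := p) (M := G)
      (fun i j => ((hM.contDiffOn i j).differentiableOn two_ne_zero _ hp).hasFDerivWithinAt)
      (hasFDerivWithinAt_const v _ _) (hasFDerivWithinAt_const w _ _)
    have h1 := hf.unique ((hf2.hasFDerivAt hs).congr_of_eventuallyEq
      (hG.mono fun y hy => (hy v w).symm))
    rw [hB, ← hf', h1, hf2']
    simp [dMat]
  rw [form_christoffelVec hM hp, key, key, key, hB' b a, hB' w a, hB' w b, hs2 (fderiv ℝ ψ p b),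
    hs2 (fderiv ℝ ψ p a)]
  ring

/-- The Hessian of `ψ` produced by the chain rule is exactly the inhomogeneous term in the
transformation law of the Christoffel symbols. -/
lemma secondFF_of_isometry (hM : IsMetricOn s G) (hM' : IsMetricOn s' G') {f : S2 → E3} {x : S2}
    (hf : ContDiffAt ℝ 2 (hom f) (x : E3)) (hs : s ∈ 𝓝 (f x)) (hs' : ∀ᶠ y in 𝓝 (f x), ψ y ∈ s')
    (hψ : ContDiffAt ℝ 2 ψ (f x)) (hG : ∀ᶠ y in 𝓝 (f x), ∀ v w,
      form (G y) v w = form (G' (ψ y)) (fderiv ℝ ψ y v) (fderiv ℝ ψ y w)) (n u v : E3) :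
    secondFF s' G' (fun z => ψ (f z)) (fderiv ℝ ψ (f x) n) x u v = secondFF s G f n x u v := by
  have hx : hom f (x : E3) = f x := hom_coe f x
  rw [← hx] at hψ
  have hψ1 : ∀ᶠ y in 𝓝 (x : E3), DifferentiableAt ℝ ψ (hom f y) := by
    have := hψ.eventually (by simp)
    filter_upwards [hf.continuousAt.eventually this] with y hy
    exact hy.differentiableAt two_ne_zero
  have hf1 : ∀ᶠ y in 𝓝 (x : E3), DifferentiableAt ℝ (hom f) y :=
    (hf.eventually (by simp)).mono fun y hy => hy.differentiableAt two_ne_zero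
  have hD : ∀ᶠ y in 𝓝 (x : E3), ∀ u, fderiv ℝ (hom fun z => ψ (f z)) y u =
      fderiv ℝ ψ (hom f y) (fderiv ℝ (hom f) y u) := by
    filter_upwards [hψ1, hf1] with y h1 h2 u
    have : (hom fun z => ψ (f z)) = ψ ∘ hom f := rfl
    rw [this, fderiv_comp y h1 h2]; rfl
  have e1 : ∀ u, sD (fun z => ψ (f z)) x u = fderiv ℝ ψ (f x) (sD f x u) := by
    intro u
    rw [sD_eq, hD.self_of_nhds, hx, sD_eq]
  have e2 : sD2 (fun z => ψ (f z)) x u v = fderiv ℝ (fderiv ℝ ψ) (f x) (sD f x v) (sD f x u) +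
      fderiv ℝ ψ (f x) (sD2 f x u v) := by
    have h1 : HasFDerivAt (fun y => fderiv ℝ ψ (hom f y)) _ (x : E3) :=
      ((hψ.fderiv_right (m := 1) (by norm_num)).differentiableAt one_ne_zero).hasFDerivAt.comp
        (x : E3) (hf.differentiableAt two_ne_zero).hasFDerivAt
    have h2 := h1.clm_apply (hasFDerivAt_fderiv_apply hf u)
    have h3 := h2.congr_of_eventuallyEq (hD.mono fun y hy => hy u)
    change fderiv ℝ (fun y => fderiv ℝ (hom fun z => ψ (f z)) y u) (x : E3) v = _
    rw [h3.fderiv]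
    simp only [hx, add_apply, ContinuousLinearMap.comp_apply, ContinuousLinearMap.flip_apply]
    rw [add_comm]
    congr 2
    exact congrArg (fun L : E3 →L[ℝ] E3 => L v) (hasFDerivAt_fderiv_apply hf u).fderiv.symm
  rw [hx] at hψ
  have h1 := form_christoffelVec_of_isometry hM hM' hs hs' hψ hG (sD f x u) (sD f x v) n
  rw [cov, (hasFDerivAt_fderiv_apply hψ _).fderiv, ContinuousLinearMap.flip_apply,
    fderiv_fderiv_symm hψ] at h1
  rw [secondFF, secondFF, e1, e1, e2, add_right_comm, form_add_left, ← h1,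
    ← hG.self_of_nhds, ← form_add_left, add_comm (sD2 f x u v)]

end ChangeOfCoordinates

/-! ### The unit normal of a conformal immersion -/

lemma inner_cross_self_smul (a b w : E3) : ⟪cross a b, cross a b⟫ • w =
    (⟪w, a⟫ * ⟪b, b⟫ - ⟪w, b⟫ * ⟪a, b⟫) • a + (⟪w, b⟫ * ⟪a, a⟫ - ⟪w, a⟫ * ⟪a, b⟫) • b
      + ⟪cross a b, w⟫ • cross a b := by
  ext i
  simp only [PiLp.add_apply, PiLp.smul_apply, smul_eq_mul, inner_eq]
  fin_cases i <;> simp <;> ring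

lemma inner_self_smul_of_cross_eq_zero {a b : E3} (h : cross a b = 0) : ⟪a, a⟫ • b = ⟪a, b⟫ • a := by
  have h1 := cross_cross a a b
  rw [h, cross_zero_right] at h1
  exact (sub_eq_zero.1 h1.symm).symm

/-- A continuous unit normal field to a conformally parametrized surface is of class `C²`. -/
lemma contDiffAt_normal_of_continuousAt {s : Set E3} {G : E3 → Matrix (Fin 3) (Fin 3) ℝ}
    {f m : S2 → E3} {x : S2} {r : ℝ} (hM : IsMetricOn s G) (hf : ContDiffAt ℝ 3 (hom f) (x : E3))
    (hm : ContinuousAt m x) (hmem : ∀ᶠ z in 𝓝 x, f z ∈ s)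
    (hunit : ∀ᶠ z in 𝓝 x, form (G (f z)) (m z) (m z) = 1)
    (hnormal : ∀ᶠ z in 𝓝 x, ∀ u, form (G (f z)) (m z) (sD f z u) = 0) (hr : 0 < r)
    (hfirst : ∀ u v, form (G (f x)) (sD f x u) (sD f x v) =
      r * (⟪u, v⟫ - ⟪(x : E3), u⟫ * ⟪(x : E3), v⟫)) : ContDiffAt ℝ 2 (hom m) (x : E3) := by
  set e0 : E3 := (frame x (frameEquiv x 0) : E3) with he0
  set e1 : E3 := (frame x (frameEquiv x 1) : E3) with he1
  have ho : ∀ i j, ⟪(frame x i : E3), (frame x j : E3)⟫ = if i = j then 1 else 0 := fun i j =>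
    orthonormal_iff_ite.1 (frame x).orthonormal i j
  set N : E3 → E3 := fun z => cross (fderiv ℝ (hom f) z e0) (fderiv ℝ (hom f) z e1) with hN
  have hd : ∀ b, ContDiffAt ℝ 2 (fun z => fderiv ℝ (hom f) z b) (x : E3) := fun b =>
    (hf.fderiv_right (m := 2) (by norm_num)).clm_apply contDiffAt_const
  have hNs : ContDiffAt ℝ 2 N (x : E3) := ContDiffAt.cross (hd e0) (hd e1)
  have span : ∀ (M : Matrix (Fin 3) (Fin 3) ℝ) (n a b w : E3), form M n a = 0 → form M n b = 0 →
      cross a b ≠ 0 → ⟪cross a b, w⟫ = 0 → form M n w = 0 := by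
    intro M n a b w ha hb hab hw
    have h1 := congrArg (form M n) (inner_cross_self_smul a b w)
    rw [form_smul_right, form_add_right, form_add_right, form_smul_right, form_smul_right, ha, hb,
      hw, zero_smul, form_zero_right] at h1
    simpa [hab] using h1
  -- A vanishing cross product would make the two images parallel, but they are `G`-orthogonal of
  -- squared length `r`.
  have hNx : N x ≠ 0 := by
    intro h0
    have h1 := inner_self_smul_of_cross_eq_zero h0
    have f00 := hfirst e0 e0
    have f01 := hfirst e1 e0
    have f11 := hfirst e1 e1
    rw [inner_frame, ho] at f00 f01 f11
    simp only [if_true, mul_zero, sub_zero, mul_one, sD_eq] at f00 f01 f11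
    rw [if_neg (by simp), zero_sub, zero_mul, neg_zero, mul_zero] at f01
    set a := fderiv ℝ (hom f) (x : E3) e0
    set b := fderiv ℝ (hom f) (x : E3) e1
    have h2 := congrArg (fun w => form (G (f x)) w a) h1
    simp only [form_smul_left, f01, f00, mul_zero] at h2
    have h3 : ⟪a, b⟫ = 0 := (mul_eq_zero.1 h2.symm).resolve_right hr.ne'
    rw [h3, zero_smul, smul_eq_zero, inner_self_eq_zero] at h1
    rcases h1 with h1 | h1
    · rw [h1, form_zero_left] at f00; exact hr.ne f00
    · rw [h1, form_zero_left] at f11; exact hr.ne f11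
  -- Otherwise `m x` would be tangent to the surface and hence `G`-orthogonal to itself.
  have hc : ⟪N x, m x⟫ ≠ 0 := by
    intro h0
    have h1 := span (G (f x)) (m x) _ _ (m x) (hnormal.self_of_nhds e0) (hnormal.self_of_nhds e1) hNx h0
    rw [hunit.self_of_nhds] at h1
    exact one_ne_zero h1
  have hmc : ContinuousAt (hom m) (x : E3) := by
    have h1 := continuousAt_radialProj x.ne_zero
    refine ContinuousAt.comp (f := radialProj) ?_ h1
    rwa [radialProj_coe]
  have hNe : ∀ᶠ z in 𝓝 (x : E3), N z ≠ 0 := hNs.continuousAt.eventually_ne hNx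
  have hdf : ∀ᶠ z in 𝓝 (x : E3), DifferentiableAt ℝ (hom f) (radialProj z : E3) :=
    eventually_radialProj (eventually_coe ((hf.eventually (by simp)).mono fun y hy =>
      hy.differentiableAt (by norm_num)))
  -- The constant factor `⟨N x, m x⟩` fixes the sign of `N` at `x`, and continuity of `m` preserves
  -- the sign nearby.
  refine contDiffAt_normal (N := fun z => ⟪N x, m x⟫ • N z) hM (hf.of_le (by norm_num))
    (eventually_radialProj hmem) (hNs.const_smul _) (eventually_radialProj hunit) ?_ ?_
  · filter_upwards [eventually_radialProj hnormal, hNe, hdf, isOpen_ne.mem_nhds x.ne_zero]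
      with z h1 h2 h3 hz w hw
    rw [real_inner_smul_left] at hw
    refine span _ _ _ _ w ?_ ?_ h2 ((mul_eq_zero.1 hw).resolve_left hc)
    · rw [fderiv_hom hz h3, form_smul_right]
      exact mul_eq_zero_of_right _ (h1 e0)
    · rw [fderiv_hom hz h3, form_smul_right]
      exact mul_eq_zero_of_right _ (h1 e1)
  · have h1 : Tendsto (fun z => ⟪N x, m x⟫ * ⟪N z, hom m z⟫) (𝓝 (x : E3))
        (𝓝 (⟪N x, m x⟫ * ⟪N x, m x⟫)) := by
      have h2 := Tendsto.inner (𝕜 := ℝ) hNs.continuousAt.tendsto hmc.tendsto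
      rw [hom_coe] at h2
      exact h2.const_mul _
    filter_upwards [h1.eventually (lt_mem_nhds (mul_self_pos.2 hc))] with z hz
    rwa [real_inner_smul_left]

lemma secondFF_congr {s : Set E3} {G : E3 → Matrix (Fin 3) (Fin 3) ℝ} {f f' : S2 → E3} {x : S2}
    (h : f =ᶠ[𝓝 x] f') (n u v : E3) : secondFF s G f n x u v = secondFF s G f' n x u v := by
  have h1 : hom f =ᶠ[𝓝 (x : E3)] hom f' := eventually_radialProj h
  have e1 : ∀ u, sD f x u = sD f' x u := fun u =>
    congrArg (fun L : E3 →L[ℝ] E3 => L u) h1.fderiv_eq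
  have e2 : sD2 f x u v = sD2 f' x u v := by
    have h2 : (fun y => fderiv ℝ (hom f) y u) =ᶠ[𝓝 (x : E3)] fun y => fderiv ℝ (hom f') y u :=
      h1.fderiv.mono fun y hy => congrArg (fun L : E3 →L[ℝ] E3 => L u) hy
    exact congrArg (fun L : E3 →L[ℝ] E3 => L v) h2.fderiv_eq
  rw [secondFF, secondFF, e1, e1, e2, h.self_of_nhds]

/-! ### Conformal immersions of the round sphere -/

section Immersion

variable {N : Type*} [TopologicalSpace N] [ChartedSpace E3 N] [IsManifold (𝓡 3) ∞ N]
  {φ φ' : OpenPartialHomeomorph N E3} {g : SmoothMetric N} {F : S2 → N} {x : S2}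

/-- Transition maps are isometries between the coordinate metrics. -/
lemma secondFF_chart (hφ : φ ∈ atlas E3 N) (hφ' : φ' ∈ atlas E3 N) (hF : ContinuousAt F x)
    (hx : F x ∈ φ.source) (hx' : F x ∈ φ'.source) (hf : ContDiffAt ℝ 2 (hom fun z => φ (F z)) (x : E3))
    (n u v : E3) :
    secondFF φ'.target (metricInChart g φ') (fun z => φ' (F z)) (dChart φ' (F x) n) x u v =
      secondFF φ.target (metricInChart g φ) (fun z => φ (F z)) (dChart φ (F x) n) x u v := by
  set ψ : E3 → E3 := fun y => φ' (φ.symm y) with hψ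
  have hU : ∀ᶠ y in 𝓝 (φ (F x)), y ∈ φ.target ∧ φ.symm y ∈ φ'.source := by
    refine Filter.Eventually.and (φ.open_target.mem_nhds (φ.map_source hx)) ?_
    refine (φ.continuousAt_symm (φ.map_source hx)).eventually (φ'.open_source.mem_nhds ?_)
    rwa [φ.left_inv hx]
  have hsm : ContDiffAt ℝ 2 ψ (φ (F x)) := by
    have h1 := (contMDiffOn_symm hφ).contMDiffAt (φ.open_target.mem_nhds (φ.map_source hx))
    have h2 : ContMDiffAt (𝓡 3) (𝓡 3) ∞ φ' (φ.symm (φ (F x))) := by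
      rw [φ.left_inv hx]
      exact (contMDiffOn_chart hφ').contMDiffAt (φ'.open_source.mem_nhds hx')
    exact (h2.comp _ h1).contDiffAt.of_le (by norm_cast)
  have hD : ∀ y ∈ φ.target, φ.symm y ∈ φ'.source → ∀ v,
      fderiv ℝ ψ y v = dChart φ' (φ.symm y) (dChartSymm φ y v) := by
    intro y hy hy' v
    have h1 := mfderiv_comp (I := 𝓡 3) (I' := 𝓡 3) (I'' := 𝓡 3) y
      ((mdifferentiable_chart hφ').mdifferentiableAt hy')
      ((mdifferentiable_chart hφ).mdifferentiableAt_symm hy)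
    have h2 : fderiv ℝ ψ y = (dChart φ' (φ.symm y)).comp (dChartSymm φ y) :=
      mfderiv_eq_fderiv.symm.trans h1
    rw [h2]; rfl
  have h1 := secondFF_of_isometry (f := fun z => φ (F z)) (ψ := ψ) (isMetricOn_metricInChart g hφ)
    (isMetricOn_metricInChart g hφ') hf (φ.open_target.mem_nhds (φ.map_source hx))
    (hU.mono fun y hy => φ'.map_source hy.2) hsm (hU.mono fun y hy v w => by
      rw [hD y hy.1 hy.2, hD y hy.1 hy.2, form_metricInChart_chart g hφ' hy.2, form_metricInChart])
    (dChart φ (F x) n) u v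
  rw [hD _ (φ.map_source hx) (by rwa [φ.left_inv hx]), dChartSymm_dChart hφ hx, φ.left_inv hx] at h1
  rw [← h1]
  refine secondFF_congr ?_ _ u v
  filter_upwards [hF.eventually (φ.open_source.mem_nhds hx)] with z hz
  simp only [hψ]
  rw [φ.left_inv hz]

/-- The differential of a map from the sphere, in the model space. -/
def dSphere (F : S2 → N) (x : S2) : EuclideanSpace ℝ (Fin 2) →L[ℝ] E3 := mfderiv (𝓡 2) (𝓡 3) F x

/-- The differential of the radial projection at a point of the sphere. -/
def dRadial (x : S2) : E3 →L[ℝ] EuclideanSpace ℝ (Fin 2) :=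
  mfderiv 𝓘(ℝ, E3) (𝓡 2) radialProj (x : E3)

lemma hasFDerivAt_hom {f : S2 → E3} {L : EuclideanSpace ℝ (Fin 2) →L[ℝ] E3}
    (h : HasMFDerivAt (𝓡 2) 𝓘(ℝ, E3) f x L) : HasFDerivAt (hom f) (L.comp (dRadial x)) (x : E3) := by
  have h0 : ∀ y : S2, y = x → HasMFDerivAt (𝓡 2) 𝓘(ℝ, E3) f y L := by
    rintro y rfl; exact h
  have h1 : HasMFDerivAt 𝓘(ℝ, E3) (𝓡 2) radialProj (x : E3) (dRadial x) :=
    ((contMDiffAt_radialProj (n := 1) x.ne_zero).mdifferentiableAt one_ne_zero).hasMFDerivAt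
  exact ((h0 _ (radialProj_coe x)).comp (x : E3) h1).hasFDerivAt

/-- The radial projection is a retraction onto the sphere whose differential is the orthogonal
projection. It converts vectors of ℝ³ into abstract tangent vectors. -/
lemma mfderiv_coe_dRadial (u : E3) :
    (mfderiv (𝓡 2) 𝓘(ℝ, E3) (fun y : S2 => (y : E3)) x : EuclideanSpace ℝ (Fin 2) →L[ℝ] E3)
      (dRadial x u) = u - ⟪(x : E3), u⟫ • (x : E3) := by
  rw [← sD_coe, sD_eq, (hasFDerivAt_hom ((contMDiff_coe (n := 1) x).mdifferentiableAt
    one_ne_zero).hasMFDerivAt).fderiv]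
  rfl

lemma sD_chart (hφ : φ ∈ atlas E3 N) (hF : MDifferentiableAt (𝓡 2) (𝓡 3) F x)
    (hx : F x ∈ φ.source) (u : E3) :
    sD (fun z => φ (F z)) x u = dChart φ (F x) (dSphere F x (dRadial x u)) := by
  have h1 := ((mdifferentiable_chart hφ).mdifferentiableAt hx).hasMFDerivAt.comp x hF.hasMFDerivAt
  exact congrArg (fun L : E3 →L[ℝ] E3 => L u) (hasFDerivAt_hom h1).fderiv

end Immersion

section Immersion

variable {N : Type*} [TopologicalSpace N] [ChartedSpace E3 N] [IsManifold (𝓡 3) ∞ N]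
  {φ : OpenPartialHomeomorph N E3} {g : SmoothMetric N} {F : S2 → N}
  {ν : ∀ x : S2, TangentSpace (𝓡 3) (F x)} {x : S2} {κ : ℝ} {ρ H : S2 → ℝ}

/-- The coordinates of a vector field along `F` in a chart. -/
def chartField (φ : OpenPartialHomeomorph N E3) (ν : ∀ x : S2, TangentSpace (𝓡 3) (F x)) (x : S2) :
    E3 :=
  dChart φ (F x) (ν x)

/-- The second fundamental form of an immersion. -/
def immersionSecond (g : SmoothMetric N) (F : S2 → N) (ν : ∀ x : S2, TangentSpace (𝓡 3) (F x)) (x : S2)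
    (u v : E3) : ℝ :=
  secondFF (chartAt E3 (F x)).target (metricInChart g (chartAt E3 (F x)))
    (fun z => chartAt E3 (F x) (F z)) (chartField (chartAt E3 (F x)) ν x) x u v

/-- The round metric scaled by the conformal factor `ρ`. -/
def conformalForm (ρ : S2 → ℝ) (x : S2) (u v : E3) : ℝ :=
  ρ x * (⟪u, v⟫ - ⟪(x : E3), u⟫ * ⟪(x : E3), v⟫)

/-- In the tangent bundle of the model space the vector component is continuous, and the tangent map
of the chart carries `ν` there. -/
lemma continuousAt_chartField (hφ : φ ∈ atlas E3 N)
    (hν : Continuous fun x : S2 => (⟨F x, ν x⟩ : TangentBundle (𝓡 3) N)) (hx : F x ∈ φ.source) :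
    ContinuousAt (chartField φ ν) x := by
  have := isManifold_one N
  have h1 : ContinuousOn (tangentMapWithin (𝓡 3) (𝓡 3) φ φ.source)
      (Bundle.TotalSpace.proj ⁻¹' φ.source) :=
    (contMDiffOn_chart hφ).continuousOn_tangentMapWithin (by norm_cast) φ.open_source.uniqueMDiffOn
  have ho : IsOpen (Bundle.TotalSpace.proj ⁻¹' φ.source : Set (TangentBundle (𝓡 3) N)) :=
    φ.open_source.preimage (FiberBundle.continuous_proj E3 _)
  have h2 := (h1.continuousAt (x := (⟨F x, ν x⟩ : TangentBundle (𝓡 3) N)) (ho.mem_nhds hx)).comp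
    (f := fun x : S2 => (⟨F x, ν x⟩ : TangentBundle (𝓡 3) N)) hν.continuousAt
  have h3 : Continuous (fun p : TangentBundle (𝓡 3) E3 => (p.2 : E3)) :=
    (contMDiff_snd_tangentBundle_modelSpace (n := 0) E3 (𝓡 3)).continuous
  refine (h3.continuousAt.comp h2).congr ?_
  filter_upwards [(ho.preimage hν).mem_nhds hx] with z hz
  have h4 : mfderivWithin (𝓡 3) (𝓡 3) φ φ.source (F z) = mfderiv (𝓡 3) (𝓡 3) φ (F z) :=
    mfderivWithin_of_isOpen φ.open_source hz
  exact congrArg (fun L : E3 →L[ℝ] E3 => L (ν z)) h4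

lemma modelInner_dSphere (hF : ∀ (x : S2) (u v : TangentSpace (𝓡 2) x),
    g.inner (F x) (mfderiv (𝓡 2) (𝓡 3) F x u) (mfderiv (𝓡 2) (𝓡 3) F x v) =
      ρ x * @inner ℝ E3 _ (mfderiv (𝓡 2) 𝓘(ℝ, E3) (fun y : S2 => (y : E3)) x u)
        (mfderiv (𝓡 2) 𝓘(ℝ, E3) (fun y : S2 => (y : E3)) x v)) (u v : E3) :
    modelInner g (F x) (dSphere F x (dRadial x u)) (dSphere F x (dRadial x v)) =
      conformalForm ρ x u v := by
  have h1 : modelInner g (F x) (dSphere F x (dRadial x u)) (dSphere F x (dRadial x v)) = ρ x *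
      ⟪u - ⟪(x : E3), u⟫ • (x : E3), v - ⟪(x : E3), v⟫ • (x : E3)⟫ := by
    rw [← mfderiv_coe_dRadial, ← mfderiv_coe_dRadial]
    exact hF x (dRadial x u) (dRadial x v)
  rw [h1, conformalForm]
  simp only [inner_sub_left, inner_sub_right, real_inner_smul_left, real_inner_smul_right,
    x.inner_self, real_inner_comm (x : E3) u]
  ring

lemma isLocalRep_immersion (hκ : IsConstCurvMetric g κ) (hF : IsConformalImmersion g F)
    (hν : IsUnitNormalAlong g F ν) (hρ : ∀ x, 0 < ρ x)
    (hc : ∀ (x : S2) (u v : TangentSpace (𝓡 2) x),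
    g.inner (F x) (mfderiv (𝓡 2) (𝓡 3) F x u) (mfderiv (𝓡 2) (𝓡 3) F x v) =
      ρ x * @inner ℝ E3 _ (mfderiv (𝓡 2) 𝓘(ℝ, E3) (fun y : S2 => (y : E3)) x u)
        (mfderiv (𝓡 2) 𝓘(ℝ, E3) (fun y : S2 => (y : E3)) x v))
    (hφ : φ ∈ atlas E3 N) (hx : F x ∈ φ.source) :
    IsLocalRep κ φ.target (metricInChart g φ) (fun z => φ (F z)) (chartField φ ν)
      (conformalForm ρ) (immersionSecond g F ν) x := by
  have hM := isMetricOn_metricInChart g hφ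
  have hFc := hF.contMDiff.continuous
  have hsrc : ∀ᶠ z in 𝓝 x, F z ∈ φ.source := hFc.continuousAt.eventually (φ.open_source.mem_nhds hx)
  have hd : ∀ z, MDifferentiableAt (𝓡 2) (𝓡 3) F z := fun z =>
    (hF.contMDiff z).mdifferentiableAt (by norm_num)
  have hsm : ∀ z, F z ∈ φ.source → ContDiffAt ℝ 3 (hom fun z => φ (F z)) (z : E3) := fun z hz =>
    contDiffAt_hom ((((contMDiffOn_chart hφ).contMDiffAt (φ.open_source.mem_nhds hz)).of_le
      (by norm_cast)).comp z (hF.contMDiff z))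
  have hunit : ∀ z, F z ∈ φ.source →
      form (metricInChart g φ (φ (F z))) (chartField φ ν z) (chartField φ ν z) = 1 := fun z hz =>
    (form_metricInChart_chart g hφ hz _ _).trans (hν.unit z)
  have hnormal : ∀ z, F z ∈ φ.source → ∀ u, form (metricInChart g φ (φ (F z))) (chartField φ ν z)
      (sD (fun z => φ (F z)) z u) = 0 := fun z hz u => by
    rw [sD_chart hφ (hd z) hz]
    exact (form_metricInChart_chart g hφ hz _ _).trans (hν.normal z (dRadial z u))
  have hfirst : ∀ z, F z ∈ φ.source → ∀ u v, conformalForm ρ z u v =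
      form (metricInChart g φ (φ (F z))) (sD (fun z => φ (F z)) z u) (sD (fun z => φ (F z)) z v) :=
    fun z hz u v => by
      rw [sD_chart hφ (hd z) hz, sD_chart hφ (hd z) hz, form_metricInChart_chart g hφ hz,
        modelInner_dSphere hc]
  have hmem : ∀ᶠ z in 𝓝 x, φ (F z) ∈ φ.target := hsrc.mono fun z hz => φ.map_source hz
  exact {
    metric := hM
    curv := hκ φ hφ
    smooth := hsm x hx
    normal_smooth := contDiffAt_normal_of_continuousAt hM (hsm x hx)
      (continuousAt_chartField hφ hν.continuous hx) hmem (hsrc.mono hunit) (hsrc.mono hnormal) (hρ x)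
      (fun u v => (hfirst x hx u v).symm)
    mem := hmem
    unit := hsrc.mono hunit
    normal := hsrc.mono hnormal
    first := hsrc.mono hfirst
    -- At each `z` the form is defined in the preferred chart at `F z`, which varies with `z`;
    -- independence of the chart brings it into the fixed chart `φ`.
    second := hsrc.mono fun z hz u v =>
      secondFF_chart hφ (chart_mem_atlas E3 (F z)) hFc.continuousAt hz (mem_chart_source E3 (F z))
        ((hsm z hz).of_le (by norm_num)) (ν z) u v }

theorem IsConformalImmersion.not_isMonotoneOfHeight (hκ : IsConstCurvMetric g κ)
    (hF : IsConformalImmersion g F) (hν : IsUnitNormalAlong g F ν) (hH : HasMeanCurv g F ν H) :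
    ¬ IsMonotoneOfHeight H := by
  obtain ⟨ρ, hρ, hc⟩ := hF.conformal
  -- In dimension two the area density of `ρ` times the round metric is `ρ` itself.
  have harea : ∀ (x : S2) (u v : E3), conformalForm ρ x u u * conformalForm ρ x v v
      - conformalForm ρ x u v ^ 2 = ρ x ^ 2 * ⟪(x : E3), cross u v⟫ ^ 2 := by
    intro x u v
    rw [← inner_cross_sub_proj x u v, inner_cross_sq (inner_sub_proj x u) (inner_sub_proj x v)]
    simp only [conformalForm, inner_sub_left, inner_sub_right, real_inner_smul_left,
      real_inner_smul_right, x.inner_self, real_inner_comm (x : E3) u, real_inner_comm (x : E3) v]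
    ring
  have hrep := fun x : S2 => isLocalRep_immersion (x := x) hκ hF hν hρ hc (chart_mem_atlas E3 (F x))
    (mem_chart_source E3 (F x))
  have hS : IsSurface κ (conformalForm ρ) (immersionSecond g F ν) H ρ := by
    refine ⟨fun x => ⟨_, _, _, _, hrep x⟩, fun x u v => ?_, hρ, harea⟩
    rw [hH _ (chart_mem_atlas E3 (F x)) x (mem_chart_source E3 (F x))]
    exact (hrep x).trace_meanCurv (hρ x) (harea x) u v
  exact hS.not_isMonotoneOfHeight hρ fun x u v => rfl

end Immersion

end Balancing

end

theorem mainTheorem4 (κ : ℝ) :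
    -- the balancing condition for the boundary data of constant curvature metrics on the ball
    (∀ (G : Balancing.E3 → Matrix (Fin 3) (Fin 3) ℝ) (ν : Balancing.S2 → Balancing.E3),
      Balancing.IsConstCurvMetricOnBall G κ → Balancing.IsOutwardUnitNormal G ν →
      ContMDiff (𝓡 2) 𝓘(ℝ, ℝ) 1 (Balancing.boundaryMeanCurv G ν) ∧
      ∀ X : Balancing.S2 → Balancing.E3, Balancing.IsConformalKilling G X →
        Integrable (fun x => Balancing.sD (Balancing.boundaryMeanCurv G ν) x (X x)
          * Balancing.areaDensity G x) Balancing.roundArea ∧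
        ∫ x, Balancing.sD (Balancing.boundaryMeanCurv G ν) x (X x)
          * Balancing.areaDensity G x ∂Balancing.roundArea = 0) ∧
    -- monotone functions of a height function are not mean curvatures of such metrics
    (∀ (G : Balancing.E3 → Matrix (Fin 3) (Fin 3) ℝ) (ν : Balancing.S2 → Balancing.E3),
      Balancing.IsConstCurvMetricOnBall G κ → Balancing.IsOutwardUnitNormal G ν →
      Balancing.IsConformalToRound G →
      ¬ Balancing.IsMonotoneOfHeight (Balancing.boundaryMeanCurv G ν)) ∧
    -- nor of conformal immersions of the round sphere in space forms
    (∀ (N : Type*) [TopologicalSpace N] [ChartedSpace Balancing.E3 N] [IsManifold (𝓡 3) ∞ N]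
      (g : Balancing.SmoothMetric N) (F : Balancing.S2 → N)
      (ν : ∀ x : Balancing.S2, TangentSpace (𝓡 3) (F x)) (H : Balancing.S2 → ℝ),
      Balancing.IsConstCurvMetric g κ → Balancing.IsConformalImmersion g F →
      Balancing.IsUnitNormalAlong g F ν → Balancing.HasMeanCurv g F ν H →
      ¬ Balancing.IsMonotoneOfHeight H) := by
  refine ⟨fun G ν hG hν => ?_, fun G ν hG hν hc => ?_, ?_⟩
  · exact ⟨Balancing.contMDiff_of_hom (Balancing.isSurface_ball hG hν).contDiffAt_meanCurv,
      fun X hX => (Balancing.isSurface_ball hG hν).balancing (Balancing.isKilling_ball hG hX)⟩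
  · exact Balancing.not_isMonotoneOfHeight_boundaryMeanCurv hG hν hc
  · intro N _ _ _ g F ν H hκ hF hν hH
    exact hF.not_isMonotoneOfHeight hκ hν hH
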